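/- Let $N\ge 1$ and let $\Omega\subset\mathbb R^N$ be a nonempty bounded open Lipschitz set, i.e. every $p\in\partial\Omega$ has an open neighborhood $N_p$ such that $\partial\Omega\cap N_p$ is, after a suitable rotation, the graph of a Lipschitz function (of $N-1$ variables) intersected with $N_p$. For $s\in[0,1)$ let $$\mathbb H^s(\Omega)=\Big\{u\in L^2(\Omega):\int_\Omega\int_\Omega\frac{(u(x)-u(y))^2}{|x-y|^{N+2s}}\,dx\,dy<\infty\Big\},\qquad \mathcal E_s(u,v)=\frac12\int_\Omega\int_\Omega\frac{(u(x)-u(y))(v(x)-v(y))}{|x-y|^{N+2s}}\,dx\,dy .$$ An eigenfunction of $\mathcal D^s_\Omega$ for the eigenvalue $\lambda\in\mathbb R$ is a nonzero $u\in\mathbb H^s(\Omega)$ with $\mathcal E_s(u,v)=\int_\Omega\lambda uv\,dx$ for all $v\in\mathbb H^s(\Omega)$; this is the weak form of $\mathcal D^s_\Omega u=\lambda u$, where $\mathcal D^s_\Omega u(x)=\mathrm{P.V.}\int_\Omega\frac{u(x)-u(y)}{|x-y|^{N+2s}}\,dy$. Let $\lambda_{0,s}\le\lambda_{1,s}\le\lambda_{2,s}\le\cdots$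 be the eigenvalues of $\mathcal D^s_\Omega$ in increasing order, counted with multiplicity; here $\lambda_{0,s}=0$ is simple, so $\lambda_{n,s}$ is the $n$-th nonzero eigenvalue for $n\ge1$. Theorem. Let $n\ge 1$. For every $s\in[0,1)$ the $n$-th nonzero eigenvalue $\lambda_{n,s}$ is well defined and positive: at most $n$ eigenvalues, counted with multiplicity and including $0$, are $<\lambda_{n,s}$, and at least $n+1$ of them are $\le\lambda_{n,s}$. Moreover $$\lambda_{n,s}\to\lambda_{n,0}\qquad\text{as } s\to0^+ .$$ Finally, let $(s_k)_k$ be a sequence in $(0,1)$ with $s_k\to0$ and, for each $k$, let $\xi_k$ be an eigenfunction of $\mathcal D^{s_k}_\Omega$ for the eigenvalue $\lambda_{n,s_k}$ with $\|\xi_k\|_{L^2(\Omega)}=1$. Then, after passing to a subsequence, $\xi_k\to\xi$ in $L^2(\Omega)$, where $\xi$ is an eigenfunction of $\mathcal D^0_\Omega$ for the eigenvalue $\lambda_{n,0}$. -/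

import Mathlib

open MeasureTheory Set Filter Topology

/-- A bounded open Lipschitz set: every boundary point `p` has an open neighbourhood `U` in which
`∂Ω` is the graph of a Lipschitz function after a rotation, i.e. the graph, in some unit
direction `e`, of a Lipschitz function `f` over the hyperplane orthogonal to `e` (only the values
of `f` at the orthogonal projections `x - ⟪e, x⟫ e` matter). -/
structure IsBoundedLipschitzSet {N : ℕ} (Ω : Set (EuclideanSpace ℝ (Fin N))) : Prop where
  isOpen : IsOpen Ω
  isBounded : Bornology.IsBounded Ω
  boundary_graph : ∀ p ∈ frontier Ω, ∃ (U : Set (EuclideanSpace ℝ (Fin N)))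
    (e : EuclideanSpace ℝ (Fin N)) (f : EuclideanSpace ℝ (Fin N) → ℝ) (K : NNReal),
    IsOpen U ∧ p ∈ U ∧ ‖e‖ = 1 ∧ LipschitzWith K f ∧
      frontier Ω ∩ U = {x | inner ℝ e x = f (x - (inner ℝ e x : ℝ) • e)} ∩ U

/-- The real Hilbert space `L²(Ω)`. -/
abbrev L2 {N : ℕ} (Ω : Set (EuclideanSpace ℝ (Fin N))) : Type :=
  Lp ℝ 2 (volume.restrict Ω)

/-- The kernel integrand `(u(x) - u(y)) (v(x) - v(y)) / |x - y|^(N + 2 s)`. -/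
noncomputable def formIntegrand {N : ℕ} (s : ℝ) (u v : EuclideanSpace ℝ (Fin N) → ℝ)
    (p : EuclideanSpace ℝ (Fin N) × EuclideanSpace ℝ (Fin N)) : ℝ :=
  (u p.1 - u p.2) * (v p.1 - v p.2) / ‖p.1 - p.2‖ ^ ((N : ℝ) + 2 * s)

/-- Lebesgue measure on `Ω × Ω`. -/
noncomputable def sqMeasure {N : ℕ} (Ω : Set (EuclideanSpace ℝ (Fin N))) :
    Measure (EuclideanSpace ℝ (Fin N) × EuclideanSpace ℝ (Fin N)) :=
  (volume.restrict Ω).prod (volume.restrict Ω)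

/-- The form `𝓔_s(u, v) = ½ ∫_Ω ∫_Ω (u(x) - u(y)) (v(x) - v(y)) / |x - y|^(N + 2 s) dx dy`. -/
noncomputable def energyForm {N : ℕ} (Ω : Set (EuclideanSpace ℝ (Fin N))) (s : ℝ)
    (u v : EuclideanSpace ℝ (Fin N) → ℝ) : ℝ :=
  (1 / 2) * ∫ p, formIntegrand s u v p ∂(sqMeasure Ω)

section helpers

variable {N : ℕ} {Ω : Set (EuclideanSpace ℝ (Fin N))}

theorem ae_sqMeasure_of_ae {P : EuclideanSpace ℝ (Fin N) → Prop}
    (h : ∀ᵐ x ∂(volume.restrict Ω), P x) : ∀ᵐ p ∂(sqMeasure Ω), P p.1 ∧ P p.2 :=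
  (Measure.quasiMeasurePreserving_fst.ae h).and (Measure.quasiMeasurePreserving_snd.ae h)

theorem formIntegrand_congr {s : ℝ} {u u' v : EuclideanSpace ℝ (Fin N) → ℝ}
    (h : u =ᵐ[volume.restrict Ω] u') :
    formIntegrand s u v =ᵐ[sqMeasure Ω] formIntegrand s u' v := by
  filter_upwards [ae_sqMeasure_of_ae h] with p hp
  simp only [formIntegrand, hp.1, hp.2]

theorem formIntegrand_comm (s : ℝ) (u v : EuclideanSpace ℝ (Fin N) → ℝ) :
    formIntegrand s u v = formIntegrand s v u := by
  funext p; simp only [formIntegrand]; ring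

theorem formIntegrand_add_left (s : ℝ) (u u' v : EuclideanSpace ℝ (Fin N) → ℝ) :
    formIntegrand s (u + u') v = formIntegrand s u v + formIntegrand s u' v := by
  funext p; simp only [formIntegrand, Pi.add_apply]; ring

theorem formIntegrand_smul_left (s c : ℝ) (u v : EuclideanSpace ℝ (Fin N) → ℝ) :
    formIntegrand s (c • u) v = c • formIntegrand s u v := by
  funext p; simp only [formIntegrand, Pi.smul_apply, smul_eq_mul]; ring

theorem aestronglyMeasurable_formIntegrand (s : ℝ) (u v : L2 Ω) :
    AEStronglyMeasurable (formIntegrand s u v) (sqMeasure Ω) := by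
  have h1 : ∀ w : L2 Ω, AEMeasurable
      (fun p : EuclideanSpace ℝ (Fin N) × EuclideanSpace ℝ (Fin N) => w p.1 - w p.2)
      (sqMeasure Ω) := fun w =>
    ((Lp.aestronglyMeasurable w).aemeasurable.comp_quasiMeasurePreserving
      Measure.quasiMeasurePreserving_fst).sub
    ((Lp.aestronglyMeasurable w).aemeasurable.comp_quasiMeasurePreserving
      Measure.quasiMeasurePreserving_snd)
  have h2 : Measurable (fun p : EuclideanSpace ℝ (Fin N) × EuclideanSpace ℝ (Fin N) =>
      ‖p.1 - p.2‖ ^ ((N : ℝ) + 2 * s)) := by fun_prop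
  exact (((h1 u).mul (h1 v)).div h2.aemeasurable).aestronglyMeasurable

theorem integrable_formIntegrand {s : ℝ} {u v : L2 Ω}
    (hu : Integrable (formIntegrand s u u) (sqMeasure Ω))
    (hv : Integrable (formIntegrand s v v) (sqMeasure Ω)) :
    Integrable (formIntegrand s u v) (sqMeasure Ω) := by
  refine (hu.add hv).mono' (aestronglyMeasurable_formIntegrand s u v) (ae_of_all _ fun p => ?_)
  have hw : 0 ≤ ‖p.1 - p.2‖ ^ ((N : ℝ) + 2 * s) := by positivity
  simp only [formIntegrand, Pi.add_apply, Real.norm_eq_abs, abs_div, abs_of_nonneg hw]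
  rw [← add_div]
  refine div_le_div_of_nonneg_right ?_ hw
  rw [abs_le]
  constructor <;>
    nlinarith [sq_nonneg ((u p.1 - u p.2) - (v p.1 - v p.2)),
      sq_nonneg ((u p.1 - u p.2) + (v p.1 - v p.2)),
      mul_self_nonneg (u p.1 - u p.2), mul_self_nonneg (v p.1 - v p.2)]

end helpers

/-- The space `ℍ^s(Ω)` of all `u ∈ L²(Ω)` with
`∫_Ω ∫_Ω (u(x) - u(y))² / |x - y|^(N + 2 s) dx dy < ∞`. -/
noncomputable def energySpace {N : ℕ} (Ω : Set (EuclideanSpace ℝ (Fin N))) (s : ℝ) : Submodule ℝ (L2 Ω) where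
  carrier := {u | Integrable (formIntegrand s u u) (sqMeasure Ω)}
  zero_mem' := by
    have h : formIntegrand s (0 : L2 Ω) (0 : L2 Ω) =ᵐ[sqMeasure Ω] 0 := by
      filter_upwards [formIntegrand_congr (s := s) (v := (0 : L2 Ω))
        (Lp.coeFn_zero ℝ 2 (volume.restrict Ω))] with p hp
      rw [hp]; simp [formIntegrand]
    exact (integrable_zero _ _ _).congr h.symm
  add_mem' := by
    intro u v hu hv
    have huv := integrable_formIntegrand hu hv
    have h : ∀ w : L2 Ω, formIntegrand s (u + v : L2 Ω) w =ᵐ[sqMeasure Ω]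
        formIntegrand s u w + formIntegrand s v w := fun w => by
      rw [← formIntegrand_add_left]
      exact formIntegrand_congr (Lp.coeFn_add u v)
    have h1 : Integrable (formIntegrand s (u + v : L2 Ω) u) (sqMeasure Ω) :=
      (hu.add (by rw [formIntegrand_comm]; exact huv)).congr (h u).symm
    have h2 : Integrable (formIntegrand s (u + v : L2 Ω) v) (sqMeasure Ω) :=
      (huv.add hv).congr (h v).symm
    rw [formIntegrand_comm] at h1 h2
    exact (h1.add h2).congr (h _).symm
  smul_mem' := by
    intro c u hu
    have h : ∀ w : L2 Ω, formIntegrand s (c • u : L2 Ω) w =ᵐ[sqMeasure Ω]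
        c • formIntegrand s u w := fun w => by
      rw [← formIntegrand_smul_left]
      exact formIntegrand_congr (Lp.coeFn_smul c u)
    have h1 : Integrable (formIntegrand s (c • u : L2 Ω) u) (sqMeasure Ω) :=
      (Integrable.smul c hu).congr (h u).symm
    rw [formIntegrand_comm] at h1
    exact (Integrable.smul c h1).congr (h _).symm

/-- The weak eigenspace of `𝓓^s_Ω` for `lam`: all `u ∈ ℍ^s(Ω)` such that
`𝓔_s(u, v) = ∫_Ω (lam u) v dx` for all `v ∈ ℍ^s(Ω)`. Its nonzero elements are the eigenfunctions
for the eigenvalue `lam`. -/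
noncomputable def weakEigenspace {N : ℕ} (Ω : Set (EuclideanSpace ℝ (Fin N))) (s lam : ℝ) :
    Submodule ℝ (L2 Ω) where
  carrier := {u | u ∈ energySpace Ω s ∧
    ∀ v ∈ energySpace Ω s, energyForm Ω s u v = ∫ x in Ω, (lam * u x) * v x}
  zero_mem' := by
    refine ⟨Submodule.zero_mem _, fun v _ => ?_⟩
    have h0 := Lp.coeFn_zero ℝ 2 (volume.restrict Ω)
    have h2 : ∫ x in Ω, (lam * (0 : L2 Ω) x) * v x = 0 := by
      rw [integral_congr_ae (g := fun _ => (0 : ℝ))]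
      · simp
      · filter_upwards [h0] with x hx
        rw [hx]; simp
    rw [h2, energyForm, integral_congr_ae (formIntegrand_congr h0)]
    simp [formIntegrand]
  add_mem' := by
    rintro u u' ⟨hu, hu1⟩ ⟨hu', hu1'⟩
    refine ⟨Submodule.add_mem _ hu hu', fun v hv => ?_⟩
    have hI : ∀ w : L2 Ω, Integrable (fun x => (lam * w x) * v x) (volume.restrict Ω) := fun w =>
      ((Lp.memLp w).const_mul lam).integrable_mul (Lp.memLp v)
    have h2 : ∫ x in Ω, (lam * (u + u' : L2 Ω) x) * v x
        = (∫ x in Ω, (lam * u x) * v x) + ∫ x in Ω, (lam * u' x) * v x := by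
      rw [← integral_add (hI u) (hI u')]
      refine integral_congr_ae ?_
      filter_upwards [Lp.coeFn_add u u'] with x hx
      rw [hx, Pi.add_apply]; ring
    rw [h2, ← hu1 v hv, ← hu1' v hv, energyForm,
      integral_congr_ae (formIntegrand_congr (Lp.coeFn_add u u')), formIntegrand_add_left,
      integral_add' (integrable_formIntegrand hu hv) (integrable_formIntegrand hu' hv)]
    simp only [energyForm]; ring
  smul_mem' := by
    rintro c u ⟨hu, hu1⟩
    refine ⟨Submodule.smul_mem _ c hu, fun v hv => ?_⟩
    have h2 : ∫ x in Ω, (lam * (c • u : L2 Ω) x) * v x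
        = c * ∫ x in Ω, (lam * u x) * v x := by
      rw [← integral_const_mul]
      refine integral_congr_ae ?_
      filter_upwards [Lp.coeFn_smul c u] with x hx
      rw [hx, Pi.smul_apply, smul_eq_mul]; ring
    rw [h2, ← hu1 v hv, energyForm,
      integral_congr_ae (formIntegrand_congr (Lp.coeFn_smul c u)), formIntegrand_smul_left]
    simp only [Pi.smul_apply, smul_eq_mul, integral_const_mul, energyForm]; ring

/-- The span of all eigenfunctions of `𝓓^s_Ω` whose eigenvalue lies in `I`. Its dimension is the
number of eigenvalues in `I`, counted with multiplicity. -/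
noncomputable def eigenSpan {N : ℕ} (Ω : Set (EuclideanSpace ℝ (Fin N))) (s : ℝ) (I : Set ℝ) :
    Submodule ℝ (L2 Ω) :=
  ⨆ mu ∈ I, weakEigenspace Ω s mu

/-- The eigenvalue `λ_{n,s}` of `𝓓^s_Ω`, where the eigenvalues are listed in increasing order,
counted with multiplicity, and the numbering starts with `n = 0`: the least `t` such that at least
`n + 1` eigenvalues are `≤ t`. -/
noncomputable def eigenvalueNth {N : ℕ} (Ω : Set (EuclideanSpace ℝ (Fin N))) (s : ℝ) (n : ℕ) : ℝ :=
  sInf {t | (n : Cardinal) < Module.rank ℝ (eigenSpan Ω s (Iic t))}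

/-- `t` stands at place `n` (counted from `0`) in the increasing list of the eigenvalues of
`𝓓^s_Ω`, counted with multiplicity: at most `n` of them are `< t` and more than `n` are `≤ t`.
At most one `t` has this property, and it is an eigenvalue. -/
def IsEigenvalueNth {N : ℕ} (Ω : Set (EuclideanSpace ℝ (Fin N))) (s : ℝ) (n : ℕ) (t : ℝ) : Prop :=
  Module.rank ℝ (eigenSpan Ω s (Iio t)) ≤ (n : Cardinal) ∧
    (n : Cardinal) < Module.rank ℝ (eigenSpan Ω s (Iic t))

/-! For 0 ≤ s < 1 the form 𝓔_s is nonnegative and symmetric, lower semicontinuous in L²(Ω) by Fatou,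
and L²-bounded sequences of bounded energy are precompact in L²(Ω). Successive minimization over
unit vectors orthogonal to the earlier minimizers then yields eigenpairs with a variational
characterization (`exists_isEigenSystem`), and the convergence of eigenvalues reduces to two
comparisons.

Lower bound: on a set of diameter at most R one has |x-y|^(-N) ≤ R^(2s) |x-y|^(-N-2s), so 𝓔_0 ≤
R^(2s) 𝓔_s and λ_{n,0} ≤ R^(2s) λ_{n,s}. Upper bound: for fixed u, v in ℍ^{1/2} dominated
convergence gives 𝓔_s(u,v) → 𝓔_0(u,v). Since ℍ^{1/2} is dense in ℍ⁰ for the form norm,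
approximations of the first n+1 eigenfunctions of 𝓔_0 are almost orthonormal, almost diagonalizing
trial vectors for 𝓔_s with s small.

The Lipschitz boundary enters twice. Compactness: |z|^(-N) just fails to be integrable at 0, and Ω
fills a fixed proportion of every small dyadic shell about each of its points, so the kernel cut off
at a small scale has mass at least M uniformly in x. Averaging u against it costs at most 2 𝓔_0(u,u)
/ M in squared norm, and after discretization the averages lie in a finite-dimensional space
(`exists_finiteDimensional_approx`). Density: truncate, extend by zero, mollify. The extension keeps
finite energy because |{x ∈ Ω : x + z ∉ Ω}| ≤ C|z|, which gains the power of |z| that |z|^(-N)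
lacks. By Jensen the mollifications have bounded energy; they converge in L², and a Mazur argument
(`exists_form_approx`) improves this to approximation in the form norm.

For the eigenfunctions, ℍ⁰ bounds give an L² limit ξ. Lower semicontinuity along ξ_k + t v, with v
in ℍ^{1/2}, gives an inequality in t whose quadratic terms cancel; being affine and valid for every
real t, it forces the weak equation against v, and density gives every v in ℍ⁰. -/

/-! ### Spectral theory of compact forms -/

section AbstractForms

variable {H : Type*} [NormedAddCommGroup H] [InnerProductSpace ℝ H] {D : Submodule ℝ H}

/-- A nonnegative symmetric form on a subspace of a Hilbert space that is lower semicontinuous for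
the norm of the ambient space and whose form-bounded sequences are precompact there. -/
structure IsCompactForm (a : LinearMap.BilinForm ℝ D) : Prop where
  symm : ∀ u v, a u v = a v u
  nonneg : ∀ u, 0 ≤ a u u
  lsc : ∀ (u : ℕ → D) (x : H) (C : ℝ), Tendsto (fun k => (u k : H)) atTop (𝓝 x) →
    (∀ k, a (u k) (u k) ≤ C) → ∃ h : x ∈ D, a ⟨x, h⟩ ⟨x, h⟩ ≤ C
  compact : ∀ (u : ℕ → D) (C : ℝ), (∀ k, ‖(u k : H)‖ ≤ C) → (∀ k, a (u k) (u k) ≤ C) →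
    ∃ (φ : ℕ → ℕ) (x : H), StrictMono φ ∧ Tendsto (fun k => (u (φ k) : H)) atTop (𝓝 x)

theorem eq_zero_of_forall_mul_add_sq_mul_nonneg {b c : ℝ} (h : ∀ t : ℝ, 0 ≤ t * b + t ^ 2 * c) :
    b = 0 := by
  have hc : 0 < |c| + 1 := by positivity
  -- The number |c| + 1 is positive and exceeds c whatever the sign of c, so this t makes the
  -- expression negative unless b = 0.
  have h1 := h (-b / (|c| + 1))
  have h2 : (-b / (|c| + 1)) * b + (-b / (|c| + 1)) ^ 2 * c
      = b ^ 2 * (c - (|c| + 1)) / (|c| + 1) ^ 2 := by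
    field_simp
    ring
  rw [h2] at h1
  by_contra hb
  have h3 : b ^ 2 * (c - (|c| + 1)) < 0 := by
    have := le_abs_self c
    exact mul_neg_of_pos_of_neg (by positivity) (by linarith)
  exact absurd h1 (not_le.2 (div_neg_of_neg_of_pos h3 (by positivity)))

theorem eq_zero_of_forall_mul_le {b c : ℝ} (h : ∀ t : ℝ, t * b ≤ c) : b = 0 := by
  by_contra hb
  have := h ((c + 1) / b)
  rw [div_mul_cancel₀ _ hb] at this
  linarith

namespace IsCompactForm

variable {a : LinearMap.BilinForm ℝ D}

theorem apply_add_smul (ha : IsCompactForm a) (u v : D) (t : ℝ) :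
    a (u + t • v) (u + t • v) = a u u + 2 * t * a u v + t ^ 2 * a v v := by
  simp only [map_add, map_smul, LinearMap.add_apply, LinearMap.smul_apply, smul_eq_mul,
    ha.symm v u]
  ring

theorem apply_sq_le (ha : IsCompactForm a) (u v : D) : (a u v) ^ 2 ≤ a u u * a v v := by
  have h : ∀ t : ℝ, 0 ≤ a v v * (t * t) + (2 * a u v) * t + a u u := fun t => by
    have := ha.nonneg (u + t • v)
    rw [ha.apply_add_smul] at this
    nlinarith
  have := discrim_le_zero h
  rw [discrim] at this
  nlinarith

theorem lsc_of_eventually (ha : IsCompactForm a) {u : ℕ → D} {x : H} {C : ℝ}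
    (hu : Tendsto (fun k => (u k : H)) atTop (𝓝 x)) (hC : ∀ᶠ k in atTop, a (u k) (u k) ≤ C) :
    ∃ h : x ∈ D, a ⟨x, h⟩ ⟨x, h⟩ ≤ C := by
  obtain ⟨m, hm⟩ := eventually_atTop.1 hC
  exact ha.lsc (fun k => u (k + m)) x C (hu.comp (tendsto_add_atTop_nat m))
    fun k => hm _ (Nat.le_add_left _ _)

theorem lsc_of_tendsto (ha : IsCompactForm a) {u : ℕ → D} {x : H} {c : ℕ → ℝ} {C : ℝ}
    (hu : Tendsto (fun k => (u k : H)) atTop (𝓝 x)) (hc : ∀ᶠ k in atTop, a (u k) (u k) ≤ c k)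
    (hC : Tendsto c atTop (𝓝 C)) :
    ∃ h : x ∈ D, a ⟨x, h⟩ ⟨x, h⟩ ≤ C := by
  have h : ∀ ε > 0, ∃ h : x ∈ D, a ⟨x, h⟩ ⟨x, h⟩ ≤ C + ε := fun ε hε =>
    ha.lsc_of_eventually hu ((hc.and (hC.eventually_lt_const (lt_add_of_pos_right C hε))).mono
      fun k hk => hk.1.trans hk.2.le)
  obtain ⟨hx, -⟩ := h 1 one_pos
  exact ⟨hx, le_of_forall_pos_le_add fun ε hε => (h ε hε).2⟩

/-- Mazur's lemma for forms: if a subspace approximates `u` in norm with bounded energy, then it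
approximates `u` in the form norm. -/
theorem exists_form_approx (ha : IsCompactForm a) (V : Submodule ℝ H) (u : D) (C : ℝ)
    (h : ∀ δ > 0, ∃ v : D, (v : H) ∈ V ∧ ‖(v : H) - u‖ ≤ δ ∧ a v v ≤ C) {ε : ℝ} (hε : 0 < ε) :
    ∃ v : D, (v : H) ∈ V ∧ ‖(v : H) - u‖ ≤ ε ∧ a (v - u) (v - u) ≤ ε := by
  -- The energies of the admissible vectors within 1/(j+1) of u. Their infima m j increase with j to
  -- a finite limit M, and near-minimizers w j will be form-Cauchy.
  set S : ℕ → Set ℝ := fun j =>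
    {r | ∃ v : D, (v : H) ∈ V ∧ ‖(v : H) - u‖ ≤ 1 / ((j : ℝ) + 1) ∧ a v v = r} with hS
  have hpos : ∀ j : ℕ, (0 : ℝ) < 1 / ((j : ℝ) + 1) := fun j => Nat.one_div_pos_of_nat
  have hbdd : ∀ j, BddBelow (S j) := fun j => ⟨0, by
    rintro r ⟨v, -, -, rfl⟩; exact ha.nonneg v⟩
  have hne : ∀ j, (S j).Nonempty := fun j => by
    obtain ⟨v, hv, hd, -⟩ := h _ (hpos j)
    exact ⟨_, v, hv, hd, rfl⟩
  set m : ℕ → ℝ := fun j => sInf (S j) with hm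
  have hmC : ∀ j, m j ≤ C := fun j => by
    obtain ⟨v, hv, hd, hc⟩ := h _ (hpos j)
    exact (csInf_le (hbdd j) ⟨v, hv, hd, rfl⟩).trans hc
  have hmono : Monotone m := fun i j hij => by
    refine csInf_le_csInf (hbdd i) (hne j) ?_
    rintro r ⟨v, hv, hd, rfl⟩
    exact ⟨v, hv, hd.trans (Nat.one_div_le_one_div hij), rfl⟩
  have hlim := tendsto_atTop_ciSup hmono ⟨C, by rintro _ ⟨j, rfl⟩; exact hmC j⟩
  set M := ⨆ i, m i
  have hmM : ∀ j, m j ≤ M := fun j => le_ciSup ⟨C, by rintro _ ⟨j, rfl⟩; exact hmC j⟩ j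
  have hw : ∀ j : ℕ, ∃ v : D, (v : H) ∈ V ∧ ‖(v : H) - u‖ ≤ 1 / ((j : ℝ) + 1) ∧
      a v v ≤ m j + 1 / ((j : ℝ) + 1) := fun j => by
    obtain ⟨r, ⟨v, hv, hd, rfl⟩, hr⟩ := exists_lt_of_csInf_lt (hne j)
      (lt_add_of_pos_right (m j) (hpos j))
    exact ⟨v, hv, hd, hr.le⟩
  choose w hwV hwd hwa using hw
  have hone := tendsto_one_div_add_atTop_nhds_zero_nat (𝕜 := ℝ)
  have hev : ∀ᶠ j : ℕ in atTop, M - m j < ε / 8 ∧ 1 / ((j : ℝ) + 1) < ε / 8 := by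
    refine Filter.Eventually.and ?_ (hone.eventually_lt_const (by positivity))
    have : Tendsto (fun j => M - m j) atTop (𝓝 0) := by
      simpa using (tendsto_const_nhds (x := M)).sub hlim
    exact this.eventually_lt_const (by positivity)
  obtain ⟨j, hj1, hj2⟩ := hev.exists
  have hwu : Tendsto (fun i => (w i : H)) atTop (𝓝 (u : H)) := by
    rw [tendsto_iff_norm_sub_tendsto_zero]
    exact squeeze_zero (fun _ => norm_nonneg _) hwd hone
  -- Parallelogram law: the midpoint of w i and w j is still admissible at level j, so its energy is
  -- at least m j, while both endpoints have energy at most M plus a small error.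
  have hcau : ∀ i, j ≤ i → a (w j - w i) (w j - w i) ≤ ε := fun i hij => by
    have hmid : m j ≤ a ((1 / 2 : ℝ) • (w i + w j)) ((1 / 2 : ℝ) • (w i + w j)) := by
      refine csInf_le (hbdd j) ⟨_, ?_, ?_, rfl⟩
      · exact V.smul_mem _ (V.add_mem (hwV i) (hwV j))
      · have : (((1 / 2 : ℝ) • (w i + w j) : D) : H) - u
            = (1 / 2 : ℝ) • (((w i : H) - u) + ((w j : H) - u)) := by
          push_cast; module
        rw [this, norm_smul]
        have h1 := norm_add_le ((w i : H) - u) ((w j : H) - u)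
        have h2 := (hwd i).trans (Nat.one_div_le_one_div (α := ℝ) hij)
        have h3 := hwd j
        rw [Real.norm_of_nonneg (by norm_num)]
        linarith
    have hi1 : 1 / ((i : ℝ) + 1) ≤ 1 / ((j : ℝ) + 1) := Nat.one_div_le_one_div hij
    have h1 := hwa i
    have h2 := hwa j
    have h3 := hmM i
    simp only [map_add, map_sub, map_smul, LinearMap.add_apply, LinearMap.sub_apply,
      LinearMap.smul_apply, smul_eq_mul, ha.symm (w i) (w j)] at hmid ⊢
    linarith
  -- Letting i tend to infinity, lower semicontinuity turns the Cauchy bound into a bound for w j -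
  -- u.
  have hconv : Tendsto (fun i => ((w j - w i : D) : H)) atTop (𝓝 ((w j - u : D) : H)) := by
    push_cast
    exact tendsto_const_nhds.sub hwu
  obtain ⟨_, hfin⟩ := ha.lsc_of_eventually hconv (eventually_atTop.2 ⟨j, hcau⟩)
  exact ⟨w j, hwV j, (hwd j).trans (by linarith), hfin⟩

/-- The minimum of the form over the unit vectors of a nonzero closed constraint space is
attained. -/
theorem exists_unit_minimizer (ha : IsCompactForm a) {n : ℕ} (e : Fin n → H)
    (hne : ∃ v : D, v ≠ 0 ∧ ∀ i, inner ℝ (e i) (v : H) = 0) :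
    ∃ u : D, ‖(u : H)‖ = 1 ∧ (∀ i, inner ℝ (e i) (u : H) = 0) ∧
      ∀ v : D, (∀ i, inner ℝ (e i) (v : H) = 0) → a u u * ‖(v : H)‖ ^ 2 ≤ a v v := by
  set S : Set ℝ :=
    {r | ∃ v : D, ‖(v : H)‖ = 1 ∧ (∀ i, inner ℝ (e i) (v : H) = 0) ∧ a v v = r} with hS
  have hbdd : BddBelow S := ⟨0, by rintro r ⟨v, -, -, rfl⟩; exact ha.nonneg v⟩
  have hscale : ∀ v : D, v ≠ 0 → (∀ i, inner ℝ (e i) (v : H) = 0) →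
      a v v / ‖(v : H)‖ ^ 2 ∈ S := fun v hv h => by
    have hv' : ‖(v : H)‖ ≠ 0 := by simpa using hv
    refine ⟨(‖(v : H)‖⁻¹) • v, ?_, fun i => ?_, ?_⟩
    · rw [Submodule.coe_smul, norm_smul, norm_inv, norm_norm, inv_mul_cancel₀ hv']
    · rw [Submodule.coe_smul, inner_smul_right, h i, mul_zero]
    · simp only [map_smul, LinearMap.smul_apply, smul_eq_mul]
      field_simp
  have hSne : S.Nonempty := by
    obtain ⟨v, hv, h⟩ := hne
    exact ⟨_, hscale v hv h⟩
  -- Direct method: a minimizing sequence converges in norm along a subsequence. The unit norm and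
  -- the orthogonality pass to the limit, and lower semicontinuity keeps the energy minimal.
  obtain ⟨r, hr, hrlim, hrS⟩ := exists_seq_tendsto_sInf hSne hbdd
  choose w hw1 hwe hwa using hrS
  obtain ⟨C, hC⟩ := hrlim.bddAbove_range
  obtain ⟨φ, x, hφ, hx⟩ := ha.compact w (max 1 C) (fun k => by rw [hw1]; exact le_max_left _ _)
    (fun k => by rw [hwa]; exact (hC ⟨k, rfl⟩).trans (le_max_right _ _))
  obtain ⟨hxD, hxa⟩ := ha.lsc_of_tendsto hx
    (Eventually.of_forall fun k => (hwa (φ k)).le) (hrlim.comp hφ.tendsto_atTop)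
  refine ⟨⟨x, hxD⟩, ?_, fun i => ?_, fun v hv => ?_⟩
  · have := hx.norm
    simp only [hw1] at this
    exact (tendsto_nhds_unique tendsto_const_nhds this).symm
  · have h1 : Tendsto (fun k => inner ℝ (e i) (w (φ k) : H)) atTop (𝓝 (inner ℝ (e i) x)) :=
      tendsto_const_nhds.inner hx
    simp only [hwe] at h1
    exact (tendsto_nhds_unique tendsto_const_nhds h1).symm
  · rcases eq_or_ne v 0 with rfl | hv0
    · simp
    · have h1 := csInf_le hbdd (hscale v hv0 hv)
      have hv' : 0 < ‖(v : H)‖ := by simpa using hv0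
      rw [le_div_iff₀ (by positivity)] at h1
      exact (mul_le_mul_of_nonneg_right hxa (by positivity)).trans h1

/-- The first `m` eigenpairs of a form, in increasing order, with the variational
characterization of each eigenvalue. -/
structure IsEigenSystem (a : LinearMap.BilinForm ℝ D) {m : ℕ} (e : Fin m → D)
    (lam : Fin m → ℝ) : Prop where
  orthonormal : Orthonormal ℝ (fun i => (e i : H))
  eigen : ∀ i v, a (e i) v = lam i * inner ℝ (e i : H) (v : H)
  mono : Monotone lam
  minimal : ∀ i (v : D), (∀ j < i, inner ℝ (e j : H) (v : H) = 0) →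
    lam i * ‖(v : H)‖ ^ 2 ≤ a v v

theorem exists_ne_zero_forall_inner_eq_zero (hD : ¬ FiniteDimensional ℝ D) {m : ℕ}
    (e : Fin m → H) : ∃ v : D, v ≠ 0 ∧ ∀ i, inner ℝ (e i) (v : H) = 0 := by
  by_contra! hcon
  let T : D →ₗ[ℝ] (Fin m → ℝ) := LinearMap.pi fun i => (innerₛₗ ℝ (e i)).comp D.subtype
  have hT : Function.Injective T := by
    rw [← LinearMap.ker_eq_bot, LinearMap.ker_eq_bot']
    intro v hv
    by_contra hv0
    obtain ⟨i, hi⟩ := hcon v hv0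
    exact hi (congrFun hv i)
  exact hD (FiniteDimensional.of_injective T hT)

/-- Each new vector minimizes the form over unit vectors orthogonal to the previous ones. Infinite
dimension keeps the constraint space nonzero at every stage, and the first variation of the Rayleigh
quotient is the eigenvalue equation. -/
theorem exists_isEigenSystem (ha : IsCompactForm a) (hD : ¬ FiniteDimensional ℝ D) (m : ℕ) :
    ∃ (e : Fin m → D) (lam : Fin m → ℝ), IsEigenSystem a e lam := by
  induction m with
  | zero =>
    exact ⟨Fin.elim0, Fin.elim0, ⟨fun i => i.elim0, fun i => i.elim0⟩, fun i => i.elim0,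
      fun i => i.elim0, fun i => i.elim0⟩
  | succ m ih =>
    obtain ⟨e, lam, he⟩ := ih
    obtain ⟨u, hu1, hue, humin⟩ := ha.exists_unit_minimizer (fun i => (e i : H))
      (exists_ne_zero_forall_inner_eq_zero hD _)
    have hae : ∀ i, a u (e i) = 0 := fun i => by rw [ha.symm, he.eigen, hue, mul_zero]
    have horth : ∀ v : D, (∀ i, inner ℝ (e i : H) (v : H) = 0) →
        a u v = a u u * inner ℝ (u : H) (v : H) := fun v hv => by
      -- Minimality at u + t v, expanded in t; the linear coefficient must vanish.
      have key : ∀ t : ℝ, 0 ≤ t * (2 * (a u v - a u u * inner ℝ (u : H) (v : H)))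
          + t ^ 2 * (a v v - a u u * ‖(v : H)‖ ^ 2) := fun t => by
        have h1 := humin (u + t • v) fun i => by
          simp [inner_add_right, inner_smul_right, hue, hv]
        have h2 : ‖((u + t • v : D) : H)‖ ^ 2
            = 1 + 2 * t * inner ℝ (u : H) (v : H) + t ^ 2 * ‖(v : H)‖ ^ 2 := by
          rw [Submodule.coe_add, Submodule.coe_smul, norm_add_sq_real, hu1, inner_smul_right,
            norm_smul, mul_pow, Real.norm_eq_abs, sq_abs]
          ring
        rw [ha.apply_add_smul, h2] at h1
        linarith
      linarith [eq_zero_of_forall_mul_add_sq_mul_nonneg key]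
    -- For general v, split off its projection p onto the earlier eigenvectors: both sides vanish at
    -- p, by their eigenvalue equations and by orthogonality.
    have heigen : ∀ v : D, a u v = a u u * inner ℝ (u : H) (v : H) := fun v => by
      set p : D := ∑ i, (inner ℝ (e i : H) (v : H) : ℝ) • e i with hp
      have h1 := horth (v - p) fun i => by
        have : (p : H) = ∑ i, (inner ℝ (e i : H) (v : H) : ℝ) • (e i : H) := by
          simp [hp]
        rw [Submodule.coe_sub, inner_sub_right, this, he.orthonormal.inner_right_fintype, sub_self]
      have h2 : a u p = 0 := by simp [hp, hae]
      have h3 : inner ℝ (u : H) (p : H) = 0 := by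
        have : ∀ i, inner ℝ (u : H) (e i : H) = 0 := fun i => by rw [real_inner_comm]; exact hue i
        simp [hp, inner_sum, inner_smul_right, this]
      rw [map_sub, h2, Submodule.coe_sub, inner_sub_right, h3, sub_zero, sub_zero] at h1
      exact h1
    refine ⟨Fin.snoc e u, Fin.snoc lam (a u u), ⟨?_, ?_⟩, ?_, ?_, ?_⟩
    · intro i
      refine Fin.lastCases ?_ (fun i => ?_) i
      · simpa using hu1
      · simpa using he.orthonormal.1 i
    · intro i j hij
      induction i using Fin.lastCases with
      | last =>
        induction j using Fin.lastCases with
        | last => exact absurd rfl hij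
        | cast j => simpa [real_inner_comm] using hue j
      | cast i =>
        induction j using Fin.lastCases with
        | last => simpa using hue i
        | cast j =>
          simpa using he.orthonormal.2 (fun h => hij (by rw [h]))
    · intro i v
      refine Fin.lastCases ?_ (fun i => ?_) i
      · simpa using heigen v
      · simpa using he.eigen i v
    · intro i j hij
      induction j using Fin.lastCases with
      | last =>
        induction i using Fin.lastCases with
        | last => exact le_rfl
        | cast i =>
          -- The new minimizer u competes in the minimum problem of every earlier eigenvalue.
          have := he.minimal i u fun j _ => hue j
          rw [hu1] at this
          simpa using this
      | cast j =>
        induction i using Fin.lastCases with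
        | last => exact absurd hij (not_le.2 (Fin.castSucc_lt_last j))
        | cast i => simpa using he.mono (by simpa using hij)
    · intro i v hv
      induction i using Fin.lastCases with
      | last =>
        simpa using humin v fun j => by simpa using hv j.castSucc (Fin.castSucc_lt_last j)
      | cast i =>
        simpa using he.minimal i v fun j hj => by
          simpa using hv j.castSucc (by simpa using hj)

/-- Any `n + 1` trial vectors have a nontrivial combination on which the form dominates the `n`-th
eigenvalue. -/
theorem IsEigenSystem.exists_comb {n : ℕ} {e : Fin (n + 1) → D} {lam : Fin (n + 1) → ℝ}
    (he : IsEigenSystem a e lam) (v : Fin (n + 1) → D) :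
    ∃ c : Fin (n + 1) → ℝ, c ≠ 0 ∧ lam (Fin.last n) * ‖((∑ i, c i • v i : D) : H)‖ ^ 2
      ≤ a (∑ i, c i • v i) (∑ i, c i • v i) := by
  -- Orthogonality to the first n eigenvectors is n linear conditions on n + 1 coefficients, so T
  -- has a nonzero kernel.
  let T : (Fin (n + 1) → ℝ) →ₗ[ℝ] (Fin n → ℝ) :=
    LinearMap.pi fun j => ∑ i, (inner ℝ (e j.castSucc : H) (v i : H) : ℝ) • LinearMap.proj i
  obtain ⟨c, hcT, hc0⟩ := (LinearMap.ker T).ne_bot_iff.1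
    (LinearMap.ker_ne_bot_of_finrank_lt (f := T) (by simp))
  refine ⟨c, hc0, he.minimal (Fin.last n) _ fun j hj => ?_⟩
  obtain ⟨j, rfl⟩ := Fin.eq_castSucc_of_ne_last hj.ne
  have h5 := congrFun hcT j
  simp only [T, LinearMap.pi_apply, LinearMap.sum_apply, LinearMap.smul_apply,
    LinearMap.proj_apply, smul_eq_mul, Pi.zero_apply] at h5
  simp only [Submodule.coe_sum, Submodule.coe_smul, inner_sum, inner_smul_right]
  rw [← h5]
  exact Finset.sum_congr rfl fun i _ => by ring

/-- The Ritz upper bound for an eigenvalue, from an almost orthonormal and almost diagonalizing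
trial family. -/
theorem IsEigenSystem.le_of_trial {n : ℕ} {e : Fin (n + 1) → D} {lam : Fin (n + 1) → ℝ}
    (he : IsEigenSystem a e lam) (hlam : 0 ≤ lam (Fin.last n)) (v : Fin (n + 1) → D)
    (mu : Fin (n + 1) → ℝ)
    {L η : ℝ} (hmu : ∀ i, mu i ≤ L)
    (hG : ∀ i j, |inner ℝ (v i : H) (v j : H) - if i = j then 1 else 0| ≤ η)
    (hA : ∀ i j, |a (v i) (v j) - if i = j then mu i else 0| ≤ η) :
    lam (Fin.last n) * (1 - (n + 1) * η) ≤ L + (n + 1) * η := by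
  obtain ⟨c, hc0, h4⟩ := he.exists_comb v
  set w : D := ∑ i, c i • v i with hw
  set q : ℝ := ∑ i, c i ^ 2 with hq
  have hqpos : 0 < q := by
    obtain ⟨i, hi⟩ := Function.ne_iff.1 hc0
    exact Finset.sum_pos' (fun _ _ => sq_nonneg _) ⟨i, Finset.mem_univ _, by
      have : c i ≠ 0 := hi
      positivity⟩
  -- Entrywise errors of size η perturb the quadratic form by at most (n+1) η q, because |c_i c_j| ≤
  -- (c_i² + c_j²)/2. It is applied to the Gram matrix and to the energy matrix.
  have hquad : ∀ (B : Fin (n + 1) → Fin (n + 1) → ℝ) (d : Fin (n + 1) → ℝ),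
      (∀ i j, |B i j - if i = j then d i else 0| ≤ η) →
      |∑ i, ∑ j, c i * c j * B i j - ∑ i, d i * c i ^ 2| ≤ (n + 1) * η * q := fun B d hB => by
    have h1 : ∑ i, ∑ j, c i * c j * B i j - ∑ i, d i * c i ^ 2
        = ∑ i, ∑ j, c i * c j * (B i j - if i = j then d i else 0) := by
      rw [← Finset.sum_sub_distrib]
      refine Finset.sum_congr rfl fun i _ => ?_
      simp only [mul_sub, Finset.sum_sub_distrib, mul_ite, mul_zero, Finset.sum_ite_eq,
        Finset.mem_univ, if_true]
      ring
    have h2 : ∀ i j, |c i * c j * (B i j - if i = j then d i else 0)|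
        ≤ (c i ^ 2 + c j ^ 2) / 2 * η := fun i j => by
      rw [abs_mul]
      refine mul_le_mul ?_ (hB i j) (abs_nonneg _) (by positivity)
      rw [abs_le]
      constructor <;> nlinarith [sq_nonneg (c i + c j), sq_nonneg (c i - c j)]
    rw [h1]
    calc _ ≤ ∑ i, ∑ j, (c i ^ 2 + c j ^ 2) / 2 * η :=
          (Finset.abs_sum_le_sum_abs _ _).trans (Finset.sum_le_sum fun i _ =>
            (Finset.abs_sum_le_sum_abs _ _).trans (Finset.sum_le_sum fun j _ => h2 i j))
      _ = (n + 1) * η * q := by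
          simp only [← Finset.sum_mul, ← Finset.sum_div, Finset.sum_add_distrib, Finset.sum_const,
            Finset.card_univ, Fintype.card_fin, nsmul_eq_mul, ← Finset.mul_sum, ← hq]
          push_cast; ring
  have hwG : ‖(w : H)‖ ^ 2 = ∑ i, ∑ j, c i * c j * inner ℝ (v i : H) (v j : H) := by
    rw [← real_inner_self_eq_norm_sq, hw]
    simp only [Submodule.coe_sum, Submodule.coe_smul, sum_inner, inner_sum, inner_smul_left,
      inner_smul_right, RCLike.conj_to_real, Finset.mul_sum]
    exact Finset.sum_congr rfl fun i _ => Finset.sum_congr rfl fun j _ => by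
      rw [real_inner_comm]; ring
  have hwA : a w w = ∑ i, ∑ j, c i * c j * a (v i) (v j) := by
    rw [hw]
    simp only [map_sum, map_smul, LinearMap.sum_apply, LinearMap.smul_apply, smul_eq_mul, Finset.mul_sum]
    rw [Finset.sum_comm]
    exact Finset.sum_congr rfl fun i _ => Finset.sum_congr rfl fun j _ => by ring
  have h1 := (abs_le.1 (hquad _ (fun _ => 1) hG)).1
  have h2 := (abs_le.1 (hquad _ mu hA)).2
  rw [← hwG] at h1
  rw [← hwA] at h2
  simp only [one_mul, ← hq] at h1
  have h3 : ∑ i, mu i * c i ^ 2 ≤ L * q := by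
    rw [hq, Finset.mul_sum]
    exact Finset.sum_le_sum fun i _ => mul_le_mul_of_nonneg_right (hmu i) (sq_nonneg _)
  have h6 : lam (Fin.last n) * ((1 - (n + 1) * η) * q) ≤ lam (Fin.last n) * ‖(w : H)‖ ^ 2 :=
    mul_le_mul_of_nonneg_left (by linarith) hlam
  refine le_of_mul_le_mul_right ?_ hqpos
  linarith

end IsCompactForm

end AbstractForms

/-! ### The forms 𝓔_s: semicontinuity, comparison in s, limit s → 0 -/

section Forms

variable {N : ℕ} {Ω : Set (EuclideanSpace ℝ (Fin N))}

theorem formIntegrand_self_nonneg (s : ℝ) (u : EuclideanSpace ℝ (Fin N) → ℝ)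
    (p : EuclideanSpace ℝ (Fin N) × EuclideanSpace ℝ (Fin N)) : 0 ≤ formIntegrand s u u p :=
  div_nonneg (mul_self_nonneg _) (Real.rpow_nonneg (norm_nonneg _) _)

/-- The form `𝓔_s` as a bilinear form on `ℍ^s(Ω)`. -/
noncomputable def energyBilin (Ω : Set (EuclideanSpace ℝ (Fin N))) (s : ℝ) :
    LinearMap.BilinForm ℝ (energySpace Ω s) :=
  have hadd : ∀ u u' v : energySpace Ω s,
      energyForm Ω s (u + u' : energySpace Ω s).1 v.1
        = energyForm Ω s u.1 v.1 + energyForm Ω s u'.1 v.1 := fun u u' v => by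
    rw [Submodule.coe_add, energyForm,
      integral_congr_ae (formIntegrand_congr (Lp.coeFn_add u.1 u'.1)), formIntegrand_add_left,
      integral_add' (integrable_formIntegrand u.2 v.2) (integrable_formIntegrand u'.2 v.2)]
    simp only [energyForm]; ring
  have hsmul : ∀ (c : ℝ) (u v : energySpace Ω s),
      energyForm Ω s (c • u : energySpace Ω s).1 v.1 = c • energyForm Ω s u.1 v.1 :=
    fun c u v => by
      rw [Submodule.coe_smul, energyForm,
        integral_congr_ae (formIntegrand_congr (Lp.coeFn_smul c u.1)), formIntegrand_smul_left]
      simp only [Pi.smul_apply, smul_eq_mul, integral_const_mul, energyForm]; ring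
  have hcomm : ∀ u v : energySpace Ω s, energyForm Ω s u.1 v.1 = energyForm Ω s v.1 u.1 :=
    fun u v => by rw [energyForm, formIntegrand_comm, energyForm]
  LinearMap.mk₂ ℝ (fun u v => energyForm Ω s u.1 v.1) hadd hsmul
    (fun u v v' => by rw [hcomm, hadd, hcomm v, hcomm v'])
    (fun c u v => by rw [hcomm, hsmul, hcomm v])

theorem energyBilin_apply {s : ℝ} (u v : energySpace Ω s) :
    energyBilin Ω s u v = energyForm Ω s u.1 v.1 := rfl

theorem energyForm_comm (s : ℝ) (u v : EuclideanSpace ℝ (Fin N) → ℝ) :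
    energyForm Ω s u v = energyForm Ω s v u := by
  rw [energyForm, formIntegrand_comm, energyForm]

theorem energyForm_self_nonneg (s : ℝ) (u : EuclideanSpace ℝ (Fin N) → ℝ) :
    0 ≤ energyForm Ω s u u :=
  mul_nonneg (by norm_num) (integral_nonneg fun p => formIntegrand_self_nonneg s u p)

theorem mem_weakEigenspace_iff {s lam : ℝ} {u : L2 Ω} :
    u ∈ weakEigenspace Ω s lam ↔ u ∈ energySpace Ω s ∧
      ∀ v ∈ energySpace Ω s, energyForm Ω s u v = lam * inner ℝ u v := by
  have h : ∀ v : L2 Ω, ∫ x in Ω, (lam * u x) * v x = lam * inner ℝ u v := fun v => by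
    rw [L2.inner_def, ← integral_const_mul]
    refine integral_congr_ae (Eventually.of_forall fun x => ?_)
    simp only [RCLike.inner_apply, RCLike.conj_to_real]
    ring
  change (u ∈ energySpace Ω s ∧ ∀ v ∈ energySpace Ω s,
    energyForm Ω s u v = ∫ x in Ω, (lam * u x) * v x) ↔ _
  simp only [h]

theorem ae_mem_sqMeasure (hΩ : MeasurableSet Ω) : ∀ᵐ p ∂(sqMeasure Ω), p.1 ∈ Ω ∧ p.2 ∈ Ω :=
  ae_sqMeasure_of_ae (ae_restrict_mem hΩ)

/-- Estimates are made on the lower integral because finiteness there gives membership, whereas the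
Bochner integral in `energyForm` is 0 when the integrand is not integrable. The factor 2 undoes the
½ in the form. -/
theorem mem_energySpace_of_lintegral_le {s C : ℝ} (u : L2 Ω)
    (h : ∫⁻ p, ENNReal.ofReal (formIntegrand s u u p) ∂(sqMeasure Ω) ≤ ENNReal.ofReal (2 * C)) :
    u ∈ energySpace Ω s :=
  ⟨aestronglyMeasurable_formIntegrand s u u, by
    rw [hasFiniteIntegral_iff_ofReal
      (Eventually.of_forall fun p => formIntegrand_self_nonneg s u p)]
    exact h.trans_lt ENNReal.ofReal_lt_top⟩

theorem lintegral_formIntegrand_self {s : ℝ} {u : L2 Ω} (hu : u ∈ energySpace Ω s) :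
    ∫⁻ p, ENNReal.ofReal (formIntegrand s u u p) ∂(sqMeasure Ω)
      = ENNReal.ofReal (2 * energyForm Ω s u u) := by
  rw [energyForm, ← mul_assoc, mul_one_div_cancel two_ne_zero, one_mul]
  exact (ofReal_integral_eq_lintegral_ofReal hu
    (Eventually.of_forall fun p => formIntegrand_self_nonneg s u p)).symm

theorem energyForm_le_of_lintegral_le {s C : ℝ} (hC : 0 ≤ C) {u : L2 Ω}
    (h : ∫⁻ p, ENNReal.ofReal (formIntegrand s u u p) ∂(sqMeasure Ω) ≤ ENNReal.ofReal (2 * C)) :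
    energyForm Ω s u u ≤ C := by
  rw [lintegral_formIntegrand_self (mem_energySpace_of_lintegral_le u h),
    ENNReal.ofReal_le_ofReal_iff (by positivity)] at h
  linarith

theorem exists_subseq_tendsto_ae {α : Type*} [MeasurableSpace α] {μ : Measure α}
    {u : ℕ → Lp ℝ 2 μ} {x : Lp ℝ 2 μ} (hu : Tendsto u atTop (𝓝 x)) :
    ∃ φ : ℕ → ℕ, StrictMono φ ∧ ∀ᵐ y ∂μ, Tendsto (fun k => u (φ k) y) atTop (𝓝 (x y)) :=
  (tendstoInMeasure_of_tendsto_Lp hu).exists_seq_tendsto_ae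

/-- Fatou's lemma along an almost everywhere convergent subsequence. -/
theorem energyForm_lsc (s : ℝ) {u : ℕ → L2 Ω} {x : L2 Ω} {C : ℝ}
    (hx : Tendsto u atTop (𝓝 x)) (hu : ∀ k, u k ∈ energySpace Ω s)
    (hC : ∀ k, energyForm Ω s (u k) (u k) ≤ C) :
    x ∈ energySpace Ω s ∧ energyForm Ω s x x ≤ C := by
  have hC0 : 0 ≤ C := (energyForm_self_nonneg s _).trans (hC 0)
  obtain ⟨φ, -, hφ⟩ := exists_subseq_tendsto_ae hx
  have key : ∫⁻ p, ENNReal.ofReal (formIntegrand s x x p) ∂(sqMeasure Ω)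
      ≤ ENNReal.ofReal (2 * C) := by
    calc _ = ∫⁻ p, liminf (fun k => ENNReal.ofReal (formIntegrand s (u (φ k)) (u (φ k)) p)) atTop
          ∂(sqMeasure Ω) := by
          refine lintegral_congr_ae ?_
          filter_upwards [ae_sqMeasure_of_ae hφ] with p hp
          refine (Tendsto.liminf_eq ?_).symm
          refine (ENNReal.continuous_ofReal.tendsto _).comp ?_
          have := hp.1.sub hp.2
          exact (this.mul this).div_const _
      _ ≤ liminf (fun k => ∫⁻ p, ENNReal.ofReal (formIntegrand s (u (φ k)) (u (φ k)) p)
          ∂(sqMeasure Ω)) atTop :=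
          lintegral_liminf_le' fun k =>
            (aestronglyMeasurable_formIntegrand s _ _).aemeasurable.ennreal_ofReal
      _ ≤ ENNReal.ofReal (2 * C) := by
          refine liminf_le_of_frequently_le' (Frequently.of_forall fun k => ?_)
          rw [lintegral_formIntegrand_self (hu _)]
          exact ENNReal.ofReal_le_ofReal (by linarith [hC (φ k)])
  exact ⟨mem_energySpace_of_lintegral_le x key, energyForm_le_of_lintegral_le hC0 key⟩

/-- The two kernels differ by the factor |x-y|^(2(t-s)). The resulting constant tends to 1 as t - s
→ 0, so the comparison loses nothing in the limit. -/
theorem formIntegrand_le_of_le {s t R : ℝ} (hst : s ≤ t)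
    (u : EuclideanSpace ℝ (Fin N) → ℝ)
    {p : EuclideanSpace ℝ (Fin N) × EuclideanSpace ℝ (Fin N)} (hp : ‖p.1 - p.2‖ ≤ R) :
    formIntegrand s u u p ≤ R ^ (2 * (t - s)) * formIntegrand t u u p := by
  rcases eq_or_ne p.1 p.2 with h | h
  · simp [formIntegrand, h]
  · have hr : 0 < ‖p.1 - p.2‖ := norm_pos_iff.2 (sub_ne_zero.2 h)
    have h1 : ‖p.1 - p.2‖ ^ ((N : ℝ) + 2 * t)
        = ‖p.1 - p.2‖ ^ ((N : ℝ) + 2 * s) * ‖p.1 - p.2‖ ^ (2 * (t - s)) := by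
      rw [← Real.rpow_add hr]; congr 1; ring
    have h2 : ‖p.1 - p.2‖ ^ (2 * (t - s)) ≤ R ^ (2 * (t - s)) :=
      Real.rpow_le_rpow hr.le hp (by linarith)
    have h3 := Real.rpow_pos_of_pos hr ((N : ℝ) + 2 * s)
    have h4 := Real.rpow_pos_of_pos hr (2 * (t - s))
    rw [formIntegrand, formIntegrand, h1, mul_div_assoc', div_le_div_iff₀ h3 (by positivity)]
    have h5 : 0 ≤ (u p.1 - u p.2) * (u p.1 - u p.2) * ‖p.1 - p.2‖ ^ ((N : ℝ) + 2 * s) :=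
      mul_nonneg (mul_self_nonneg _) h3.le
    nlinarith [mul_le_mul_of_nonneg_left h2 h5]

theorem lintegral_formIntegrand_le_of_le (hΩ : MeasurableSet Ω) {s t R : ℝ} (hst : s ≤ t)
    (hR : 0 ≤ R) (hdiam : ∀ x ∈ Ω, ∀ y ∈ Ω, ‖x - y‖ ≤ R) {u : L2 Ω}
    (hu : u ∈ energySpace Ω t) :
    ∫⁻ p, ENNReal.ofReal (formIntegrand s u u p) ∂(sqMeasure Ω)
      ≤ ENNReal.ofReal (2 * (R ^ (2 * (t - s)) * energyForm Ω t u u)) := by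
  have hRp : 0 ≤ R ^ (2 * (t - s)) := by positivity
  calc _ ≤ ∫⁻ p, ENNReal.ofReal (R ^ (2 * (t - s))) * ENNReal.ofReal (formIntegrand t u u p)
        ∂(sqMeasure Ω) := by
        refine lintegral_mono_ae ?_
        filter_upwards [ae_mem_sqMeasure hΩ] with p hp
        rw [← ENNReal.ofReal_mul hRp]
        exact ENNReal.ofReal_le_ofReal
          (formIntegrand_le_of_le hst u (hdiam _ hp.1 _ hp.2))
    _ = _ := by
        rw [lintegral_const_mul' _ _ ENNReal.ofReal_ne_top, lintegral_formIntegrand_self hu,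
          ← ENNReal.ofReal_mul hRp]
        congr 1; ring

theorem exists_diam_bound (hb : Bornology.IsBounded Ω) :
    ∃ R : ℝ, 1 ≤ R ∧ ∀ x ∈ Ω, ∀ y ∈ Ω, ‖x - y‖ ≤ R := by
  obtain ⟨C, hC⟩ := Metric.isBounded_iff.1 hb
  exact ⟨max 1 C, le_max_left _ _, fun x hx y hy => by
    rw [← dist_eq_norm]; exact (hC hx hy).trans (le_max_right _ _)⟩

theorem energySpace_anti (hΩ : MeasurableSet Ω) (hb : Bornology.IsBounded Ω) {s t : ℝ}
    (hst : s ≤ t) : energySpace Ω t ≤ energySpace Ω s := fun u hu => by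
  obtain ⟨R, hR, hd⟩ := exists_diam_bound hb
  exact mem_energySpace_of_lintegral_le u
    (lintegral_formIntegrand_le_of_le hΩ hst (zero_le_one.trans hR) hd hu)

theorem energyForm_le_of_le (hΩ : MeasurableSet Ω) {s t R : ℝ} (hst : s ≤ t)
    (hR : 0 ≤ R) (hdiam : ∀ x ∈ Ω, ∀ y ∈ Ω, ‖x - y‖ ≤ R) {u : L2 Ω}
    (hu : u ∈ energySpace Ω t) :
    energyForm Ω s u u ≤ R ^ (2 * (t - s)) * energyForm Ω t u u :=
  energyForm_le_of_lintegral_le (mul_nonneg (by positivity) (energyForm_self_nonneg t u))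
    (lintegral_formIntegrand_le_of_le hΩ hst hR hdiam hu)

/-- The kernel of order s is dominated by the one of order 0 where |x-y| ≥ 1 and by the one of order
t where |x-y| ≤ 1. This is the s-independent majorant for dominated convergence. -/
theorem abs_formIntegrand_le {s t : ℝ} (hs : 0 ≤ s) (hst : s ≤ t)
    (u v : EuclideanSpace ℝ (Fin N) → ℝ)
    (p : EuclideanSpace ℝ (Fin N) × EuclideanSpace ℝ (Fin N)) :
    |formIntegrand s u v p| ≤ |formIntegrand 0 u v p| + |formIntegrand t u v p| := by
  rcases eq_or_ne p.1 p.2 with h | h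
  · simp [formIntegrand, h]
  · have hr : 0 < ‖p.1 - p.2‖ := norm_pos_iff.2 (sub_ne_zero.2 h)
    have hpos : ∀ a : ℝ, 0 < ‖p.1 - p.2‖ ^ a := fun a => Real.rpow_pos_of_pos hr a
    simp only [formIntegrand, abs_div, abs_of_pos (hpos _)]
    have hnum := abs_nonneg ((u p.1 - u p.2) * (v p.1 - v p.2))
    rcases le_total 1 ‖p.1 - p.2‖ with h1 | h1
    · refine le_add_of_le_of_nonneg (div_le_div_of_nonneg_left hnum (hpos _) ?_)
        (div_nonneg hnum (hpos _).le)
      exact Real.rpow_le_rpow_of_exponent_le h1 (by linarith)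
    · refine le_add_of_nonneg_of_le (div_nonneg hnum (hpos _).le)
        (div_le_div_of_nonneg_left hnum (hpos _) ?_)
      exact Real.rpow_le_rpow_of_exponent_ge hr h1 (by linarith)

theorem tendsto_energyForm {t : ℝ} (ht : 0 < t) {u v : L2 Ω} (hu : u ∈ energySpace Ω t)
    (hv : v ∈ energySpace Ω t) (hu0 : u ∈ energySpace Ω 0) (hv0 : v ∈ energySpace Ω 0) :
    Tendsto (fun s => energyForm Ω s u v) (𝓝[≥] 0) (𝓝 (energyForm Ω 0 u v)) := by
  refine Tendsto.const_mul _ ?_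
  refine tendsto_integral_filter_of_dominated_convergence
    (fun p => |formIntegrand 0 u v p| + |formIntegrand t u v p|)
    (Eventually.of_forall fun s => aestronglyMeasurable_formIntegrand s u v) ?_
    ((integrable_formIntegrand hu0 hv0).abs.add (integrable_formIntegrand hu hv).abs)
    (Eventually.of_forall fun p => ?_)
  · filter_upwards [self_mem_nhdsWithin, mem_nhdsWithin_of_mem_nhds (Iio_mem_nhds ht)] with s h1 h2
    exact Eventually.of_forall fun p => abs_formIntegrand_le h1 (le_of_lt h2) u v p
  · rcases eq_or_ne p.1 p.2 with h | h
    · simp [formIntegrand, h]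
    · have hr : 0 < ‖p.1 - p.2‖ := norm_pos_iff.2 (sub_ne_zero.2 h)
      refine tendsto_nhdsWithin_of_tendsto_nhds (Continuous.tendsto ?_ 0)
      unfold formIntegrand
      refine continuous_const.div ?_ fun s => (Real.rpow_pos_of_pos hr _).ne'
      exact Continuous.rpow continuous_const (by fun_prop) fun s => Or.inl hr.ne'

theorem isCompactForm_energyBilin {s : ℝ}
    (hc : ∀ (u : ℕ → energySpace Ω s) (C : ℝ), (∀ k, ‖(u k : L2 Ω)‖ ≤ C) →
      (∀ k, energyForm Ω s (u k).1 (u k).1 ≤ C) →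
      ∃ (φ : ℕ → ℕ) (x : L2 Ω), StrictMono φ ∧ Tendsto (fun k => (u (φ k) : L2 Ω)) atTop (𝓝 x)) :
    IsCompactForm (energyBilin Ω s) where
  symm u v := energyForm_comm s _ _
  nonneg u := energyForm_self_nonneg s _
  lsc u x C hx hu := by
    obtain ⟨h1, h2⟩ := energyForm_lsc s hx (fun k => (u k).2) hu
    exact ⟨h1, h2⟩
  compact := hc

end Forms

/-! ### Geometry of Lipschitz sets: interior shells and boundary layers -/

section Geometry

variable {N : ℕ} {Ω : Set (EuclideanSpace ℝ (Fin N))}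

/-- A segment is connected, and off the frontier it is covered by the disjoint open sets interior
and exterior of S. -/
theorem mem_of_segment_disjoint_frontier {E : Type*} [NormedAddCommGroup E] [NormedSpace ℝ E]
    {S : Set E} {x w : E} (hx : x ∈ S)
    (h : ∀ τ ∈ Icc (0 : ℝ) 1, x + τ • (w - x) ∉ frontier S) : w ∈ S := by
  have hseg : ∀ z ∈ segment ℝ x w, z ∉ frontier S := by
    rw [segment_eq_image']
    rintro _ ⟨τ, hτ, rfl⟩
    exact h τ hτ
  by_contra hw
  obtain ⟨z, -, hz1, hz2⟩ := (convex_segment (𝕜 := ℝ) x w).isPreconnected (interior S)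
    (closure S)ᶜ isOpen_interior isClosed_closure.isOpen_compl
    (fun z hz => by
      by_contra hcon
      rw [mem_union, not_or, notMem_compl_iff] at hcon
      exact hseg z hz ⟨hcon.2, hcon.1⟩)
    ⟨x, left_mem_segment ℝ x w, by
      by_contra hcon
      exact hseg x (left_mem_segment ℝ x w) ⟨subset_closure hx, hcon⟩⟩
    ⟨w, right_mem_segment ℝ x w, fun hcon =>
      hseg w (right_mem_segment ℝ x w) ⟨hcon, fun h => hw (interior_subset h)⟩⟩
  exact hz2 (subset_closure (interior_subset hz1))

/-- The signed height of a point over the graph of `f` in the direction `e`. -/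
noncomputable def graphHeight {N : ℕ} (e : EuclideanSpace ℝ (Fin N))
    (f : EuclideanSpace ℝ (Fin N) → ℝ) (x : EuclideanSpace ℝ (Fin N)) : ℝ :=
  inner ℝ e x - f (x - (inner ℝ e x : ℝ) • e)

section graphHeight

variable {e : EuclideanSpace ℝ (Fin N)} {f : EuclideanSpace ℝ (Fin N) → ℝ} {K : NNReal}

/-- Moving by a along e raises the height by exactly a. The remaining displacement d changes ⟪e, x⟫
by at most ‖d‖ and the base point by at most 2‖d‖, hence the value of f by at most 2K‖d‖. -/
theorem abs_graphHeight_add_smul_sub_le (he : ‖e‖ = 1) (hf : LipschitzWith K f)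
    (x d : EuclideanSpace ℝ (Fin N)) (a : ℝ) :
    |graphHeight e f (x + (a • e + d)) - graphHeight e f x - a| ≤ (2 * K + 1) * ‖d‖ := by
  have hee : (inner ℝ e e : ℝ) = 1 := by rw [real_inner_self_eq_norm_sq, he]; norm_num
  have h1 : |(inner ℝ e d : ℝ)| ≤ ‖d‖ := by
    have := abs_real_inner_le_norm e d
    rwa [he, one_mul] at this
  have h2 := hf.dist_le_mul (x + (a • e + d) - (inner ℝ e (x + (a • e + d)) : ℝ) • e)
    (x - (inner ℝ e x : ℝ) • e)
  have h3 : x + (a • e + d) - (inner ℝ e (x + (a • e + d)) : ℝ) • e - (x - (inner ℝ e x : ℝ) • e)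
      = d - (inner ℝ e d : ℝ) • e := by
    rw [inner_add_right, inner_add_right, inner_smul_right, hee]
    module
  have h4 : ‖d - (inner ℝ e d : ℝ) • e‖ ≤ 2 * ‖d‖ := by
    refine (norm_sub_le _ _).trans ?_
    rw [norm_smul, he, Real.norm_eq_abs]
    linarith
  rw [dist_eq_norm, dist_eq_norm, h3, Real.norm_eq_abs] at h2
  have h5 : graphHeight e f (x + (a • e + d)) - graphHeight e f x - a
      = inner ℝ e d - (f (x + (a • e + d) - (inner ℝ e (x + (a • e + d)) : ℝ) • e)
        - f (x - (inner ℝ e x : ℝ) • e)) := by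
    simp only [graphHeight, inner_add_right, inner_smul_right, hee]
    ring
  rw [h5]
  refine (abs_sub _ _).trans ?_
  have := mul_le_mul_of_nonneg_left h4 K.2
  have h6 : (K : ℝ) * ‖d - (inner ℝ e d : ℝ) • e‖ ≤ K * (2 * ‖d‖) := this
  linarith

theorem continuous_graphHeight (hf : LipschitzWith K f) : Continuous (graphHeight e f) := by
  have := hf.continuous
  unfold graphHeight
  fun_prop

/-- Fubini in the direction e without a change of coordinates: average the volume over the
translates by a e with 0 ≤ a ≤ 1. Along each line the height has unit speed, so the slab is met for
a set of a of length at most 2L; the translation enlarges the ball by 1. -/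
theorem volume_graphHeight_slab_le (he : ‖e‖ = 1) (hf : LipschitzWith K f)
    (p : EuclideanSpace ℝ (Fin N)) (r L : ℝ) :
    volume {x ∈ Metric.ball p r | |graphHeight e f x| ≤ L}
      ≤ volume (Metric.ball p (r + 1)) * ENNReal.ofReal (2 * L) := by
  set S := {x ∈ Metric.ball p r | |graphHeight e f x| ≤ L} with hS
  have hSm : MeasurableSet S := Metric.isOpen_ball.measurableSet.inter
    (isClosed_le (continuous_graphHeight hf).abs continuous_const).measurableSet
  have hshift : ∀ (x : EuclideanSpace ℝ (Fin N)) (a : ℝ),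
      graphHeight e f (x + a • e) = graphHeight e f x + a := fun x a => by
    have := abs_graphHeight_add_smul_sub_le he hf x 0 a
    simp only [norm_zero, mul_zero, add_zero] at this
    linarith [abs_nonpos_iff.1 this]
  have hmeas : Measurable fun q : ℝ × EuclideanSpace ℝ (Fin N) =>
      S.indicator (1 : EuclideanSpace ℝ (Fin N) → ENNReal) (q.2 + q.1 • e) :=
    (measurable_one.indicator hSm).comp (by fun_prop)
  calc volume S = ∫⁻ a in Icc (0 : ℝ) 1, volume S := by simp
    _ = ∫⁻ a in Icc (0 : ℝ) 1, ∫⁻ x : EuclideanSpace ℝ (Fin N),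
          S.indicator 1 (x + a • e) := by
        refine lintegral_congr fun a => ?_
        rw [lintegral_add_right_eq_self (S.indicator 1), lintegral_indicator_one hSm]
    _ = ∫⁻ x : EuclideanSpace ℝ (Fin N), ∫⁻ a in Icc (0 : ℝ) 1, S.indicator 1 (x + a • e) :=
        lintegral_lintegral_swap hmeas.aemeasurable
    _ ≤ ∫⁻ x, (Metric.ball p (r + 1)).indicator (fun _ => ENNReal.ofReal (2 * L)) x := by
        refine lintegral_mono fun x => ?_
        by_cases hx : x ∈ Metric.ball p (r + 1)
        · rw [indicator_of_mem hx]
          calc _ ≤ ∫⁻ a in Icc (0 : ℝ) 1,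
                (Icc (-L - graphHeight e f x) (L - graphHeight e f x)).indicator 1 a := by
                refine lintegral_mono fun a => ?_
                by_cases h : x + a • e ∈ S
                · have := h.2
                  rw [hshift, abs_le] at this
                  rw [indicator_of_mem h, indicator_of_mem (mem_Icc.2 ⟨by linarith, by linarith⟩)]
                  rfl
                · rw [indicator_of_notMem h]
                  exact zero_le
            _ ≤ ∫⁻ a, (Icc (-L - graphHeight e f x) (L - graphHeight e f x)).indicator 1 a :=
                setLIntegral_le_lintegral _ _
            _ = ENNReal.ofReal (2 * L) := by
                rw [lintegral_indicator_one measurableSet_Icc, Real.volume_Icc]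
                congr 1; ring
        · rw [indicator_of_notMem hx, nonpos_iff_eq_zero]
          refine (setLIntegral_congr_fun measurableSet_Icc fun a ha => ?_).trans
            (lintegral_zero)
          refine indicator_of_notMem (fun h => hx ?_) _
          have h1 := h.1
          rw [Metric.mem_ball, dist_eq_norm] at h1 ⊢
          calc ‖x - p‖ = ‖(x + a • e - p) - a • e‖ := by congr 1; abel
            _ ≤ ‖x + a • e - p‖ + ‖a • e‖ := norm_sub_le _ _
            _ < r + 1 := by
              rw [norm_smul, he, mul_one, Real.norm_of_nonneg ha.1]
              linarith [ha.2]
    _ = _ := by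
        rw [lintegral_indicator_const Metric.isOpen_ball.measurableSet, mul_comm]

end graphHeight

theorem IsBoundedLipschitzSet.isCompact_frontier (hΩ : IsBoundedLipschitzSet Ω) :
    IsCompact (frontier Ω) :=
  hΩ.isBounded.isCompact_closure.of_isClosed_subset isClosed_frontier frontier_subset_closure

theorem IsBoundedLipschitzSet.exists_local_graph (hΩ : IsBoundedLipschitzSet Ω)
    {p : EuclideanSpace ℝ (Fin N)} (hp : p ∈ frontier Ω) :
    ∃ (r : ℝ) (e : EuclideanSpace ℝ (Fin N)) (f : EuclideanSpace ℝ (Fin N) → ℝ) (K : NNReal),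
      0 < r ∧ ‖e‖ = 1 ∧ LipschitzWith K f ∧
        ∀ x ∈ Metric.ball p r, x ∈ frontier Ω ↔ graphHeight e f x = 0 := by
  obtain ⟨U, e, f, K, hU, hpU, he, hf, hgr⟩ := hΩ.boundary_graph p hp
  obtain ⟨r, hr, hrU⟩ := Metric.isOpen_iff.1 hU p hpU
  refine ⟨r, e, f, K, hr, he, hf, fun x hx => ?_⟩
  have hxU := hrU hx
  rw [graphHeight, sub_eq_zero]
  constructor
  · intro h
    have : x ∈ frontier Ω ∩ U := ⟨h, hxU⟩
    rw [hgr] at this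
    exact this.1
  · intro h
    have : x ∈ frontier Ω ∩ U := by rw [hgr]; exact ⟨h, hxU⟩
    exact this.1

/-- The part of `Ω` in the spherical shell of radii `ρ / 2` and `ρ` about `x` contains a ball of
radius `c ρ`. -/
def HasShellBall {N : ℕ} (Ω : Set (EuclideanSpace ℝ (Fin N))) (c : ℝ)
    (x : EuclideanSpace ℝ (Fin N)) (ρ : ℝ) : Prop :=
  ∃ y, Metric.ball y (c * ρ) ⊆ {w ∈ Ω | ρ / 2 ≤ ‖w - x‖ ∧ ‖w - x‖ < ρ}

theorem HasShellBall.mono {c c' ρ : ℝ} {x : EuclideanSpace ℝ (Fin N)} (hc : c' ≤ c) (hρ : 0 ≤ ρ)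
    (h : HasShellBall Ω c x ρ) : HasShellBall Ω c' x ρ := by
  obtain ⟨y, hy⟩ := h
  exact ⟨y, (Metric.ball_subset_ball (mul_le_mul_of_nonneg_right hc hρ)).trans hy⟩

/-- The centre lies at distance 3ρ/4 from x, midway through the shell, so radius at most ρ/4 keeps
the ball inside the shell. -/
theorem hasShellBall_of_forall {c ρ σ : ℝ} {x e : EuclideanSpace ℝ (Fin N)} (he : ‖e‖ = 1)
    (hσ : |σ| = 1) (hc : c ≤ 1 / 4) (hρ : 0 < ρ)
    (h : ∀ d : EuclideanSpace ℝ (Fin N), ‖d‖ < c * ρ → x + ((σ * (3 / 4 * ρ)) • e + d) ∈ Ω) :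
    HasShellBall Ω c x ρ := by
  refine ⟨x + (σ * (3 / 4 * ρ)) • e, fun w hw => ?_⟩
  rw [Metric.mem_ball, dist_eq_norm] at hw
  have h1 : c * ρ ≤ 1 / 4 * ρ := mul_le_mul_of_nonneg_right hc hρ.le
  have h2 : ‖(σ * (3 / 4 * ρ)) • e‖ = 3 / 4 * ρ := by
    rw [norm_smul, he, mul_one, Real.norm_eq_abs, abs_mul, hσ, one_mul, abs_of_pos (by positivity)]
  have h3 : w - x = (σ * (3 / 4 * ρ)) • e + (w - (x + (σ * (3 / 4 * ρ)) • e)) := by abel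
  refine ⟨?_, ?_, ?_⟩
  · have := h _ hw
    rwa [← h3, add_sub_cancel] at this
  · have := norm_sub_le (w - x) (w - (x + (σ * (3 / 4 * ρ)) • e))
    have h4 : w - x - (w - (x + (σ * (3 / 4 * ρ)) • e)) = (σ * (3 / 4 * ρ)) • e := by abel
    rw [h4, h2] at this
    linarith
  · rw [h3]
    refine (norm_add_le _ _).trans_lt ?_
    rw [h2]
    linarith

/-- From x move along ±e away from the graph. The absolute height then grows faster than sideways
perturbations can reduce it, so the path never meets the frontier and stays in Ω. -/
theorem IsBoundedLipschitzSet.exists_shellBall_near (hΩ : IsBoundedLipschitzSet Ω)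
    {p : EuclideanSpace ℝ (Fin N)} (hp : p ∈ frontier Ω) :
    ∃ c r : ℝ, 0 < c ∧ 0 < r ∧ ∀ x ∈ Ω, ‖x - p‖ < r → ∀ ρ, 0 < ρ → ρ ≤ r →
      HasShellBall Ω c x ρ := by
  obtain ⟨r, e, f, K, hr, he, hf, hgr⟩ := hΩ.exists_local_graph hp
  -- With (2K+1) c = 1/4 the perturbation d changes the height by at most ρ/4, against the gain 3ρ/4
  -- along e.
  set c : ℝ := 1 / (4 * (2 * K + 1)) with hc
  have hK : (0 : ℝ) ≤ K := K.2
  have hc0 : 0 < c := by positivity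
  have hcK : (2 * K + 1) * c = 1 / 4 := by rw [hc]; field_simp
  have hc4 : c ≤ 1 / 4 := by nlinarith
  refine ⟨c, r / 2, hc0, by positivity, fun x hx hxp ρ hρ hρr => ?_⟩
  have hx0 : graphHeight e f x ≠ 0 := fun h => by
    have hxf := (hgr x (by rw [Metric.mem_ball, dist_eq_norm]; linarith)).2 h
    rw [hΩ.isOpen.frontier_eq] at hxf
    exact hxf.2 hx
  -- The boundary condition does not say on which side of the graph Ω lies, and it may lie on both,
  -- so the direction depends on the sign of the height at x.
  obtain ⟨σ, hσ, hσpos⟩ : ∃ σ : ℝ, |σ| = 1 ∧ 0 < σ * graphHeight e f x := by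
    rcases lt_or_gt_of_ne hx0 with h | h
    · exact ⟨-1, by norm_num, by linarith⟩
    · exact ⟨1, by norm_num, by linarith⟩
  have hσσ : σ * σ = 1 := by rw [← abs_mul_abs_self, hσ, one_mul]
  refine hasShellBall_of_forall he hσ hc4 hρ fun d hd => ?_
  refine mem_of_segment_disjoint_frontier hx fun τ hτ => ?_
  have hz : x + τ • (x + ((σ * (3 / 4 * ρ)) • e + d) - x)
      = x + ((τ * (σ * (3 / 4 * ρ))) • e + τ • d) := by
    rw [add_sub_cancel_left, smul_add, smul_smul]
  rw [hz]
  have hd4 : ‖d‖ ≤ 1 / 4 * ρ := hd.le.trans (mul_le_mul_of_nonneg_right hc4 hρ.le)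
  have hnear : x + ((τ * (σ * (3 / 4 * ρ))) • e + τ • d) ∈ Metric.ball p r := by
    rw [Metric.mem_ball, dist_eq_norm, add_sub_right_comm]
    refine (norm_add_le _ _).trans_lt ?_
    have h1 : ‖(τ * (σ * (3 / 4 * ρ))) • e + τ • d‖ ≤ ρ := by
      refine (norm_add_le _ _).trans ?_
      rw [norm_smul, norm_smul, he, mul_one, Real.norm_eq_abs, Real.norm_eq_abs, abs_mul, abs_mul,
        hσ, abs_of_nonneg hτ.1, abs_of_pos (by positivity : 0 < 3 / 4 * ρ)]
      nlinarith [hτ.2, hτ.1, norm_nonneg d]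
    linarith
  rw [hgr _ hnear]
  have h1 := abs_graphHeight_add_smul_sub_le he hf x (τ • d) (τ * (σ * (3 / 4 * ρ)))
  rw [norm_smul, Real.norm_of_nonneg hτ.1] at h1
  intro h0
  rw [h0] at h1
  have h2 : (2 * (K : ℝ) + 1) * (τ * ‖d‖) ≤ τ * (1 / 4 * ρ) := by
    have : (2 * (K : ℝ) + 1) * ‖d‖ ≤ 1 / 4 * ρ := by
      calc (2 * (K : ℝ) + 1) * ‖d‖ ≤ (2 * K + 1) * (c * ρ) :=
            mul_le_mul_of_nonneg_left hd.le (by positivity)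
        _ = 1 / 4 * ρ := by rw [← mul_assoc, hcK]
    nlinarith [hτ.1]
  -- A zero height at time τ would give this bound, which contradicts the positive signed height at
  -- x.
  have h3 : σ * graphHeight e f x + τ * (3 / 4 * ρ) ≤ τ * (1 / 4 * ρ) := by
    calc σ * graphHeight e f x + τ * (3 / 4 * ρ)
        = -(σ * (0 - graphHeight e f x - τ * (σ * (3 / 4 * ρ)))) := by
          linear_combination (-τ * (3 / 4 * ρ)) * hσσ
      _ ≤ |σ * (0 - graphHeight e f x - τ * (σ * (3 / 4 * ρ)))| := neg_le_abs _
      _ ≤ _ := by rw [abs_mul, hσ, one_mul]; exact h1.trans h2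
  nlinarith [mul_nonneg hτ.1 hρ.le]

/-- The uniform interior shell condition for Lipschitz sets. -/
theorem IsBoundedLipschitzSet.exists_shellBall (hN : 1 ≤ N) (hΩ : IsBoundedLipschitzSet Ω) :
    ∃ c r : ℝ, 0 < c ∧ 0 < r ∧ ∀ x ∈ Ω, ∀ ρ, 0 < ρ → ρ ≤ r → HasShellBall Ω c x ρ := by
  -- Compactness makes c and r uniform for all points of Ω within r of the frontier.
  obtain ⟨c, r, hc, hr, h⟩ := hΩ.isCompact_frontier.induction_on
    (p := fun S => ∃ c r : ℝ, 0 < c ∧ 0 < r ∧ ∀ x ∈ Ω, (∃ q ∈ S, ‖x - q‖ < r) →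
      ∀ ρ, 0 < ρ → ρ ≤ r → HasShellBall Ω c x ρ)
    ⟨1, 1, one_pos, one_pos, fun x _ ⟨q, hq, _⟩ => hq.elim⟩
    (fun S T hST ⟨c, r, hc, hr, h⟩ =>
      ⟨c, r, hc, hr, fun x hx ⟨q, hq, hxq⟩ => h x hx ⟨q, hST hq, hxq⟩⟩)
    (fun S T ⟨c, r, hc, hr, h⟩ ⟨c', r', hc', hr', h'⟩ => by
      refine ⟨min c c', min r r', lt_min hc hc', lt_min hr hr', ?_⟩
      rintro x hx ⟨q, hq | hq, hxq⟩ ρ hρ hρr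
      · exact (h x hx ⟨q, hq, hxq.trans_le (min_le_left _ _)⟩ ρ hρ
          (hρr.trans (min_le_left _ _))).mono (min_le_left _ _) hρ.le
      · exact (h' x hx ⟨q, hq, hxq.trans_le (min_le_right _ _)⟩ ρ hρ
          (hρr.trans (min_le_right _ _))).mono (min_le_right _ _) hρ.le)
    (fun p hp => by
      obtain ⟨c, r, hc, hr, h⟩ := hΩ.exists_shellBall_near hp
      refine ⟨Metric.ball p (r / 2), mem_nhdsWithin_of_mem_nhds (Metric.ball_mem_nhds _ (by positivity)),
        c, r / 2, hc, by positivity, ?_⟩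
      rintro x hx ⟨q, hq, hxq⟩ ρ hρ hρr
      refine h x hx ?_ ρ hρ (by linarith)
      rw [Metric.mem_ball, dist_eq_norm] at hq
      have := norm_sub_le_norm_sub_add_norm_sub x q p
      linarith)
  have : Nontrivial (EuclideanSpace ℝ (Fin N)) := by
    have : Nonempty (Fin N) := ⟨⟨0, hN⟩⟩
    infer_instance
  obtain ⟨e, he⟩ := exists_norm_eq (EuclideanSpace ℝ (Fin N)) zero_le_one
  refine ⟨min c (1 / 4), r, by positivity, hr, fun x hx ρ hρ hρr => ?_⟩
  by_cases hnear : ∃ q ∈ frontier Ω, ‖x - q‖ < r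
  · exact (h x hx hnear ρ hρ hρr).mono (min_le_left _ _) hρ.le
  -- Far from the frontier any direction works: the path is shorter than ρ ≤ r.
  · push Not at hnear
    refine hasShellBall_of_forall he (σ := 1) (by norm_num) (min_le_right _ _) hρ fun d hd => ?_
    refine mem_of_segment_disjoint_frontier hx fun τ hτ hf => ?_
    have h1 := hnear _ hf
    have hd4 : ‖d‖ < 1 / 4 * ρ := hd.trans_le (mul_le_mul_of_nonneg_right (min_le_right _ _) hρ.le)
    rw [add_sub_cancel_left, sub_add_cancel_left, norm_neg, norm_smul,
      Real.norm_of_nonneg hτ.1] at h1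
    have h2 : ‖((1 : ℝ) * (3 / 4 * ρ)) • e + d‖ < ρ := by
      refine (norm_add_le _ _).trans_lt ?_
      rw [norm_smul, he, one_mul, mul_one, Real.norm_of_nonneg (by positivity)]
      linarith
    nlinarith [hτ.1, hτ.2, norm_nonneg (((1 : ℝ) * (3 / 4 * ρ)) • e + d)]

/-- Locally, points within ρ of the graph have height at most (2K+1)ρ in absolute value, so they lie
in a slab of volume O(ρ); compactness of the frontier makes the bound global. -/
theorem IsBoundedLipschitzSet.exists_volume_thickening_le (hΩ : IsBoundedLipschitzSet Ω) :
    ∃ C δ : ℝ, 0 ≤ C ∧ 0 < δ ∧ ∀ ρ, 0 ≤ ρ → ρ ≤ δ →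
      volume {x | ∃ q ∈ frontier Ω, ‖x - q‖ ≤ ρ} ≤ ENNReal.ofReal (C * ρ) := by
  refine hΩ.isCompact_frontier.induction_on
    (p := fun S => ∃ C δ : ℝ, 0 ≤ C ∧ 0 < δ ∧ ∀ ρ, 0 ≤ ρ → ρ ≤ δ →
      volume {x | ∃ q ∈ S, ‖x - q‖ ≤ ρ} ≤ ENNReal.ofReal (C * ρ)) ?_ ?_ ?_ ?_
  · exact ⟨0, 1, le_rfl, one_pos, fun ρ _ _ => by simp⟩
  · rintro S T hST ⟨C, δ, hC, hδ, h⟩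
    refine ⟨C, δ, hC, hδ, fun ρ h0 h1 => (measure_mono ?_).trans (h ρ h0 h1)⟩
    rintro x ⟨q, hq, hx⟩
    exact ⟨q, hST hq, hx⟩
  · rintro S T ⟨C, δ, hC, hδ, h⟩ ⟨C', δ', hC', hδ', h'⟩
    refine ⟨C + C', min δ δ', by positivity, by positivity, fun ρ h0 h1 => ?_⟩
    rw [add_mul, ENNReal.ofReal_add (by positivity) (by positivity)]
    refine (measure_mono ?_).trans ((measure_union_le _ _).trans
      (add_le_add (h ρ h0 (h1.trans (min_le_left _ _))) (h' ρ h0 (h1.trans (min_le_right _ _)))))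
    rintro x ⟨q, hq | hq, hx⟩
    · exact Or.inl ⟨q, hq, hx⟩
    · exact Or.inr ⟨q, hq, hx⟩
  · intro p hp
    obtain ⟨r, e, f, K, hr, he, hf, hgr⟩ := hΩ.exists_local_graph hp
    refine ⟨frontier Ω ∩ Metric.ball p r,
      inter_mem_nhdsWithin _ (Metric.ball_mem_nhds _ hr),
      (volume (Metric.ball p (r + 2 + 1))).toReal * (2 * (2 * K + 1)), 1, by positivity, one_pos,
      fun ρ h0 h1 => ?_⟩
    refine (measure_mono ?_).trans ((volume_graphHeight_slab_le he hf p (r + 2)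
      ((2 * K + 1) * ρ)).trans_eq ?_)
    · rintro x ⟨q, ⟨hqf, hqb⟩, hx⟩
      have hq0 := (hgr q hqb).1 hqf
      rw [Metric.mem_ball, dist_eq_norm] at hqb
      refine ⟨?_, ?_⟩
      · rw [Metric.mem_ball, dist_eq_norm]
        have := norm_sub_le_norm_sub_add_norm_sub x q p
        linarith
      · have := abs_graphHeight_add_smul_sub_le he hf q (x - q) 0
        rw [zero_smul, zero_add, add_sub_cancel, hq0, sub_zero, sub_zero] at this
        exact this.trans (mul_le_mul_of_nonneg_left hx (by positivity))
    · rw [mul_assoc, ENNReal.ofReal_mul ENNReal.toReal_nonneg,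
        ENNReal.ofReal_toReal measure_ball_lt_top.ne, mul_assoc]

/-- If x is in Ω and x + z is not, the segment between them meets the frontier, so x is within ‖z‖
of it. For ‖z‖ ≥ δ the trivial bound |Ω| ≤ (|Ω|/δ) ‖z‖ suffices. -/
theorem IsBoundedLipschitzSet.exists_volume_escape_le (hΩ : IsBoundedLipschitzSet Ω) :
    ∃ C : ℝ, 0 ≤ C ∧ ∀ z, volume {x ∈ Ω | x + z ∉ Ω} ≤ ENNReal.ofReal (C * ‖z‖) := by
  obtain ⟨C, δ, hC, hδ, h⟩ := hΩ.exists_volume_thickening_le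
  refine ⟨C + (volume Ω).toReal / δ, by positivity, fun z => ?_⟩
  rcases le_total ‖z‖ δ with hz | hz
  · refine (measure_mono ?_).trans ((h ‖z‖ (norm_nonneg _) hz).trans
      (ENNReal.ofReal_le_ofReal ?_))
    · rintro x ⟨hx, hxz⟩
      by_contra hcon
      refine hxz (mem_of_segment_disjoint_frontier hx fun τ hτ hf => hcon ⟨_, hf, ?_⟩)
      rw [add_sub_cancel_left, sub_add_cancel_left, norm_neg, norm_smul, Real.norm_of_nonneg hτ.1]
      exact mul_le_of_le_one_left (norm_nonneg _) hτ.2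
    · exact mul_le_mul_of_nonneg_right (le_add_of_nonneg_right (by positivity)) (norm_nonneg _)
  · refine (measure_mono (t := Ω) fun x hx => hx.1).trans ?_
    refine (ENNReal.ofReal_toReal hΩ.isBounded.measure_lt_top.ne).symm.le.trans
      (ENNReal.ofReal_le_ofReal ?_)
    have h1 : (volume Ω).toReal = (volume Ω).toReal / δ * δ := by field_simp
    have h2 : (volume Ω).toReal / δ * δ ≤ (volume Ω).toReal / δ * ‖z‖ :=
      mul_le_mul_of_nonneg_left hz (by positivity)
    nlinarith [norm_nonneg z, mul_nonneg hC (norm_nonneg z)]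

/-- Polar coordinates reduce this to the integrability of y^(N-1-q) near 0. -/
theorem lintegral_norm_rpow_neg_ball_lt_top (hN : 1 ≤ N) {q : ℝ} (hq : q < N) (R : ℝ) :
    ∫⁻ z in Metric.ball (0 : EuclideanSpace ℝ (Fin N)) R, ENNReal.ofReal (‖z‖ ^ (-q)) < ⊤ := by
  have : Nontrivial (EuclideanSpace ℝ (Fin N)) := by
    have : Nonempty (Fin N) := ⟨⟨0, hN⟩⟩
    infer_instance
  have h : IntegrableOn (fun z : EuclideanSpace ℝ (Fin N) => ‖z‖ ^ (-q)) (Metric.ball 0 R) := by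
    rw [integrableOn_fun_norm_addHaar (μ := volume) (f := fun y : ℝ => y ^ (-q))]
    rcases le_or_gt R 0 with hR | hR
    · simp [Ioo_eq_empty_of_le hR]
    refine (integrableOn_congr_fun (g := fun y : ℝ => y ^ ((N : ℝ) - 1 - q)) ?_
      measurableSet_Ioo).2 ((intervalIntegral.integrableOn_Ioo_rpow_iff hR).2 (by linarith))
    intro y hy
    simp only [finrank_euclideanSpace, Fintype.card_fin, smul_eq_mul]
    rw [← Real.rpow_natCast, ← Real.rpow_add hy.1, Nat.cast_sub hN]
    congr 1
    push_cast; ring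
  exact (hasFiniteIntegral_iff_ofReal (Eventually.of_forall fun z => by positivity)).1 h.2

end Geometry

/-! ### Compact embedding of ℍ⁰(Ω) in L²(Ω) -/

section Compactness

theorem totallyBounded_of_finiteDimensional_approx {H : Type*} [NormedAddCommGroup H]
    [NormedSpace ℝ H] {S : Set H} {C : ℝ} (hC : ∀ u ∈ S, ‖u‖ ≤ C)
    (h : ∀ ε > 0, ∃ F : Submodule ℝ H, FiniteDimensional ℝ F ∧ ∀ u ∈ S, ∃ f ∈ F, ‖u - f‖ ≤ ε) :
    TotallyBounded S := by
  rw [Metric.totallyBounded_iff]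
  intro ε hε
  obtain ⟨F, hF, hSF⟩ := h (ε / 3) (by positivity)
  have : ProperSpace F := FiniteDimensional.proper ℝ F
  have hcpt : IsCompact ((F.subtype) '' Metric.closedBall (0 : F) (C + ε / 3)) :=
    (isCompact_closedBall _ _).image continuous_subtype_val
  obtain ⟨t, ht, hcov⟩ := Metric.totallyBounded_iff.1 hcpt.totallyBounded (ε / 3) (by positivity)
  refine ⟨t, ht, fun u hu => ?_⟩
  obtain ⟨f, hf, huf⟩ := hSF u hu
  have hfn : ‖f‖ ≤ C + ε / 3 := by
    have := norm_sub_norm_le f u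
    rw [norm_sub_rev] at this
    linarith [hC u hu]
  have hmem : f ∈ F.subtype '' Metric.closedBall (0 : F) (C + ε / 3) :=
    ⟨⟨f, hf⟩, by simpa using hfn, rfl⟩
  obtain ⟨y, hy, hfy⟩ := mem_iUnion₂.1 (hcov hmem)
  refine mem_iUnion₂.2 ⟨y, hy, ?_⟩
  rw [Metric.mem_ball, dist_eq_norm] at hfy ⊢
  have := norm_sub_le_norm_sub_add_norm_sub u f y
  linarith

/-- The weighted second moment about c is the total mass times the squared distance from c to the
mean, plus the variance, which is nonnegative. It serves both the compactness estimate and, with c =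
0 and mass one, Jensen's inequality for mollification. -/
theorem weighted_sq_sub_average_le {α : Type*} [MeasurableSpace α] {μ : Measure α}
    {k w : α → ℝ} (hk : ∀ y, 0 ≤ k y) (hk1 : Integrable k μ)
    (hkw : Integrable (fun y => k y * w y) μ) (hkw2 : Integrable (fun y => k y * w y ^ 2) μ)
    (hpos : 0 < ∫ y, k y ∂μ) (c : ℝ) :
    (∫ y, k y ∂μ) * (c - (∫ y, k y * w y ∂μ) / ∫ y, k y ∂μ) ^ 2
      ≤ ∫ y, k y * (c - w y) ^ 2 ∂μ := by
  set κ := ∫ y, k y ∂μ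
  set A := ∫ y, k y * w y ∂μ
  have hexp : ∀ g : ℝ, ∫ y, k y * (g - w y) ^ 2 ∂μ
      = g ^ 2 * κ - 2 * g * A + ∫ y, k y * w y ^ 2 ∂μ := fun g => by
    have hi : Integrable (fun y => g ^ 2 * k y - 2 * g * (k y * w y)) μ :=
      (hk1.const_mul _).sub (hkw.const_mul _)
    rw [← integral_const_mul, ← integral_const_mul,
      ← integral_sub (hk1.const_mul _) (hkw.const_mul _), ← integral_add hi hkw2]
    refine integral_congr_ae (Eventually.of_forall fun y => ?_)
    simp only
    ring
  have h0 : 0 ≤ ∫ y, k y * (A / κ - w y) ^ 2 ∂μ :=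
    integral_nonneg fun y => mul_nonneg (hk y) (sq_nonneg _)
  rw [hexp] at h0 ⊢
  have h1 : κ * (c - A / κ) ^ 2 = c ^ 2 * κ - 2 * c * A + A ^ 2 / κ := by
    field_simp
    ring
  have h2 : (A / κ) ^ 2 * κ - 2 * (A / κ) * A = - (A ^ 2 / κ) := by
    field_simp
    ring
  rw [h1]
  linarith

variable {N : ℕ} {Ω : Set (EuclideanSpace ℝ (Fin N))}

/-- The truncated logarithmic kernel has uniformly large mass on a Lipschitz set. -/
theorem IsBoundedLipschitzSet.exists_kernel_mass_ge (hN : 1 ≤ N) (hΩ : IsBoundedLipschitzSet Ω)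
    (M : ℝ) : ∃ h : ℝ, 0 < h ∧ ∀ x ∈ Ω,
      ENNReal.ofReal M ≤ ∫⁻ y in Ω, ENNReal.ofReal (((‖x - y‖ + h) ^ N)⁻¹) := by
  have : Nontrivial (EuclideanSpace ℝ (Fin N)) := by
    have : Nonempty (Fin N) := ⟨⟨0, hN⟩⟩
    infer_instance
  obtain ⟨c, r, hc, hr, hball⟩ := hΩ.exists_shellBall hN
  set V : ℝ := (volume (Metric.ball (0 : EuclideanSpace ℝ (Fin N)) 1)).toReal with hV
  have hVpos : 0 < V :=
    ENNReal.toReal_pos (Metric.measure_ball_pos volume _ one_pos).ne' measure_ball_lt_top.ne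
  -- A lower bound for the kernel mass of one dyadic shell: a ball of radius c ρ_i on which the
  -- kernel is at least (2ρ_i)^(-N). It does not depend on i, so m ≥ M / b shells suffice; the
  -- cutoff scale is then the smallest radius ρ_m.
  set b : ℝ := (c / 2) ^ N * V with hb
  have hbpos : 0 < b := by positivity
  obtain ⟨m, hm⟩ := exists_nat_ge (M / b)
  rw [div_le_iff₀ hbpos] at hm
  set ρ : ℕ → ℝ := fun i => r / 2 ^ i with hρdef
  have hρpos : ∀ i, 0 < ρ i := fun i => by positivity
  have hρanti : ∀ i j, i ≤ j → ρ j ≤ ρ i := fun i j hij => by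
    have : (2 : ℝ) ^ i ≤ 2 ^ j := pow_le_pow_right₀ (by norm_num) hij
    exact div_le_div_of_nonneg_left hr.le (by positivity) this
  have hρr : ∀ i, ρ i ≤ r := fun i => by simpa [hρdef] using hρanti 0 i (Nat.zero_le _)
  have hρsucc : ∀ i, ρ (i + 1) = ρ i / 2 := fun i => by
    simp only [hρdef, pow_succ]; field_simp
  refine ⟨ρ m, hρpos m, fun x hx => ?_⟩
  choose y hy using fun i => hball x hx (ρ i) (hρpos i) (hρr i)
  set B : Fin m → Set (EuclideanSpace ℝ (Fin N)) := fun i => Metric.ball (y i) (c * ρ i) with hB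
  have hBm : ∀ i, MeasurableSet (B i) := fun i => Metric.isOpen_ball.measurableSet
  -- Shell i stays outside radius ρ_i / 2 = ρ_{i+1}, and shell j > i lies inside radius ρ_j ≤
  -- ρ_{i+1}.
  have hlt : ∀ i j : Fin m, i < j → Disjoint (B i) (B j) := fun i j hij => by
    rw [Set.disjoint_left]
    intro w hwi hwj
    have h1 := (hy i hwi).2.1
    have h2 := (hy j hwj).2.2
    have h3 := hρanti (i + 1) j hij
    rw [hρsucc] at h3
    linarith
  have hdisj : Pairwise (Function.onFun Disjoint B) := fun i j hij => by
    rcases lt_or_gt_of_ne hij with h | h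
    · exact hlt i j h
    · exact (hlt j i h).symm
  have hone : ∀ i, ENNReal.ofReal b
      ≤ ∫⁻ w in B i, ENNReal.ofReal (((‖x - w‖ + ρ m) ^ N)⁻¹) := fun i => by
    calc ENNReal.ofReal b
        = ENNReal.ofReal (((2 * ρ i) ^ N)⁻¹) * volume (B i) := by
          rw [hB]
          simp only
          rw [Measure.addHaar_ball _ _ (mul_pos hc (hρpos i)).le, finrank_euclideanSpace,
            Fintype.card_fin, ← ENNReal.ofReal_toReal
              (measure_ball_lt_top (μ := volume) (x := (0 : EuclideanSpace ℝ (Fin N)))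
                (r := 1)).ne, ← hV, ← ENNReal.ofReal_mul (by have := hρpos i; positivity),
            ← ENNReal.ofReal_mul (by have := hρpos i; positivity)]
          congr 1
          have := (hρpos i).ne'
          rw [hb, div_pow, mul_pow, mul_pow]
          field_simp
      _ = ∫⁻ w in B i, ENNReal.ofReal (((2 * ρ i) ^ N)⁻¹) := by rw [setLIntegral_const]
      _ ≤ _ := by
          refine setLIntegral_mono' (hBm i) fun w hw => ENNReal.ofReal_le_ofReal ?_
          have h1 := (hy i hw).2.2
          rw [norm_sub_rev] at h1
          have h2 := hρanti i m i.2.le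
          have h3 := hρpos m
          gcongr
          linarith
  calc ENNReal.ofReal M ≤ ENNReal.ofReal (m * b) := ENNReal.ofReal_le_ofReal hm
    _ = ∑ _i : Fin m, ENNReal.ofReal b := by
        rw [Finset.sum_const, Finset.card_univ, Fintype.card_fin, nsmul_eq_mul,
          ENNReal.ofReal_mul (Nat.cast_nonneg _), ENNReal.ofReal_natCast]
    _ ≤ ∑ i, ∫⁻ w in B i, ENNReal.ofReal (((‖x - w‖ + ρ m) ^ N)⁻¹) :=
        Finset.sum_le_sum fun i _ => hone i
    _ = ∫⁻ w in ⋃ i, B i, ENNReal.ofReal (((‖x - w‖ + ρ m) ^ N)⁻¹) := by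
        rw [lintegral_iUnion hBm hdisj, tsum_fintype]
    _ ≤ _ := lintegral_mono_set (iUnion_subset fun i w hw => (hy i hw).1)

theorem exists_simpleFunc_near (hb : Bornology.IsBounded Ω) {h : ℝ} (hh : 0 < h) :
    ∃ π : SimpleFunc (EuclideanSpace ℝ (Fin N)) (EuclideanSpace ℝ (Fin N)),
      ∀ x ∈ Ω, ‖π x - x‖ ≤ h := by
  obtain ⟨t, ht, hcov⟩ := Metric.totallyBounded_iff.1
    (hb.isCompact_closure.totallyBounded.subset subset_closure) h hh
  obtain ⟨l, hl⟩ : ∃ l : List (EuclideanSpace ℝ (Fin N)), ∀ z, z ∈ l ↔ z ∈ t :=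
    ⟨ht.toFinset.toList, by simp⟩
  refine ⟨SimpleFunc.nearestPt (fun i => l.getD i 0) l.length, fun x hx => ?_⟩
  obtain ⟨z, hz, hxz⟩ := mem_iUnion₂.1 (hcov hx)
  obtain ⟨i, hi, rfl⟩ := List.getElem_of_mem ((hl z).2 hz)
  have h1 := SimpleFunc.edist_nearestPt_le (fun i => l.getD i 0) x hi.le
  rw [edist_dist, edist_dist, ENNReal.ofReal_le_ofReal_iff dist_nonneg, dist_eq_norm] at h1
  refine h1.trans ?_
  simp only [List.getD_eq_getElem _ _ hi]
  rw [dist_comm]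
  exact (Metric.mem_ball.1 hxz).le

theorem memLp_comp_simpleFunc (hb : Bornology.IsBounded Ω)
    (π : SimpleFunc (EuclideanSpace ℝ (Fin N)) (EuclideanSpace ℝ (Fin N))) (g : π.range → ℝ) :
    MemLp (fun x => g ⟨π x, π.mem_range_self x⟩) 2 (volume.restrict Ω) := by
  have hfin : IsFiniteMeasure (volume.restrict Ω) := ⟨by simpa using hb.measure_lt_top⟩
  refine MemLp.of_bound (C := ∑ c, |g c|) ?_ (Eventually.of_forall fun x => ?_)
  · exact ((Measurable.of_discrete (f := g)).comp
      (π.measurable.subtype_mk)).aestronglyMeasurable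
  · exact Finset.single_le_sum (f := fun c => |g c|) (fun _ _ => abs_nonneg _)
      (Finset.mem_univ _)

/-- The linear map sending a function on the range of a simple function to its pullback. -/
noncomputable def simplePullback (hb : Bornology.IsBounded Ω)
    (π : SimpleFunc (EuclideanSpace ℝ (Fin N)) (EuclideanSpace ℝ (Fin N))) :
    (π.range → ℝ) →ₗ[ℝ] L2 Ω where
  toFun g := (memLp_comp_simpleFunc hb π g).toLp
  map_add' g g' := (memLp_comp_simpleFunc hb π g).toLp_add (memLp_comp_simpleFunc hb π g')
  map_smul' c g := (memLp_comp_simpleFunc hb π g).toLp_const_smul c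

theorem coeFn_simplePullback (hb : Bornology.IsBounded Ω)
    (π : SimpleFunc (EuclideanSpace ℝ (Fin N)) (EuclideanSpace ℝ (Fin N))) (g : π.range → ℝ) :
    simplePullback hb π g =ᵐ[volume.restrict Ω] fun x => g ⟨π x, π.mem_range_self x⟩ :=
  (memLp_comp_simpleFunc hb π g).coeFn_toLp

theorem ofReal_norm_sq_eq_lintegral (u : L2 Ω) :
    ENNReal.ofReal (‖u‖ ^ 2) = ∫⁻ x in Ω, ENNReal.ofReal (u x ^ 2) := by
  rw [← real_inner_self_eq_norm_sq, L2.inner_def,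
    ofReal_integral_eq_lintegral_ofReal (L2.integrable_inner u u)
      (Eventually.of_forall fun x => real_inner_self_nonneg)]
  refine lintegral_congr fun x => ?_
  simp [sq]

/-- The approximation at x is the average of u with weight a cut-off kernel evaluated at π x and π
y. It depends on x only through the finitely many values of π. The kernel has mass at least M and is
at most |x-y|^(-N), so the variance inequality bounds M (u(x) - f(x))² by the inner energy integral
at x. -/
theorem IsBoundedLipschitzSet.exists_finiteDimensional_approx (hN : 1 ≤ N)
    (hΩ : IsBoundedLipschitzSet Ω) {M : ℝ} (hM : 0 < M) :
    ∃ F : Submodule ℝ (L2 Ω), FiniteDimensional ℝ F ∧ ∀ u ∈ energySpace Ω 0,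
      ∃ f ∈ F, M * ‖u - f‖ ^ 2 ≤ 2 * energyForm Ω 0 u u := by
  have hfin : IsFiniteMeasure (volume.restrict Ω) := ⟨by simpa using hΩ.isBounded.measure_lt_top⟩
  have hΩm := hΩ.isOpen.measurableSet
  obtain ⟨h', hh', hmass⟩ := hΩ.exists_kernel_mass_ge hN M
  -- Replacing x, y by π x, π y changes the distance by at most 2h. The shift 2h in k keeps it below
  -- |x-y|^(-N), and a second 2h compares it from below with the kernel cut off at 4h = h'.
  set h := h' / 4 with hh
  have hpos : 0 < h := by positivity
  obtain ⟨π, hπ⟩ := exists_simpleFunc_near hΩ.isBounded hpos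
  refine ⟨LinearMap.range (simplePullback hΩ.isBounded π), inferInstance, fun u hu => ?_⟩
  set k : EuclideanSpace ℝ (Fin N) → EuclideanSpace ℝ (Fin N) → ℝ :=
    fun a y => ((‖a - π y‖ + 2 * h) ^ N)⁻¹ with hk
  have hk0 : ∀ a y, 0 ≤ k a y := fun a y => by positivity
  have hkle : ∀ a y, ‖k a y‖ ≤ ((2 * h) ^ N)⁻¹ := fun a y => by
    rw [Real.norm_of_nonneg (hk0 a y)]
    simp only [hk]
    gcongr
    linarith [norm_nonneg (a - π y)]
  have hkm : ∀ a, Measurable (k a) := fun a => by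
    have := π.measurable
    simp only [hk]
    fun_prop
  have hk1 : ∀ a, Integrable (k a) (volume.restrict Ω) := fun a =>
    Integrable.of_bound (hkm a).aestronglyMeasurable _ (Eventually.of_forall (hkle a))
  have hu2 := (Lp.memLp u).integrable_sq
  have hu1 : Integrable (u : EuclideanSpace ℝ (Fin N) → ℝ) (volume.restrict Ω) :=
    (Lp.memLp u).integrable (by norm_num)
  have hku : ∀ a, Integrable (fun y => k a y * u y) (volume.restrict Ω) := fun a =>
    hu1.bdd_mul (hkm a).aestronglyMeasurable (Eventually.of_forall (hkle a))
  have hku2 : ∀ a, Integrable (fun y => k a y * u y ^ 2) (volume.restrict Ω) := fun a =>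
    hu2.bdd_mul (hkm a).aestronglyMeasurable (Eventually.of_forall (hkle a))
  have hκ : ∀ x ∈ Ω, M ≤ ∫ y in Ω, k (π x) y := fun x hx => by
    have h1 : ENNReal.ofReal M ≤ ENNReal.ofReal (∫ y in Ω, k (π x) y) := by
      rw [ofReal_integral_eq_lintegral_ofReal (hk1 _) (Eventually.of_forall (hk0 _))]
      refine (hmass x hx).trans (setLIntegral_mono' hΩm fun y hy => ENNReal.ofReal_le_ofReal ?_)
      have h2 : ‖π x - π y‖ ≤ ‖x - y‖ + 2 * h := by
        calc ‖π x - π y‖ = ‖(π x - x) + (x - y) - (π y - y)‖ := by congr 1; abel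
          _ ≤ ‖π x - x‖ + ‖x - y‖ + ‖π y - y‖ :=
            (norm_sub_le _ _).trans (add_le_add_left (norm_add_le _ _) _)
          _ ≤ _ := by linarith [hπ x hx, hπ y hy]
      exact inv_anti₀ (by positivity)
        (pow_le_pow_left₀ (by positivity) (by linarith) N)
    exact (ENNReal.ofReal_le_ofReal_iff (integral_nonneg (hk0 _))).1 h1
  set g : π.range → ℝ := fun c => (∫ y in Ω, k c y * u y) / ∫ y in Ω, k c y with hg
  refine ⟨simplePullback hΩ.isBounded π g, ⟨g, rfl⟩, ?_⟩
  have hpt : ∀ x ∈ Ω, ENNReal.ofReal (M * (u x - g ⟨π x, π.mem_range_self x⟩) ^ 2)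
      ≤ ∫⁻ y in Ω, ENNReal.ofReal (formIntegrand 0 u u (x, y)) := fun x hx => by
    have h1 := weighted_sq_sub_average_le (hk0 (π x)) (hk1 (π x)) (hku _) (hku2 _)
      (hM.trans_le (hκ x hx)) (u x)
    have h2 : Integrable (fun y => k (π x) y * (u x - u y) ^ 2) (volume.restrict Ω) := by
      refine Integrable.bdd_mul ?_ (hkm _).aestronglyMeasurable (Eventually.of_forall (hkle _))
      exact ((memLp_const (u x)).sub (Lp.memLp u)).integrable_sq
    calc _ ≤ ENNReal.ofReal (∫ y in Ω, k (π x) y * (u x - u y) ^ 2) :=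
          ENNReal.ofReal_le_ofReal
            ((mul_le_mul_of_nonneg_right (hκ x hx) (sq_nonneg _)).trans h1)
      _ = ∫⁻ y in Ω, ENNReal.ofReal (k (π x) y * (u x - u y) ^ 2) :=
          ofReal_integral_eq_lintegral_ofReal h2
            (Eventually.of_forall fun y => mul_nonneg (hk0 _ _) (sq_nonneg _))
      _ ≤ _ := by
          refine setLIntegral_mono' hΩm fun y hy => ENNReal.ofReal_le_ofReal ?_
          rcases eq_or_ne x y with rfl | hxy
          · simp [formIntegrand]
          · have hr : 0 < ‖x - y‖ := norm_pos_iff.2 (sub_ne_zero.2 hxy)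
            have h3 : ‖x - y‖ ≤ ‖π x - π y‖ + 2 * h := by
              calc ‖x - y‖ = ‖(π x - π y) - (π x - x) + (π y - y)‖ := by congr 1; abel
                _ ≤ ‖π x - π y‖ + ‖π x - x‖ + ‖π y - y‖ :=
                  (norm_add_le _ _).trans (add_le_add_left (norm_sub_le _ _) _)
                _ ≤ _ := by linarith [hπ x hx, hπ y hy]
            simp only [formIntegrand, mul_zero, add_zero, Real.rpow_natCast]
            rw [mul_comm, ← sq, div_eq_mul_inv]
            refine mul_le_mul_of_nonneg_left ?_ (sq_nonneg _)
            simp only [hk]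
            gcongr
  have hfinal : ENNReal.ofReal (M * ‖u - simplePullback hΩ.isBounded π g‖ ^ 2)
      ≤ ENNReal.ofReal (2 * energyForm Ω 0 u u) := by
    rw [ENNReal.ofReal_mul hM.le, ofReal_norm_sq_eq_lintegral,
      ← lintegral_const_mul' _ _ ENNReal.ofReal_ne_top, ← lintegral_formIntegrand_self hu,
      sqMeasure, lintegral_prod _
        (aestronglyMeasurable_formIntegrand 0 u u).aemeasurable.ennreal_ofReal]
    refine lintegral_mono_ae ?_
    filter_upwards [Lp.coeFn_sub u (simplePullback hΩ.isBounded π g),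
      coeFn_simplePullback hΩ.isBounded π g, ae_restrict_mem hΩm] with x h1 h2 hx
    rw [h1, Pi.sub_apply, h2, ← ENNReal.ofReal_mul hM.le]
    exact hpt x hx
  exact (ENNReal.ofReal_le_ofReal_iff
    (mul_nonneg zero_le_two (energyForm_self_nonneg 0 _))).1 hfinal

/-- Bounded sequences in `ℍ⁰(Ω)` are precompact in `L²(Ω)`. -/
theorem IsBoundedLipschitzSet.exists_tendsto_subseq_energySpace_zero (hN : 1 ≤ N)
    (hΩ : IsBoundedLipschitzSet Ω) {u : ℕ → L2 Ω} (hu : ∀ k, u k ∈ energySpace Ω 0) {C : ℝ}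
    (hn : ∀ k, ‖u k‖ ≤ C) (hE : ∀ k, energyForm Ω 0 (u k) (u k) ≤ C) :
    ∃ (φ : ℕ → ℕ) (x : L2 Ω), StrictMono φ ∧ Tendsto (fun k => u (φ k)) atTop (𝓝 x) := by
  set S : Set (L2 Ω) := {w | w ∈ energySpace Ω 0 ∧ ‖w‖ ≤ C ∧ energyForm Ω 0 w w ≤ C}
  have hC0 : 0 ≤ C := (norm_nonneg _).trans (hn 0)
  have hS : TotallyBounded S := by
    refine totallyBounded_of_finiteDimensional_approx (C := C) (fun w hw => hw.2.1) fun ε hε => ?_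
    obtain ⟨F, hF, hFa⟩ := hΩ.exists_finiteDimensional_approx hN
      -- The added 1 keeps M positive when C = 0.
      (M := (2 * C + 1) / ε ^ 2) (by positivity)
    refine ⟨F, hF, fun w hw => ?_⟩
    obtain ⟨f, hf, hwf⟩ := hFa w hw.1
    refine ⟨f, hf, ?_⟩
    have h1 : (2 * C + 1) / ε ^ 2 * ‖w - f‖ ^ 2 ≤ 2 * C + 1 := by linarith [hw.2.2]
    rw [div_mul_eq_mul_div, div_le_iff₀ (by positivity)] at h1
    have h2 := le_of_mul_le_mul_left h1 (by positivity)
    exact (sq_le_sq₀ (norm_nonneg _) hε.le).1 h2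
  obtain ⟨x, -, φ, hφ, hx⟩ := (hS.closure.isCompact_of_isClosed
    isClosed_closure).tendsto_subseq (x := u)
    fun k => subset_closure ⟨hu k, hn k, hE k⟩
  exact ⟨φ, x, hφ, hx⟩

/-- 𝓔_s controls 𝓔_0 on a bounded set, so compactness for every s ≥ 0 is inherited from s = 0. -/
theorem IsBoundedLipschitzSet.isCompactForm (hN : 1 ≤ N) (hΩ : IsBoundedLipschitzSet Ω) {s : ℝ}
    (hs : 0 ≤ s) : IsCompactForm (energyBilin Ω s) := by
  obtain ⟨R, hR, hd⟩ := exists_diam_bound hΩ.isBounded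
  have hR0 : 0 ≤ R := zero_le_one.trans hR
  refine isCompactForm_energyBilin fun u C hn hE => ?_
  have hp : 0 ≤ R ^ (2 * (s - 0)) := by positivity
  refine hΩ.exists_tendsto_subseq_energySpace_zero hN (u := fun k => (u k).1)
    (C := max C (R ^ (2 * (s - 0)) * C))
    (fun k => energySpace_anti hΩ.isOpen.measurableSet hΩ.isBounded hs (u k).2)
    (fun k => (hn k).trans (le_max_left _ _)) fun k => ?_
  refine (energyForm_le_of_le hΩ.isOpen.measurableSet hs hR0 hd (u k).2).trans
    ((mul_le_mul_of_nonneg_left (hE k) hp).trans (le_max_right _ _))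

end Compactness

/-! ### Lipschitz functions, interaction with the exterior, truncation -/

section Density

variable {N : ℕ} {Ω : Set (EuclideanSpace ℝ (Fin N))}

theorem lintegral_norm_sub_rpow_neg_le {R : ℝ} (hΩ : MeasurableSet Ω)
    {x : EuclideanSpace ℝ (Fin N)} (hR : ∀ y ∈ Ω, ‖x - y‖ < R) (q : ℝ) :
    ∫⁻ y in Ω, ENNReal.ofReal (‖x - y‖ ^ (-q))
      ≤ ∫⁻ z in Metric.ball (0 : EuclideanSpace ℝ (Fin N)) R, ENNReal.ofReal (‖z‖ ^ (-q)) := by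
  rw [← lintegral_indicator hΩ, ← lintegral_indicator Metric.isOpen_ball.measurableSet,
    ← lintegral_sub_left_eq_self _ x]
  refine lintegral_mono fun y => ?_
  by_cases hy : x - y ∈ Ω
  · have h1 : y ∈ Metric.ball (0 : EuclideanSpace ℝ (Fin N)) R := by simpa using hR _ hy
    rw [indicator_of_mem hy, indicator_of_mem h1, sub_sub_cancel]
  · rw [indicator_of_notMem hy]
    exact zero_le

theorem mem_energySpace_of_lipschitz (hN : 1 ≤ N) (hΩ : MeasurableSet Ω)
    (hb : Bornology.IsBounded Ω) {s : ℝ} (hs : s < 1) {f : EuclideanSpace ℝ (Fin N) → ℝ} {L : ℝ}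
    (hf : ∀ x ∈ Ω, ∀ y ∈ Ω, |f x - f y| ≤ L * ‖x - y‖) {u : L2 Ω}
    (hu : u =ᵐ[volume.restrict Ω] f) : u ∈ energySpace Ω s := by
  obtain ⟨R, -, hR⟩ := exists_diam_bound hb
  -- The Lipschitz bound contributes |x-y|², lowering the order of the singularity to q, which is
  -- below N exactly when s < 1.
  set q : ℝ := N + 2 * s - 2 with hq
  have hI := lintegral_norm_rpow_neg_ball_lt_top hN (q := q) (by linarith) (R + 1)
  have hdom : ∀ᵐ p ∂(sqMeasure Ω), ENNReal.ofReal (formIntegrand s u u p)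
      ≤ ENNReal.ofReal (L ^ 2) * ENNReal.ofReal (‖p.1 - p.2‖ ^ (-q)) := by
    filter_upwards [ae_mem_sqMeasure hΩ, ae_sqMeasure_of_ae hu] with p hp hpu
    rw [← ENNReal.ofReal_mul (sq_nonneg L)]
    refine ENNReal.ofReal_le_ofReal ?_
    rw [formIntegrand, hpu.1, hpu.2]
    rcases eq_or_ne p.1 p.2 with h | h
    · rw [h, sub_self, zero_mul, zero_div]
      positivity
    · have hr : 0 < ‖p.1 - p.2‖ := norm_pos_iff.2 (sub_ne_zero.2 h)
      rw [div_le_iff₀ (Real.rpow_pos_of_pos hr _), mul_assoc, ← Real.rpow_add hr]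
      have h1 : -q + (N + 2 * s) = (2 : ℕ) := by rw [hq]; push_cast; ring
      rw [h1, Real.rpow_natCast, ← mul_pow, ← sq]
      exact sq_le_sq.2 ((hf _ hp.1 _ hp.2).trans (le_abs_self _))
  refine ⟨aestronglyMeasurable_formIntegrand s u u, ?_⟩
  rw [hasFiniteIntegral_iff_ofReal
    (Eventually.of_forall fun p => formIntegrand_self_nonneg s u p)]
  refine (lintegral_mono_ae hdom).trans_lt ?_
  rw [lintegral_const_mul' _ _ ENNReal.ofReal_ne_top]
  refine ENNReal.mul_lt_top ENNReal.ofReal_lt_top ?_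
  rw [sqMeasure, lintegral_prod _ (by fun_prop)]
  calc ∫⁻ x in Ω, ∫⁻ y in Ω, ENNReal.ofReal (‖x - y‖ ^ (-q))
      ≤ ∫⁻ x in Ω, ∫⁻ z in Metric.ball (0 : EuclideanSpace ℝ (Fin N)) (R + 1),
          ENNReal.ofReal (‖z‖ ^ (-q)) :=
        setLIntegral_mono' hΩ fun x hx => lintegral_norm_sub_rpow_neg_le hΩ
          (fun y hy => (hR x hx y hy).trans_lt (lt_add_one R)) q
    _ < ⊤ := by
        rw [setLIntegral_const]
        exact ENNReal.mul_lt_top hI hb.measure_lt_top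

/-- The logarithmic interaction between a Lipschitz set and its bounded surroundings is finite. -/
theorem IsBoundedLipschitzSet.lintegral_interaction_lt_top (hN : 1 ≤ N)
    (hΩ : IsBoundedLipschitzSet Ω) {B : Set (EuclideanSpace ℝ (Fin N))} {R : ℝ}
    (hR : ∀ x ∈ Ω, ∀ y ∈ B, ‖y - x‖ < R) (hB : MeasurableSet B) :
    ∫⁻ x in Ω, ∫⁻ y in B \ Ω, ENNReal.ofReal (‖x - y‖ ^ (-(N : ℝ))) < ⊤ := by
  have hΩm := hΩ.isOpen.measurableSet
  obtain ⟨C, hC, hesc⟩ := hΩ.exists_volume_escape_le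
  have hI := lintegral_norm_rpow_neg_ball_lt_top hN (q := N - 1) (by linarith) R
  set S : Set (EuclideanSpace ℝ (Fin N) × EuclideanSpace ℝ (Fin N)) :=
    {p | p.1 + p.2 ∉ Ω} with hS
  have hSm : MeasurableSet S := (measurableSet_preimage (by fun_prop) hΩm).compl
  have hmeas : Measurable fun p : EuclideanSpace ℝ (Fin N) × EuclideanSpace ℝ (Fin N) =>
      S.indicator (fun p => ENNReal.ofReal (‖p.2‖ ^ (-(N : ℝ)))) p :=
    Measurable.indicator (by fun_prop) hSm
  -- Substitute y = x + z and exchange the integrals. The inner measure |{x ∈ Ω : x + z ∉ Ω}| ≤ C|z|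
  -- leaves |z|^(-(N-1)), which is integrable near 0.
  calc _ ≤ ∫⁻ x in Ω, ∫⁻ z in Metric.ball (0 : EuclideanSpace ℝ (Fin N)) R,
        S.indicator (fun p => ENNReal.ofReal (‖p.2‖ ^ (-(N : ℝ)))) (x, z) := by
        refine setLIntegral_mono' hΩm fun x hx => ?_
        rw [← lintegral_indicator (hB.diff hΩm),
          ← lintegral_indicator Metric.isOpen_ball.measurableSet,
          ← lintegral_add_left_eq_self _ x]
        refine lintegral_mono fun z => ?_
        by_cases hz : x + z ∈ B \ Ω
        · have h1 : z ∈ Metric.ball (0 : EuclideanSpace ℝ (Fin N)) R := by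
            simpa using hR x hx _ hz.1
          have h2 : (x, z) ∈ S := hz.2
          rw [indicator_of_mem hz, indicator_of_mem h1, indicator_of_mem h2]
          simp
        · rw [indicator_of_notMem hz]
          exact zero_le
    _ = ∫⁻ z in Metric.ball (0 : EuclideanSpace ℝ (Fin N)) R, ∫⁻ x in Ω,
        S.indicator (fun p => ENNReal.ofReal (‖p.2‖ ^ (-(N : ℝ)))) (x, z) :=
        lintegral_lintegral_swap hmeas.aemeasurable
    _ ≤ ∫⁻ z in Metric.ball (0 : EuclideanSpace ℝ (Fin N)) R,
        ENNReal.ofReal C * ENNReal.ofReal (‖z‖ ^ (-((N : ℝ) - 1))) := by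
        refine lintegral_mono fun z => ?_
        have hTm : MeasurableSet {x | x + z ∉ Ω} :=
          (measurableSet_preimage (by fun_prop : Measurable fun x => x + z) hΩm).compl
        calc ∫⁻ x in Ω, S.indicator (fun p => ENNReal.ofReal (‖p.2‖ ^ (-(N : ℝ)))) (x, z)
            = ∫⁻ x in Ω, {x | x + z ∉ Ω}.indicator
                (fun _ => ENNReal.ofReal (‖z‖ ^ (-(N : ℝ)))) x := rfl
          _ = ENNReal.ofReal (‖z‖ ^ (-(N : ℝ))) * volume {x ∈ Ω | x + z ∉ Ω} := by
              rw [lintegral_indicator_const hTm, Measure.restrict_apply hTm, inter_comm]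
              rfl
          _ ≤ ENNReal.ofReal (‖z‖ ^ (-(N : ℝ))) * ENNReal.ofReal (C * ‖z‖) := by
              gcongr
              exact hesc z
          _ ≤ _ := by
              rw [← ENNReal.ofReal_mul (by positivity), ← ENNReal.ofReal_mul hC]
              refine ENNReal.ofReal_le_ofReal ?_
              rcases eq_or_ne z 0 with rfl | hz
              · rw [norm_zero, mul_zero, mul_zero]
                exact mul_nonneg hC (Real.rpow_nonneg le_rfl _)
              · have hr : 0 < ‖z‖ := norm_pos_iff.2 hz
                rw [show -((N : ℝ) - 1) = -(N : ℝ) + 1 by ring, Real.rpow_add hr, Real.rpow_one]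
                linarith
    _ < ⊤ := by
        rw [lintegral_const_mul' _ _ ENNReal.ofReal_ne_top]
        exact ENNReal.mul_lt_top ENNReal.ofReal_lt_top hI

theorem tendsto_L2_of_dominated {α : Type*} [MeasurableSpace α] {μ : Measure α}
    {f : ℕ → Lp ℝ 2 μ} {g : Lp ℝ 2 μ} {b : α → ℝ} (hb : MemLp b 2 μ)
    (hf : ∀ i, ∀ᵐ x ∂μ, |f i x| ≤ b x)
    (hlim : ∀ᵐ x ∂μ, Tendsto (fun i => f i x) atTop (𝓝 (g x))) :
    Tendsto f atTop (𝓝 g) := by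
  rw [tendsto_iff_norm_sub_tendsto_zero]
  have hsq : ∀ i, ‖f i - g‖ ^ 2 = ∫ x, (f i x - g x) ^ 2 ∂μ := fun i => by
    rw [← real_inner_self_eq_norm_sq, L2.inner_def]
    refine integral_congr_ae ?_
    filter_upwards [Lp.coeFn_sub (f i) g] with x hx
    rw [hx]
    simp [sq]
  have h0 : Tendsto (fun i => ‖f i - g‖ ^ 2) atTop (𝓝 0) := by
    simp only [hsq]
    rw [← integral_zero α ℝ (μ := μ)]
    refine tendsto_integral_of_dominated_convergence (fun x => (b x + |g x|) ^ 2)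
      (fun i => (((Lp.memLp (f i)).sub (Lp.memLp g)).integrable_sq).aestronglyMeasurable)
      (hb.add (Lp.memLp g).abs).integrable_sq (fun i => ?_) ?_
    · filter_upwards [hf i] with x hx
      rw [Real.norm_of_nonneg (sq_nonneg _)]
      refine sq_le_sq.2 (((abs_sub _ _).trans ?_).trans (le_abs_self _))
      linarith
    · filter_upwards [hlim] with x hx
      simpa using (hx.sub_const (g x)).pow 2
  have := h0.sqrt
  simpa using this

/-- Truncation of `u` at height `M`, extended by zero outside `Ω`. -/
noncomputable def truncation {N : ℕ} (Ω : Set (EuclideanSpace ℝ (Fin N))) (M : ℝ)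
    (u : EuclideanSpace ℝ (Fin N) → ℝ) : EuclideanSpace ℝ (Fin N) → ℝ :=
  Ω.indicator fun x => max (-M) (min (u x) M)

section truncation

variable {M : ℝ} {u : EuclideanSpace ℝ (Fin N) → ℝ}

theorem abs_truncation_le (hM : 0 ≤ M) (x : EuclideanSpace ℝ (Fin N)) :
    |truncation Ω M u x| ≤ M := by
  rw [truncation]
  by_cases hx : x ∈ Ω
  · rw [indicator_of_mem hx, abs_le]
    exact ⟨le_max_left _ _, max_le (by linarith) (min_le_right _ _)⟩
  · rw [indicator_of_notMem hx, abs_zero]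
    exact hM

theorem abs_truncation_le_abs (hM : 0 ≤ M) (x : EuclideanSpace ℝ (Fin N)) :
    |truncation Ω M u x| ≤ |u x| := by
  rw [truncation]
  by_cases hx : x ∈ Ω
  · rw [indicator_of_mem hx, abs_le]
    have h1 := neg_abs_le (u x)
    have h2 := le_abs_self (u x)
    have h3 := abs_nonneg (u x)
    exact ⟨le_max_of_le_right (le_min h1 (by linarith)),
      max_le (by linarith) ((min_le_left _ _).trans h2)⟩
  · rw [indicator_of_notMem hx, abs_zero]
    exact abs_nonneg _

theorem abs_truncation_sub_le {x y : EuclideanSpace ℝ (Fin N)} (hx : x ∈ Ω) (hy : y ∈ Ω) :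
    |truncation Ω M u x - truncation Ω M u y| ≤ |u x - u y| := by
  rw [truncation, indicator_of_mem hx, indicator_of_mem hy]
  refine (abs_max_sub_max_le_max _ _ _ _).trans ?_
  rw [sub_self, abs_zero]
  refine max_le (abs_nonneg _) ((abs_min_sub_min_le_max _ _ _ _).trans ?_)
  rw [sub_self, abs_zero]
  exact max_le le_rfl (abs_nonneg _)

theorem truncation_eq_self {x : EuclideanSpace ℝ (Fin N)} (hx : x ∈ Ω) (h : |u x| ≤ M) :
    truncation Ω M u x = u x := by
  rw [abs_le] at h
  rw [truncation, indicator_of_mem hx, min_eq_left h.2, max_eq_right h.1]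

theorem measurable_truncation (hΩ : MeasurableSet Ω) (hu : Measurable u) :
    Measurable (truncation Ω M u) :=
  (measurable_const.max (hu.min measurable_const)).indicator hΩ

end truncation

theorem memLp_truncation (hΩ : MeasurableSet Ω) {M : ℝ} (hM : 0 ≤ M) (u : L2 Ω) :
    MemLp (truncation Ω M u) 2 (volume.restrict Ω) :=
  (Lp.memLp u).mono
    (measurable_truncation hΩ (Lp.stronglyMeasurable u).measurable).aestronglyMeasurable
    (Eventually.of_forall fun x => abs_truncation_le_abs hM x)

theorem tendsto_truncation (hΩ : MeasurableSet Ω) (u : L2 Ω) :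
    Tendsto (fun i : ℕ => (memLp_truncation hΩ (Nat.cast_nonneg i) u).toLp) atTop (𝓝 u) := by
  refine tendsto_L2_of_dominated (Lp.memLp u).abs (fun i => ?_) ?_
  · filter_upwards [(memLp_truncation hΩ (Nat.cast_nonneg i) u).coeFn_toLp] with x hx
    rw [hx]
    exact abs_truncation_le_abs (Nat.cast_nonneg i) x
  · have := ae_all_iff.2 fun i : ℕ => (memLp_truncation hΩ (Nat.cast_nonneg i) u).coeFn_toLp
    filter_upwards [this, ae_restrict_mem hΩ] with x hx hxΩ
    obtain ⟨m, hm⟩ := exists_nat_ge |u x|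
    refine tendsto_const_nhds.congr' ?_
    filter_upwards [eventually_ge_atTop m] with i hi
    rw [hx, truncation_eq_self hxΩ (hm.trans (Nat.cast_le.2 hi))]

/-- Truncation is a contraction of the values, so it decreases every difference inside Ω. -/
theorem truncation_energy_le (hΩ : MeasurableSet Ω) {M : ℝ} (hM : 0 ≤ M) {s : ℝ} {u : L2 Ω}
    (hu : u ∈ energySpace Ω s) :
    (memLp_truncation hΩ hM u).toLp ∈ energySpace Ω s ∧
      energyForm Ω s (memLp_truncation hΩ hM u).toLp (memLp_truncation hΩ hM u).toLp
        ≤ energyForm Ω s u u := by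
  have key : ∫⁻ p, ENNReal.ofReal (formIntegrand s (memLp_truncation hΩ hM u).toLp
      (memLp_truncation hΩ hM u).toLp p) ∂(sqMeasure Ω)
      ≤ ENNReal.ofReal (2 * energyForm Ω s u u) := by
    rw [← lintegral_formIntegrand_self hu]
    refine lintegral_mono_ae ?_
    filter_upwards [ae_mem_sqMeasure hΩ,
      ae_sqMeasure_of_ae (memLp_truncation hΩ hM u).coeFn_toLp] with p hp hpu
    refine ENNReal.ofReal_le_ofReal ?_
    rw [formIntegrand, formIntegrand, hpu.1, hpu.2]
    refine div_le_div_of_nonneg_right ?_ (by positivity)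
    rw [← sq, ← sq]
    exact sq_le_sq.2 (abs_truncation_sub_le hp.1 hp.2)
  exact ⟨mem_energySpace_of_lintegral_le _ key,
    energyForm_le_of_lintegral_le (energyForm_self_nonneg s _) key⟩

end Density

/-! ### Density of ℍ^{1/2}(Ω) in ℍ⁰(Ω) -/

section Mollification

variable {N : ℕ} {Ω : Set (EuclideanSpace ℝ (Fin N))}

/-- The mollification of `w` by a normalized bump function. -/
noncomputable def mollify {N : ℕ} (φ : ContDiffBump (0 : EuclideanSpace ℝ (Fin N)))
    (w : EuclideanSpace ℝ (Fin N) → ℝ) (x : EuclideanSpace ℝ (Fin N)) : ℝ :=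
  ∫ t, φ.normed volume t * w (x - t)

theorem mollify_eq_convolution (φ : ContDiffBump (0 : EuclideanSpace ℝ (Fin N)))
    (w : EuclideanSpace ℝ (Fin N) → ℝ) :
    mollify φ w = MeasureTheory.convolution (φ.normed volume) w (ContinuousLinearMap.lsmul ℝ ℝ)
      volume := rfl

section

variable {φ : ContDiffBump (0 : EuclideanSpace ℝ (Fin N))} {w : EuclideanSpace ℝ (Fin N) → ℝ}
  {M : ℝ}

theorem integrable_normed_mul (hw : Measurable w) (hM : ∀ x, |w x| ≤ M)
    (x : EuclideanSpace ℝ (Fin N)) :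
    Integrable (fun t => φ.normed volume t * w (x - t)) :=
  φ.integrable_normed.mul_bdd (hw.comp (by fun_prop)).aestronglyMeasurable
    (Eventually.of_forall fun t => hM (x - t))

theorem abs_mollify_le (hM : ∀ x, |w x| ≤ M)
    (x : EuclideanSpace ℝ (Fin N)) : |mollify φ w x| ≤ M := by
  have h1 : ‖∫ t, φ.normed volume t * w (x - t)‖ ≤ ∫ t, φ.normed volume t * M := by
    refine norm_integral_le_of_norm_le (φ.integrable_normed.mul_const M)
      (Eventually.of_forall fun t => ?_)
    rw [norm_mul, Real.norm_of_nonneg (φ.nonneg_normed t)]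
    exact mul_le_mul_of_nonneg_left (hM _) (φ.nonneg_normed t)
  rwa [integral_mul_const, φ.integral_normed, one_mul] at h1

theorem ofReal_sq_mollify_sub_le (hw : Measurable w) (hM : ∀ x, |w x| ≤ M)
    (x y : EuclideanSpace ℝ (Fin N)) :
    ENNReal.ofReal ((mollify φ w x - mollify φ w y) ^ 2)
      ≤ ∫⁻ t, ENNReal.ofReal (φ.normed volume t) *
          ENNReal.ofReal ((w (x - t) - w (y - t)) ^ 2) := by
  set d : EuclideanSpace ℝ (Fin N) → ℝ := fun t => w (x - t) - w (y - t) with hd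
  have hdm : Measurable d := by fun_prop
  have hdM : ∀ t, |d t| ≤ M + M := fun t =>
    (abs_sub _ _).trans (add_le_add (hM _) (hM _))
  have hkd : Integrable fun t => φ.normed volume t * d t :=
    φ.integrable_normed.mul_bdd hdm.aestronglyMeasurable (Eventually.of_forall hdM)
  have hkd2 : Integrable fun t => φ.normed volume t * d t ^ 2 := by
    refine φ.integrable_normed.mul_bdd (c := (M + M) ^ 2) (hdm.pow_const 2).aestronglyMeasurable
      (Eventually.of_forall fun t => ?_)
    rw [Real.norm_of_nonneg (sq_nonneg _)]
    exact sq_le_sq.2 ((hdM t).trans (le_abs_self _))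
  have h1 : mollify φ w x - mollify φ w y = ∫ t, φ.normed volume t * d t := by
    rw [mollify, mollify,
      ← integral_sub (integrable_normed_mul hw hM x) (integrable_normed_mul hw hM y)]
    exact integral_congr_ae (Eventually.of_forall fun t => (mul_sub _ _ _).symm)
  have h2 := weighted_sq_sub_average_le (fun t => φ.nonneg_normed t) φ.integrable_normed hkd hkd2
    (by rw [φ.integral_normed]; exact one_pos) 0
  simp only [φ.integral_normed, zero_sub, div_one, one_mul, neg_sq] at h2
  calc _ ≤ ENNReal.ofReal (∫ t, φ.normed volume t * d t ^ 2) := by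
        rw [h1]; exact ENNReal.ofReal_le_ofReal h2
    _ = ∫⁻ t, ENNReal.ofReal (φ.normed volume t * d t ^ 2) :=
        ofReal_integral_eq_lintegral_ofReal hkd2
          (Eventually.of_forall fun t => mul_nonneg (φ.nonneg_normed t) (sq_nonneg _))
    _ = _ := lintegral_congr fun t => ENNReal.ofReal_mul (φ.nonneg_normed t)

theorem exists_lipschitzWith_mollify (hw : LocallyIntegrable w volume)
    (hc : HasCompactSupport w) : ∃ C, LipschitzWith C (mollify φ w) := by
  rw [mollify_eq_convolution]
  exact ContDiff.lipschitzWith_of_hasCompactSupport (𝕂 := ℝ) (n := 1)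
    (φ.hasCompactSupport_normed.convolution _ hc)
    (φ.hasCompactSupport_normed.contDiff_convolution_left _ φ.contDiff_normed hw) one_ne_zero

/-- Mollification at scale at most `1` does not increase the energy beyond the energy on a
neighbourhood of size `1`. -/
theorem lintegral_formIntegrand_mollify_le {B : Set (EuclideanSpace ℝ (Fin N))} (hΩ : MeasurableSet Ω)
    (hB : MeasurableSet B) (hΩB : ∀ x ∈ Ω, ∀ t, ‖t‖ < 1 → x - t ∈ B) (hφ : φ.rOut ≤ 1)
    (hw : Measurable w) (hM : ∀ x, |w x| ≤ M) (s : ℝ) :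
    ∫⁻ p, ENNReal.ofReal (formIntegrand s (mollify φ w) (mollify φ w) p) ∂(sqMeasure Ω)
      ≤ ∫⁻ p, ENNReal.ofReal (formIntegrand s w w p) ∂(sqMeasure B) := by
  set F : EuclideanSpace ℝ (Fin N) × EuclideanSpace ℝ (Fin N) → ENNReal :=
    fun p => ENNReal.ofReal (formIntegrand s w w p) with hF
  have hFm : Measurable F := by
    simp only [hF, formIntegrand]
    fun_prop
  have hkm : Measurable fun t => ENNReal.ofReal (φ.normed volume t) :=
    φ.continuous_normed.measurable.ennreal_ofReal
  -- Jensen's inequality, together with the invariance of |x-y| under translating both variables by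
  -- t: the energy density of the mollification is at most an average of translated energy
  -- densities.
  have hpt : ∀ p : EuclideanSpace ℝ (Fin N) × EuclideanSpace ℝ (Fin N),
      ENNReal.ofReal (formIntegrand s (mollify φ w) (mollify φ w) p)
        ≤ ∫⁻ t, ENNReal.ofReal (φ.normed volume t) * F (p - (t, t)) := fun p => by
    set c : ℝ := (‖p.1 - p.2‖ ^ ((N : ℝ) + 2 * s))⁻¹ with hc
    have hc0 : 0 ≤ c := by positivity
    have h1 := ofReal_sq_mollify_sub_le (φ := φ) hw hM p.1 p.2
    calc _ = ENNReal.ofReal c * ENNReal.ofReal ((mollify φ w p.1 - mollify φ w p.2) ^ 2) := by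
          rw [← ENNReal.ofReal_mul hc0, formIntegrand, div_eq_mul_inv, sq, mul_comm]
      _ ≤ ENNReal.ofReal c * ∫⁻ t, ENNReal.ofReal (φ.normed volume t) *
          ENNReal.ofReal ((w (p.1 - t) - w (p.2 - t)) ^ 2) := by gcongr
      _ = _ := by
          rw [← lintegral_const_mul' _ _ ENNReal.ofReal_ne_top]
          refine lintegral_congr fun t => ?_
          rw [mul_left_comm, ← ENNReal.ofReal_mul hc0]
          simp only [hF, formIntegrand, Prod.fst_sub, Prod.snd_sub, sub_sub_sub_cancel_right]
          rw [div_eq_mul_inv, ← sq, mul_comm c]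
  calc _ ≤ ∫⁻ p, (∫⁻ t, ENNReal.ofReal (φ.normed volume t) * F (p - (t, t))) ∂(sqMeasure Ω) :=
        lintegral_mono hpt
    _ = ∫⁻ t, ∫⁻ p, ENNReal.ofReal (φ.normed volume t) * F (p - (t, t)) ∂(sqMeasure Ω) := by
        have : SFinite (sqMeasure Ω) := by unfold sqMeasure; infer_instance
        refine lintegral_lintegral_swap (Measurable.aemeasurable ?_)
        exact (hkm.comp measurable_snd).mul (hFm.comp (by fun_prop))
    _ ≤ ∫⁻ t, ENNReal.ofReal (φ.normed volume t) * ∫⁻ p, F p ∂(sqMeasure B) := by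
        refine lintegral_mono fun t => ?_
        simp only
        rw [lintegral_const_mul' _ _ ENNReal.ofReal_ne_top]
        -- Only shifts with ‖t‖ < 1 carry weight, and these move Ω into B.
        by_cases ht : φ.normed volume t = 0
        · simp [ht]
        have ht1 : ‖t‖ < 1 := by
          have h1 : t ∈ Function.support (φ.normed volume) := ht
          rw [φ.support_normed_eq, Metric.mem_ball, dist_zero_right] at h1
          exact h1.trans_le hφ
        refine mul_le_mul' le_rfl ?_
        rw [sqMeasure, sqMeasure, Measure.prod_restrict, Measure.prod_restrict,
          ← lintegral_indicator (hΩ.prod hΩ), ← lintegral_indicator (hB.prod hB),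
          ← lintegral_sub_right_eq_self (μ := (volume : Measure
            (EuclideanSpace ℝ (Fin N))).prod volume) ((B ×ˢ B).indicator F) (t, t)]
        refine lintegral_mono fun p => ?_
        by_cases hp : p ∈ Ω ×ˢ Ω
        · have h2 : p - (t, t) ∈ B ×ˢ B := ⟨hΩB _ hp.1 t ht1, hΩB _ hp.2 t ht1⟩
          rw [indicator_of_mem hp, indicator_of_mem h2]
        · rw [indicator_of_notMem hp]
          exact zero_le
    _ = _ := by
        rw [lintegral_mul_const _ hkm, ← ofReal_integral_eq_lintegral_ofReal φ.integrable_normed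
          (Eventually.of_forall fun t => φ.nonneg_normed t), φ.integral_normed,
          ENNReal.ofReal_one, one_mul]

end

/-- A bounded function of finite logarithmic energy on a Lipschitz set keeps finite energy on
bounded neighbourhoods after extension by zero. -/
theorem IsBoundedLipschitzSet.lintegral_formIntegrand_extension_lt_top (hN : 1 ≤ N)
    (hΩ : IsBoundedLipschitzSet Ω) {B : Set (EuclideanSpace ℝ (Fin N))} {R : ℝ}
    (hR : ∀ x ∈ Ω, ∀ y ∈ B, ‖y - x‖ < R) (hB : MeasurableSet B)
    {w : EuclideanSpace ℝ (Fin N) → ℝ} {M : ℝ} (hw : Measurable w) (hM : ∀ x, |w x| ≤ M)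
    (hw0 : ∀ x ∉ Ω, w x = 0)
    (hE : ∫⁻ p, ENNReal.ofReal (formIntegrand 0 w w p) ∂(sqMeasure Ω) < ⊤) :
    ∫⁻ p, ENNReal.ofReal (formIntegrand 0 w w p) ∂(sqMeasure B) < ⊤ := by
  have hΩm := hΩ.isOpen.measurableSet
  set F : EuclideanSpace ℝ (Fin N) × EuclideanSpace ℝ (Fin N) → ENNReal :=
    fun p => ENNReal.ofReal (formIntegrand 0 w w p) with hF
  have hFm : Measurable F := by
    simp only [hF, formIntegrand]
    fun_prop
  have hFsymm : ∀ x y, F (x, y) = F (y, x) := fun x y => by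
    simp only [hF, formIntegrand]
    rw [norm_sub_rev, ← neg_sub (w y) (w x), neg_mul_neg]
  -- The energy on B × B splits into the energy on Ω × Ω, two equal cross terms bounded by M² times
  -- the interaction integral, and a term where w vanishes at both points.
  have hcross : ∫⁻ x in Ω, ∫⁻ y in B \ Ω, F (x, y) < ⊤ := by
    have h1 := hΩ.lintegral_interaction_lt_top hN hR hB
    calc _ ≤ ∫⁻ x in Ω, ∫⁻ y in B \ Ω,
          ENNReal.ofReal (M ^ 2) * ENNReal.ofReal (‖x - y‖ ^ (-(N : ℝ))) := by
          refine lintegral_mono fun x => setLIntegral_mono' (hB.diff hΩm) fun y hy => ?_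
          rw [← ENNReal.ofReal_mul (sq_nonneg M)]
          refine ENNReal.ofReal_le_ofReal ?_
          simp only [formIntegrand, hw0 y hy.2, sub_zero, mul_zero, add_zero]
          rw [div_eq_mul_inv, ← Real.rpow_neg (norm_nonneg _), ← sq]
          exact mul_le_mul_of_nonneg_right (sq_le_sq.2 ((hM x).trans (le_abs_self _)))
            (by positivity)
      _ = ENNReal.ofReal (M ^ 2) * ∫⁻ x in Ω, ∫⁻ y in B \ Ω,
          ENNReal.ofReal (‖x - y‖ ^ (-(N : ℝ))) := by
          simp_rw [lintegral_const_mul' _ _ (ENNReal.ofReal_ne_top (r := M ^ 2))]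
      _ < ⊤ := ENNReal.mul_lt_top ENNReal.ofReal_lt_top h1
  have hcross' : ∫⁻ x in B \ Ω, ∫⁻ y in Ω, F (x, y) < ⊤ := by
    rw [lintegral_lintegral_swap hFm.aemeasurable]
    simpa only [hFsymm] using hcross
  have hzero : ∫⁻ x in B \ Ω, ∫⁻ y in B \ Ω, F (x, y) = 0 := by
    refine (setLIntegral_congr_fun (hB.diff hΩm) fun x hx => ?_).trans lintegral_zero
    refine (setLIntegral_congr_fun (hB.diff hΩm) fun y hy => ?_).trans lintegral_zero
    simp [hF, formIntegrand, hw0 x hx.2, hw0 y hy.2]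
  rw [sqMeasure, lintegral_prod _ hFm.aemeasurable] at hE ⊢
  have hsub : B ⊆ Ω ∪ (B \ Ω) := by rw [union_sdiff_self]; exact subset_union_right
  have hsplit : ∀ G : EuclideanSpace ℝ (Fin N) → ENNReal,
      ∫⁻ x in B, G x ≤ (∫⁻ x in Ω, G x) + ∫⁻ x in B \ Ω, G x := fun G => by
    rw [← lintegral_union (hB.diff hΩm) disjoint_sdiff_right]
    exact lintegral_mono_set hsub
  have hFy : ∀ S : Set (EuclideanSpace ℝ (Fin N)), Measurable fun x => ∫⁻ y in S, F (x, y) :=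
    fun S => hFm.lintegral_prod_right'
  calc ∫⁻ x in B, ∫⁻ y in B, F (x, y)
      ≤ ∫⁻ x in B, ((∫⁻ y in Ω, F (x, y)) + ∫⁻ y in B \ Ω, F (x, y)) :=
        lintegral_mono fun x => hsplit _
    _ ≤ _ := hsplit _
    _ < ⊤ := by
        rw [lintegral_add_left (hFy _), lintegral_add_left (hFy _), hzero, add_zero]
        exact ENNReal.add_lt_top.2 ⟨ENNReal.add_lt_top.2 ⟨hE, hcross⟩, hcross'⟩

/-- Mollifications of the zero extension are Lipschitz, hence in ℍ^{1/2}. They converge in L² with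
energy bounded by that of the extension near Ω, so the Mazur argument finds an approximation in the
form norm without proving that their own energies converge. -/
theorem IsBoundedLipschitzSet.exists_energy_approx_truncation (hN : 1 ≤ N)
    (hΩ : IsBoundedLipschitzSet Ω) {u : L2 Ω} (hu : u ∈ energySpace Ω 0) {M : ℝ} (hM : 0 ≤ M)
    {ε : ℝ} (hε : 0 < ε) :
    ∃ v ∈ energySpace Ω (1 / 2),
      ‖v - (memLp_truncation hΩ.isOpen.measurableSet hM u).toLp‖ ≤ ε ∧
      energyForm Ω 0 (v - (memLp_truncation hΩ.isOpen.measurableSet hM u).toLp : L2 Ω)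
        (v - (memLp_truncation hΩ.isOpen.measurableSet hM u).toLp : L2 Ω) ≤ ε := by
  have hΩm := hΩ.isOpen.measurableSet
  have hfin : IsFiniteMeasure (volume.restrict Ω) := ⟨by simpa using hΩ.isBounded.measure_lt_top⟩
  set w := truncation Ω M u with hw
  have hwm : Measurable w := measurable_truncation hΩm (Lp.stronglyMeasurable u).measurable
  have hwM : ∀ x, |w x| ≤ M := abs_truncation_le hM
  have hw0 : ∀ x ∉ Ω, w x = 0 := fun x hx => indicator_of_notMem hx _
  set U : L2 Ω := (memLp_truncation hΩm hM u).toLp with hU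
  have hUw : U =ᵐ[volume.restrict Ω] w := (memLp_truncation hΩm hM u).coeFn_toLp
  obtain ⟨hUE, -⟩ := truncation_energy_le hΩm hM hu
  obtain ⟨ρ, hρ⟩ := hΩ.isBounded.subset_ball 0
  set B : Set (EuclideanSpace ℝ (Fin N)) := Metric.ball 0 (ρ + 1) with hB
  have hBm : MeasurableSet B := Metric.isOpen_ball.measurableSet
  have hΩB : ∀ x ∈ Ω, ∀ t, ‖t‖ < 1 → x - t ∈ B := fun x hx t ht => by
    have h1 := hρ hx
    rw [mem_ball_zero_iff] at h1 ⊢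
    linarith [norm_sub_le x t]
  have hJ : ∫⁻ p, ENNReal.ofReal (formIntegrand 0 w w p) ∂(sqMeasure B) < ⊤ := by
    refine hΩ.lintegral_formIntegrand_extension_lt_top hN (R := (ρ + 1) + ρ)
      (fun x hx y hy => ?_) hBm hwm hwM hw0 ?_
    · have h1 := hρ hx
      rw [mem_ball_zero_iff] at h1 hy
      linarith [norm_sub_le y x]
    · have h1 : ∫⁻ p, ENNReal.ofReal (formIntegrand 0 w w p) ∂(sqMeasure Ω)
          = ∫⁻ p, ENNReal.ofReal (formIntegrand 0 U U p) ∂(sqMeasure Ω) := by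
        refine lintegral_congr_ae ?_
        filter_upwards [ae_sqMeasure_of_ae hUw] with p hp
        simp only [formIntegrand, hp.1, hp.2]
      rw [h1, lintegral_formIntegrand_self hUE]
      exact ENNReal.ofReal_lt_top
  set J := (∫⁻ p, ENNReal.ofReal (formIntegrand 0 w w p) ∂(sqMeasure B)).toReal with hJdef
  have hwint : Integrable w volume := by
    refine (integrableOn_iff_integrable_of_support_subset (s := Ω) fun x hx => ?_).1
      (Integrable.of_bound hwm.aestronglyMeasurable M (Eventually.of_forall hwM))
    by_contra h
    exact hx (hw0 x h)
  have hcs : HasCompactSupport w := by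
    refine HasCompactSupport.intro hΩ.isBounded.isCompact_closure fun x hx => hw0 x ?_
    exact fun h => hx (subset_closure h)
  have hrad : ∀ i : ℕ, (0 : ℝ) < 1 / ((i : ℝ) + 1) := fun i => Nat.one_div_pos_of_nat
  -- The inner radius is half the outer one: a bounded ratio of radii is what almost everywhere
  -- convergence of the mollifications requires (K = 2 below).
  set φ : ℕ → ContDiffBump (0 : EuclideanSpace ℝ (Fin N)) := fun i =>
    ⟨1 / ((i : ℝ) + 1) / 2, 1 / ((i : ℝ) + 1), half_pos (hrad i), half_lt_self (hrad i)⟩ with hφ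
  have hrOut : ∀ i, (φ i).rOut = 1 / ((i : ℝ) + 1) := fun i => rfl
  have hlim : ∀ᵐ x, Tendsto (fun i => mollify (φ i) w x) atTop (𝓝 (w x)) := by
    simp only [mollify_eq_convolution]
    refine ContDiffBump.ae_convolution_tendsto_right_of_locallyIntegrable (K := 2) ?_ ?_
      hwint.locallyIntegrable
    · exact tendsto_one_div_add_atTop_nhds_zero_nat
    · refine Eventually.of_forall fun i => ?_
      change 1 / ((i : ℝ) + 1) ≤ 2 * (1 / ((i : ℝ) + 1) / 2)
      linarith
  choose K hK using fun i =>
    exists_lipschitzWith_mollify (φ := φ i) hwint.locallyIntegrable hcs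
  have hmem : ∀ i, MemLp (mollify (φ i) w) 2 (volume.restrict Ω) := fun i =>
    MemLp.of_bound (hK i).continuous.aestronglyMeasurable M
      (Eventually.of_forall fun x => abs_mollify_le hwM x)
  set v : ℕ → L2 Ω := fun i => (hmem i).toLp with hv
  have hvw : ∀ i, v i =ᵐ[volume.restrict Ω] mollify (φ i) w := fun i => (hmem i).coeFn_toLp
  have hvE : ∀ i, v i ∈ energySpace Ω (1 / 2) := fun i =>
    mem_energySpace_of_lipschitz hN hΩm hΩ.isBounded (by norm_num) (L := K i)
      (fun x _ y _ => by simpa [dist_eq_norm] using (hK i).dist_le_mul x y) (hvw i)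
  have hvU : Tendsto v atTop (𝓝 U) := by
    refine tendsto_L2_of_dominated (memLp_const M) (fun i => ?_) ?_
    · filter_upwards [hvw i] with x hx
      rw [hx]
      exact abs_mollify_le hwM x
    · filter_upwards [ae_all_iff.2 hvw, hUw, ae_restrict_of_ae hlim] with x h1 h2 h3
      simpa only [h1, h2] using h3
  have hvJ : ∀ i, energyForm Ω 0 (v i) (v i) ≤ J / 2 := fun i => by
    refine energyForm_le_of_lintegral_le (by positivity) ?_
    rw [mul_div_cancel₀ J two_ne_zero, hJdef, ENNReal.ofReal_toReal hJ.ne]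
    refine le_trans (le_of_eq ?_) (lintegral_formIntegrand_mollify_le (φ := φ i) hΩm hBm hΩB ?_
      hwm hwM 0)
    · refine lintegral_congr_ae ?_
      filter_upwards [ae_sqMeasure_of_ae (hvw i)] with p hp
      simp only [formIntegrand, hp.1, hp.2]
    · rw [hrOut, div_le_one (by positivity)]
      linarith [(Nat.cast_nonneg i : (0 : ℝ) ≤ i)]
  have h12 : energySpace Ω (1 / 2) ≤ energySpace Ω 0 :=
    energySpace_anti hΩm hΩ.isBounded (by norm_num)
  obtain ⟨z, hz, hzn, hzE⟩ := (hΩ.isCompactForm hN le_rfl).exists_form_approx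
    (energySpace Ω (1 / 2)) ⟨U, hUE⟩ (J / 2) (fun δ hδ => by
      obtain ⟨i, hi⟩ := (Metric.tendsto_atTop.1 hvU δ hδ)
      have h1 := hi i le_rfl
      rw [dist_eq_norm] at h1
      exact ⟨⟨v i, h12 (hvE i)⟩, hvE i, h1.le, hvJ i⟩) hε
  exact ⟨z, hz, hzn, hzE⟩

/-- `ℍ^{1/2}(Ω)` is dense in `ℍ⁰(Ω)` for the form norm. -/
theorem IsBoundedLipschitzSet.exists_energy_approx (hN : 1 ≤ N)
    (hΩ : IsBoundedLipschitzSet Ω) {u : L2 Ω} (hu : u ∈ energySpace Ω 0) {ε : ℝ} (hε : 0 < ε) :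
    ∃ v ∈ energySpace Ω (1 / 2), ‖v - u‖ ≤ ε ∧
      energyForm Ω 0 (v - u : L2 Ω) (v - u : L2 Ω) ≤ ε := by
  have hΩm := hΩ.isOpen.measurableSet
  have hform := hΩ.isCompactForm hN (s := 0) le_rfl
  have h12 : energySpace Ω (1 / 2) ≤ energySpace Ω 0 :=
    energySpace_anti hΩm hΩ.isBounded (by norm_num)
  obtain ⟨z, hz, hzn, hzE⟩ := hform.exists_form_approx
    (energySpace Ω (1 / 2)) ⟨u, hu⟩ (2 * energyForm Ω 0 u u + 2) (fun δ hδ => by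
      obtain ⟨i, hi⟩ := (Metric.tendsto_atTop.1 (tendsto_truncation hΩm u) (δ / 2) (by positivity))
      have h1 := hi i le_rfl
      rw [dist_eq_norm] at h1
      obtain ⟨hTE, hTle⟩ := truncation_energy_le hΩm (Nat.cast_nonneg (α := ℝ) i) hu
      obtain ⟨v, hv, hvn, hvE⟩ := hΩ.exists_energy_approx_truncation hN hu
        (Nat.cast_nonneg (α := ℝ) i) (ε := min (δ / 2) 1) (by positivity)
      set T : energySpace Ω 0 := ⟨_, hTE⟩ with hT
      set V : energySpace Ω 0 := ⟨v, h12 hv⟩ with hV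
      refine ⟨V, hv, ?_, ?_⟩
      · have h2 := norm_sub_le_norm_sub_add_norm_sub v T.1 u
        have h3 := hvn.trans (min_le_left _ _)
        change ‖v - u‖ ≤ δ
        linarith
      -- Nonnegativity at V - 2T says a(V,V) ≤ 2 a(V-T,V-T) + 2 a(T,T). This is the source of the
      -- bound 2 𝓔_0(u,u) + 2.
      · have h2 := hform.nonneg (V - (2 : ℝ) • T)
        have h3 : energyBilin Ω 0 (V - T) (V - T) ≤ 1 := hvE.trans (min_le_right _ _)
        have h4 : energyBilin Ω 0 T T ≤ energyForm Ω 0 u u := hTle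
        simp only [map_sub, map_smul, LinearMap.sub_apply, LinearMap.smul_apply, smul_eq_mul,
          hform.symm T V] at h2 h3
        linarith) hε
  exact ⟨z, hz, hzn, hzE⟩

end Mollification

/-! ### Identification of `eigenvalueNth` and positivity -/

section Eigenvalues

variable {N : ℕ} {Ω : Set (EuclideanSpace ℝ (Fin N))}

/-- Polynomials in ⟪e, x⟫ are Lipschitz on the bounded set Ω. One that vanishes almost everywhere on
the open set Ω vanishes on an interval, so the space of polynomials embeds. -/
theorem not_finiteDimensional_energySpace (hN : 1 ≤ N) (hΩ : IsOpen Ω)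
    (hb : Bornology.IsBounded Ω) (hne : Ω.Nonempty) {s : ℝ} (hs : s < 1) :
    ¬ FiniteDimensional ℝ (energySpace Ω s) := by
  intro hfd
  have hfin : IsFiniteMeasure (volume.restrict Ω) := ⟨by simpa using hb.measure_lt_top⟩
  have : Nontrivial (EuclideanSpace ℝ (Fin N)) := by
    have : Nonempty (Fin N) := ⟨⟨0, hN⟩⟩
    infer_instance
  obtain ⟨e, he⟩ := exists_norm_eq (EuclideanSpace ℝ (Fin N)) zero_le_one
  obtain ⟨R, hR⟩ := hb.exists_norm_le
  have hin : ∀ x ∈ Ω, (inner ℝ e x : ℝ) ∈ Icc (-R) R := fun x hx => by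
    have := (abs_real_inner_le_norm e x).trans_eq (by rw [he, one_mul])
    exact abs_le.1 (this.trans (hR x hx))
  have hcont : ∀ P : Polynomial ℝ,
      Continuous fun x : EuclideanSpace ℝ (Fin N) => P.eval (inner ℝ e x : ℝ) :=
    fun P => P.continuous.comp (by fun_prop)
  have hmem : ∀ P : Polynomial ℝ, MemLp (fun x : EuclideanSpace ℝ (Fin N) =>
      P.eval (inner ℝ e x : ℝ)) 2 (volume.restrict Ω) := fun P => by
    obtain ⟨C, hC⟩ := isCompact_Icc.exists_bound_of_continuousOn
      (s := Icc (-R) R) (f := fun t => P.eval t) P.continuous.continuousOn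
    exact MemLp.of_bound (hcont P).aestronglyMeasurable C
      ((ae_restrict_mem hΩ.measurableSet).mono fun x hx => hC _ (hin x hx))
  have hE : ∀ P : Polynomial ℝ, (hmem P).toLp ∈ energySpace Ω s := fun P => by
    have hP : ContDiff ℝ 1 fun t => P.eval t := by
      simpa using P.contDiff_aeval (𝕜 := ℝ) 1
    obtain ⟨K, hK⟩ := hP.contDiffOn.exists_lipschitzOnWith one_ne_zero (convex_Icc (-R) R)
      isCompact_Icc
    refine mem_energySpace_of_lipschitz hN hΩ.measurableSet hb hs (L := K)
      (fun x hx y hy => ?_) (hmem P).coeFn_toLp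
    have h1 := hK.dist_le_mul _ (hin x hx) _ (hin y hy)
    rw [Real.dist_eq, Real.dist_eq, ← inner_sub_right] at h1
    refine h1.trans (mul_le_mul_of_nonneg_left ?_ K.2)
    exact (abs_real_inner_le_norm e _).trans_eq (by rw [he, one_mul])
  let T : Polynomial ℝ →ₗ[ℝ] energySpace Ω s :=
    { toFun := fun P => ⟨(hmem P).toLp, hE P⟩
      map_add' := fun P Q => Subtype.ext <| by
        rw [Submodule.coe_add]
        refine Eq.trans ?_ ((hmem P).toLp_add (hmem Q))
        exact MemLp.toLp_congr (hmem (P + Q)) ((hmem P).add (hmem Q))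
          (Eventually.of_forall fun x => by simp)
      map_smul' := fun c P => Subtype.ext <| by
        rw [Submodule.coe_smul]
        refine Eq.trans ?_ ((hmem P).toLp_const_smul c)
        exact MemLp.toLp_congr (hmem (c • P)) ((hmem P).const_smul c)
          (Eventually.of_forall fun x => by simp) }
  have hT : Function.Injective T := by
    rw [← LinearMap.ker_eq_bot, LinearMap.ker_eq_bot']
    intro P hP
    have h0 : (hmem P).toLp = 0 := congrArg Subtype.val hP
    have h1 : (fun x : EuclideanSpace ℝ (Fin N) => P.eval (inner ℝ e x : ℝ))
        =ᵐ[volume.restrict Ω] fun _ => 0 := by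
      filter_upwards [(hmem P).coeFn_toLp, Lp.coeFn_zero ℝ 2 (volume.restrict Ω)] with x hx hx0
      rw [← hx, h0, hx0]
      rfl
    have h2 := Measure.eqOn_open_of_ae_eq h1 hΩ (hcont P).continuousOn continuousOn_const
    obtain ⟨x, hx⟩ := hne
    obtain ⟨r, hr, hball⟩ := Metric.isOpen_iff.1 hΩ x hx
    refine P.eq_zero_of_infinite_isRoot ((Ioo_infinite (lt_add_of_pos_right
      (inner ℝ e x : ℝ) hr)).mono fun t ht => ?_)
    have hxt : x + (t - inner ℝ e x) • e ∈ Ω := hball <| by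
      rw [Metric.mem_ball, dist_eq_norm, add_sub_cancel_left, norm_smul, he, mul_one,
        Real.norm_eq_abs, abs_lt]
      constructor <;> linarith [ht.1, ht.2]
    have h3 : (inner ℝ e (x + (t - inner ℝ e x) • e) : ℝ) = t := by
      rw [inner_add_right, inner_smul_right, real_inner_self_eq_norm_sq, he]
      ring
    have h4 := h2 hxt
    simp only [h3] at h4
    exact h4
  exact Polynomial.not_finite (R := ℝ) (Module.Finite.of_injective T hT)

theorem IsBoundedLipschitzSet.exists_eigenSystem (hN : 1 ≤ N) (hΩ : IsBoundedLipschitzSet Ω)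
    (hne : Ω.Nonempty) {s : ℝ} (hs : s ∈ Ico (0 : ℝ) 1) (n : ℕ) :
    ∃ (e : Fin (n + 1) → energySpace Ω s) (lam : Fin (n + 1) → ℝ),
      IsCompactForm.IsEigenSystem (energyBilin Ω s) e lam :=
  (hΩ.isCompactForm hN hs.1).exists_isEigenSystem
    (not_finiteDimensional_energySpace hN hΩ.isOpen hΩ.isBounded hne hs.2) _

open IsCompactForm

variable {s : ℝ} {n : ℕ} {e : Fin (n + 1) → energySpace Ω s} {lam : Fin (n + 1) → ℝ}

theorem IsCompactForm.IsEigenSystem.mem_weakEigenspace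
    (he : IsEigenSystem (energyBilin Ω s) e lam) (i : Fin (n + 1)) :
    (e i : L2 Ω) ∈ weakEigenspace Ω s (lam i) :=
  mem_weakEigenspace_iff.2 ⟨(e i).2, fun v hv => he.eigen i ⟨v, hv⟩⟩

/-- The part d of u orthogonal to the first n eigenvectors has energy mu ‖d‖², whereas minimality
makes it at least λ_n ‖d‖². Since mu < λ_n, d = 0. -/
theorem IsCompactForm.IsEigenSystem.weakEigenspace_le_span
    (he : IsEigenSystem (energyBilin Ω s) e lam) {mu : ℝ} (hmu : mu < lam (Fin.last n)) :
    weakEigenspace Ω s mu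
      ≤ Submodule.span ℝ (range fun j : Fin n => (e j.castSucc : L2 Ω)) := by
  intro u hu
  obtain ⟨huE, hueig⟩ := mem_weakEigenspace_iff.1 hu
  set U : energySpace Ω s := ⟨u, huE⟩ with hU
  have hUeig : ∀ v, energyBilin Ω s U v = mu * inner ℝ u (v : L2 Ω) := fun v => hueig v v.2
  have hON : Orthonormal ℝ fun j : Fin n => (e j.castSucc : L2 Ω) :=
    he.orthonormal.comp _ (Fin.castSucc_injective n)
  set p : energySpace Ω s :=
    ∑ j : Fin n, (inner ℝ (e j.castSucc : L2 Ω) u : ℝ) • e j.castSucc with hp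
  have hpc : (p : L2 Ω)
      = ∑ j : Fin n, (inner ℝ (e j.castSucc : L2 Ω) u : ℝ) • (e j.castSucc : L2 Ω) := by
    simp [hp]
  set d : energySpace Ω s := U - p with hd
  have hdo : ∀ j : Fin n, inner ℝ (e j.castSucc : L2 Ω) (d : L2 Ω) = 0 := fun j => by
    rw [hd, Submodule.coe_sub, inner_sub_right, hpc, hON.inner_right_fintype, sub_self]
  have hmin := he.minimal (Fin.last n) d fun j hj => by
    obtain ⟨j, rfl⟩ := Fin.eq_castSucc_of_ne_last hj.ne
    exact hdo j
  have hpd : energyBilin Ω s p d = 0 := by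
    rw [hp]
    simp [he.eigen, hdo]
  have hpd' : inner ℝ (p : L2 Ω) (d : L2 Ω) = 0 := by
    rw [hpc, sum_inner]
    simp [inner_smul_left, hdo]
  have hud : inner ℝ u (d : L2 Ω) = ‖(d : L2 Ω)‖ ^ 2 := by
    have : u = (d : L2 Ω) + (p : L2 Ω) := by simp [hd, hU]
    rw [this, inner_add_left, hpd', add_zero]
    simp [hd, hU]
  have hdd : energyBilin Ω s d d = mu * ‖(d : L2 Ω)‖ ^ 2 := by
    calc energyBilin Ω s d d = energyBilin Ω s U d - energyBilin Ω s p d := by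
          rw [← LinearMap.sub_apply, ← map_sub]
      _ = _ := by rw [hpd, sub_zero, hUeig, hud]
  rw [hdd] at hmin
  have hd0 : ‖(d : L2 Ω)‖ = 0 := by
    by_contra h
    have : 0 < ‖(d : L2 Ω)‖ ^ 2 := by positivity
    nlinarith
  have hup : u = (p : L2 Ω) := by
    have := norm_eq_zero.1 hd0
    rw [hd, Submodule.coe_sub, sub_eq_zero] at this
    exact this
  rw [hup, hpc]
  exact Submodule.sum_mem _ fun j _ => Submodule.smul_mem _ _ (Submodule.subset_span ⟨j, rfl⟩)

theorem IsCompactForm.IsEigenSystem.rank_eigenSpan_Iio_le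
    (he : IsEigenSystem (energyBilin Ω s) e lam) :
    Module.rank ℝ (eigenSpan Ω s (Iio (lam (Fin.last n)))) ≤ (n : Cardinal) := by
  have h1 : eigenSpan Ω s (Iio (lam (Fin.last n)))
      ≤ Submodule.span ℝ (range fun j : Fin n => (e j.castSucc : L2 Ω)) :=
    iSup₂_le fun mu hmu => he.weakEigenspace_le_span hmu
  refine (Submodule.rank_mono h1).trans ((rank_span_le _).trans ?_)
  simpa using Cardinal.mk_range_le (f := fun j : Fin n => (e j.castSucc : L2 Ω))

theorem IsCompactForm.IsEigenSystem.lt_rank_eigenSpan_Iic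
    (he : IsEigenSystem (energyBilin Ω s) e lam) {t : ℝ} (ht : lam (Fin.last n) ≤ t) :
    (n : Cardinal) < Module.rank ℝ (eigenSpan Ω s (Iic t)) := by
  have h1 : Submodule.span ℝ (range fun i => (e i : L2 Ω)) ≤ eigenSpan Ω s (Iic t) := by
    rw [Submodule.span_le]
    rintro _ ⟨i, rfl⟩
    exact Submodule.mem_iSup_of_mem (lam i) (Submodule.mem_iSup_of_mem
      ((he.mono (Fin.le_last i)).trans ht) (he.mem_weakEigenspace i))
  refine lt_of_lt_of_le ?_ (Submodule.rank_mono h1)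
  rw [rank_span he.orthonormal.linearIndependent,
    Cardinal.mk_range_eq _ he.orthonormal.linearIndependent.injective, Cardinal.mk_fin]
  exact_mod_cast Nat.lt_succ_self n

/-- The two rank bounds show that the set in the definition is the half-line starting at the
variational eigenvalue. All later estimates pass through this identification. -/
theorem IsCompactForm.IsEigenSystem.eigenvalueNth_eq
    (he : IsEigenSystem (energyBilin Ω s) e lam) :
    eigenvalueNth Ω s n = lam (Fin.last n) := by
  have h : {t | (n : Cardinal) < Module.rank ℝ (eigenSpan Ω s (Iic t))}
      = Ici (lam (Fin.last n)) := by
    ext t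
    refine ⟨fun ht => ?_, fun ht => he.lt_rank_eigenSpan_Iic ht⟩
    by_contra hlt
    have h1 : eigenSpan Ω s (Iic t) ≤ eigenSpan Ω s (Iio (lam (Fin.last n))) :=
      biSup_mono fun mu hmu => lt_of_le_of_lt (mem_Iic.1 hmu) (not_le.1 (mt mem_Ici.2 hlt))
    exact absurd ht (not_lt.2 ((Submodule.rank_mono h1).trans he.rank_eigenSpan_Iio_le))
  rw [eigenvalueNth, h, csInf_Ici]

/-- The kernel is positive off the diagonal, so u(x) = u(y) for almost every pair; fix one good x.
Connectedness plays no role, since the double integral couples all points of Ω. -/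
theorem exists_ae_const_of_energyForm_eq_zero (hne : volume.restrict Ω ≠ 0) {u : L2 Ω}
    (hu : u ∈ energySpace Ω s) (h0 : energyForm Ω s u u = 0) :
    ∃ c : ℝ, u =ᵐ[volume.restrict Ω] fun _ => c := by
  have h1 : ∫ p, formIntegrand s u u p ∂(sqMeasure Ω) = 0 := by
    rw [energyForm] at h0
    linarith
  rw [integral_eq_zero_iff_of_nonneg (fun p => formIntegrand_self_nonneg s u p) hu] at h1
  have h2 : ∀ᵐ p ∂(sqMeasure Ω), u p.2 = u p.1 := by
    filter_upwards [h1] with p hp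
    rcases eq_or_ne p.1 p.2 with h | h
    · rw [h]
    · have hr : 0 < ‖p.1 - p.2‖ := norm_pos_iff.2 (sub_ne_zero.2 h)
      have h3 : (u p.1 - u p.2) * (u p.1 - u p.2) / ‖p.1 - p.2‖ ^ ((N : ℝ) + 2 * s) = 0 := hp
      rw [div_eq_zero_iff, or_iff_left (Real.rpow_pos_of_pos hr _).ne', mul_self_eq_zero] at h3
      linarith
  have h3 := Measure.ae_ae_of_ae_prod h2
  have : (ae (volume.restrict Ω)).NeBot := ae_neBot.2 hne
  obtain ⟨x, hx⟩ := h3.exists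
  exact ⟨u x, hx⟩

/-- Otherwise all n + 1 ≥ 2 eigenvectors have zero energy and are constants, but two constants
cannot be orthonormal. -/
theorem IsCompactForm.IsEigenSystem.last_pos (hΩ : IsOpen Ω) (hne : Ω.Nonempty)
    (hn : 1 ≤ n) (he : IsEigenSystem (energyBilin Ω s) e lam) : 0 < lam (Fin.last n) := by
  have hmeas : volume.restrict Ω ≠ 0 := by
    rw [Ne, Measure.restrict_eq_zero]
    exact (hΩ.measure_pos volume hne).ne'
  by_contra hle
  have hlam : ∀ i, energyForm Ω s (e i).1 (e i).1 = lam i := fun i => by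
    rw [← energyBilin_apply, he.eigen, real_inner_self_eq_norm_sq, he.orthonormal.1]
    norm_num
  have hzero : ∀ i, energyForm Ω s (e i).1 (e i).1 = 0 := fun i =>
    le_antisymm ((hlam i).le.trans ((he.mono (Fin.le_last i)).trans (not_lt.1 hle)))
      (energyForm_self_nonneg s _)
  choose c hc using fun i => exists_ae_const_of_energyForm_eq_zero hmeas (e i).2 (hzero i)
  have hinner : ∀ i j, inner ℝ (e i : L2 Ω) (e j : L2 Ω)
      = c i * c j * (volume.restrict Ω).real univ := fun i j => by
    rw [L2.inner_def, mul_comm, ← smul_eq_mul, ← integral_const]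
    refine integral_congr_ae ?_
    filter_upwards [hc i, hc j] with x hi hj
    rw [hi, hj]
    simp [mul_comm]
  have h01 : (0 : Fin (n + 1)) ≠ Fin.last n := fun h => by
    have := congrArg Fin.val h
    simp only [Fin.val_zero, Fin.val_last] at this
    omega
  have h1 : inner ℝ (e 0 : L2 Ω) (e (Fin.last n) : L2 Ω) = 0 := he.orthonormal.2 h01
  have h2 : ∀ i, inner ℝ (e i : L2 Ω) (e i : L2 Ω) = 1 := fun i => by
    rw [real_inner_self_eq_norm_sq, he.orthonormal.1]
    norm_num
  have h3 := h2 0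
  have h4 := h2 (Fin.last n)
  rw [hinner] at h1 h3 h4
  set V := (volume.restrict Ω).real univ
  have h5 : (c 0 * c 0 * V) * (c (Fin.last n) * c (Fin.last n) * V)
      = (c 0 * c (Fin.last n) * V) ^ 2 := by ring
  rw [h1, h3, h4] at h5
  norm_num at h5

end Eigenvalues

/-! ### Convergence of eigenvalues and eigenfunctions -/

section Convergence

open IsCompactForm

theorem IsCompactForm.tendsto_apply {H : Type*} [NormedAddCommGroup H] [InnerProductSpace ℝ H]
    {D : Submodule ℝ H} {a : LinearMap.BilinForm ℝ D} (ha : IsCompactForm a) {u v : ℕ → D}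
    {x y : D} (hu : Tendsto (fun k => a (u k - x) (u k - x)) atTop (𝓝 0))
    (hv : Tendsto (fun k => a (v k - y) (v k - y)) atTop (𝓝 0)) :
    Tendsto (fun k => a (u k) (v k)) atTop (𝓝 (a x y)) := by
  have hzero : ∀ {p q : ℕ → D}, Tendsto (fun k => a (p k) (p k) * a (q k) (q k)) atTop (𝓝 0) →
      Tendsto (fun k => a (p k) (q k)) atTop (𝓝 0) := fun {p q} h => by
    have h1 : Tendsto (fun k => (a (p k) (q k)) ^ 2) atTop (𝓝 0) :=
      squeeze_zero (fun k => sq_nonneg _) (fun k => ha.apply_sq_le (p k) (q k)) h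
    have h2 := h1.sqrt
    simp only [Real.sqrt_sq_eq_abs, Real.sqrt_zero] at h2
    exact (tendsto_zero_iff_abs_tendsto_zero _).2 h2
  have h1 : Tendsto (fun k => a (u k - x) (v k - y)) atTop (𝓝 0) :=
    hzero (by simpa using hu.mul hv)
  have h2 : Tendsto (fun k => a (u k - x) y) atTop (𝓝 0) :=
    hzero (q := fun _ => y) (by simpa using hu.mul_const (a y y))
  have h3 : Tendsto (fun k => a x (v k - y)) atTop (𝓝 0) :=
    hzero (p := fun _ => x) (by simpa using hv.const_mul (a x x))
  have h4 := ((h1.add h2).add h3).add_const (a x y)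
  simp only [add_zero, zero_add] at h4
  refine h4.congr fun k => ?_
  simp only [map_sub, LinearMap.sub_apply]
  ring

variable {N : ℕ} {Ω : Set (EuclideanSpace ℝ (Fin N))}

theorem IsBoundedLipschitzSet.exists_energy_approx_seq (hN : 1 ≤ N)
    (hΩ : IsBoundedLipschitzSet Ω) (u : energySpace Ω 0) :
    ∃ v : ℕ → energySpace Ω 0, (∀ k, (v k : L2 Ω) ∈ energySpace Ω (1 / 2)) ∧
      Tendsto (fun k => (v k : L2 Ω)) atTop (𝓝 (u : L2 Ω)) ∧
      Tendsto (fun k => energyBilin Ω 0 (v k - u) (v k - u)) atTop (𝓝 0) := by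
  have h12 : energySpace Ω (1 / 2) ≤ energySpace Ω 0 :=
    energySpace_anti hΩ.isOpen.measurableSet hΩ.isBounded (by norm_num)
  choose v hv hvn hvE using fun k : ℕ =>
    hΩ.exists_energy_approx hN u.2 (ε := 1 / ((k : ℝ) + 1)) Nat.one_div_pos_of_nat
  have hone := tendsto_one_div_add_atTop_nhds_zero_nat (𝕜 := ℝ)
  refine ⟨fun k => ⟨v k, h12 (hv k)⟩, hv, ?_, ?_⟩
  · rw [tendsto_iff_norm_sub_tendsto_zero]
    exact squeeze_zero (fun _ => norm_nonneg _) hvn hone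
  · exact squeeze_zero (fun k => energyForm_self_nonneg 0 _) hvE hone

theorem IsBoundedLipschitzSet.eigenvalueNth_nonneg (hN : 1 ≤ N) (hΩ : IsBoundedLipschitzSet Ω)
    (hne : Ω.Nonempty) {s : ℝ} (hs : s ∈ Ico (0 : ℝ) 1) (n : ℕ) : 0 ≤ eigenvalueNth Ω s n := by
  obtain ⟨e, lam, he⟩ := hΩ.exists_eigenSystem hN hne hs n
  have h1 := he.eigen (Fin.last n) (e (Fin.last n))
  rw [real_inner_self_eq_norm_sq, he.orthonormal.1, one_pow, mul_one, energyBilin_apply] at h1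
  rw [he.eigenvalueNth_eq, ← h1]
  exact energyForm_self_nonneg s _

/-- The first n + 1 eigenfunctions of 𝓔_s serve as trial vectors for 𝓔_0: on their span 𝓔_s is at
most λ_{n,s} times the squared norm, and 𝓔_0 ≤ R^(2s) 𝓔_s. -/
theorem IsBoundedLipschitzSet.eigenvalueNth_zero_le (hN : 1 ≤ N) (hΩ : IsBoundedLipschitzSet Ω)
    (hne : Ω.Nonempty) {s R : ℝ} (hs : s ∈ Ico (0 : ℝ) 1) (hR : 0 ≤ R)
    (hd : ∀ x ∈ Ω, ∀ y ∈ Ω, ‖x - y‖ ≤ R) (n : ℕ) :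
    eigenvalueNth Ω 0 n ≤ R ^ (2 * s) * eigenvalueNth Ω s n := by
  have hΩm := hΩ.isOpen.measurableSet
  obtain ⟨e₀, lam₀, he₀⟩ := hΩ.exists_eigenSystem hN hne (s := 0) ⟨le_rfl, one_pos⟩ n
  obtain ⟨e, lam, he⟩ := hΩ.exists_eigenSystem hN hne hs n
  have hanti : energySpace Ω s ≤ energySpace Ω 0 := energySpace_anti hΩm hΩ.isBounded hs.1
  obtain ⟨c, hc0, hc⟩ := he₀.exists_comb fun i => ⟨(e i : L2 Ω), hanti (e i).2⟩
  rw [he₀.eigenvalueNth_eq, he.eigenvalueNth_eq]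
  set w : energySpace Ω s := ∑ i, c i • e i with hw
  have hwcoe : ((∑ i, c i • (⟨(e i : L2 Ω), hanti (e i).2⟩ : energySpace Ω 0) :
      energySpace Ω 0) : L2 Ω) = w := by
    simp [hw]
  have hwc : (w : L2 Ω) = ∑ i, c i • (e i : L2 Ω) := by simp [hw]
  rw [energyBilin_apply, hwcoe] at hc
  have hnorm : ‖(w : L2 Ω)‖ ^ 2 = ∑ i, c i ^ 2 := by
    rw [← real_inner_self_eq_norm_sq, hwc, he.orthonormal.inner_sum]
    simp [sq]
  have hpos : 0 < ‖(w : L2 Ω)‖ ^ 2 := by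
    obtain ⟨i, hi⟩ := Function.ne_iff.1 hc0
    rw [hnorm]
    exact Finset.sum_pos' (fun _ _ => sq_nonneg _) ⟨i, Finset.mem_univ _, by
      have : c i ≠ 0 := hi
      positivity⟩
  have hE : energyForm Ω s w w ≤ lam (Fin.last n) * ‖(w : L2 Ω)‖ ^ 2 := by
    have h1 : energyForm Ω s w w = ∑ i, lam i * c i ^ 2 := by
      have h2 : energyBilin Ω s w w = ∑ i, c i * (lam i * inner ℝ (e i : L2 Ω) (w : L2 Ω)) := by
        have h3 : energyBilin Ω s w = ∑ i, c i • energyBilin Ω s (e i) := by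
          rw [hw, map_sum]
          simp only [map_smul]
        rw [h3, LinearMap.sum_apply]
        refine Finset.sum_congr rfl fun i _ => ?_
        rw [LinearMap.smul_apply, he.eigen, smul_eq_mul]
      rw [← energyBilin_apply, h2]
      refine Finset.sum_congr rfl fun i _ => ?_
      rw [hwc, he.orthonormal.inner_right_fintype]
      ring
    rw [h1, hnorm, Finset.mul_sum]
    exact Finset.sum_le_sum fun i _ =>
      mul_le_mul_of_nonneg_right (he.mono (Fin.le_last i)) (sq_nonneg _)
  have hcmp := energyForm_le_of_le hΩm hs.1 hR hd w.2
  rw [sub_zero] at hcmp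
  have hRp : 0 ≤ R ^ (2 * s) := by positivity
  refine le_of_mul_le_mul_right ?_ hpos
  rw [mul_assoc]
  exact hc.trans (hcmp.trans (mul_le_mul_of_nonneg_left hE hRp))

/-- Eigenfunctions of 𝓔_0 are not known to lie in any ℍ^s with s > 0, so they are replaced by
ℍ^{1/2} approximations, on which 𝓔_s → 𝓔_0. -/
theorem IsBoundedLipschitzSet.eventually_eigenvalueNth_le (hN : 1 ≤ N)
    (hΩ : IsBoundedLipschitzSet Ω) (hne : Ω.Nonempty) (n : ℕ) {η : ℝ} (hη : 0 < η) :
    ∀ᶠ s in 𝓝[>] (0 : ℝ), eigenvalueNth Ω s n * (1 - (n + 1) * η)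
      ≤ eigenvalueNth Ω 0 n + (n + 1) * η := by
  have hΩm := hΩ.isOpen.measurableSet
  have hform := hΩ.isCompactForm hN (s := 0) le_rfl
  obtain ⟨e, lam, he⟩ := hΩ.exists_eigenSystem hN hne (s := 0) ⟨le_rfl, one_pos⟩ n
  choose v hv hvlim hvE using fun i => hΩ.exists_energy_approx_seq hN (e i)
  have hG : ∀ i j, ∀ᶠ k in atTop,
      |inner ℝ (v i k : L2 Ω) (v j k : L2 Ω) - if i = j then 1 else 0| < η := fun i j => by
    have h1 := (((hvlim i).inner (hvlim j)).sub_const (if i = j then (1 : ℝ) else 0)).abs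
    have h2 : inner ℝ (e i : L2 Ω) (e j : L2 Ω) = if i = j then (1 : ℝ) else 0 :=
      orthonormal_iff_ite.1 he.orthonormal i j
    rw [h2, sub_self, abs_zero] at h1
    exact h1.eventually_lt_const hη
  have hA : ∀ i j, ∀ᶠ k in atTop,
      |energyForm Ω 0 (v i k).1 (v j k).1 - if i = j then lam i else 0| < η := fun i j => by
    have h1 := ((hform.tendsto_apply (hvE i) (hvE j)).sub_const
      (if i = j then lam i else 0)).abs
    have h2 : energyBilin Ω 0 (e i) (e j) = if i = j then lam i else 0 := by
      rw [he.eigen, orthonormal_iff_ite.1 he.orthonormal i j]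
      split_ifs <;> simp
    rw [h2, sub_self, abs_zero] at h1
    exact h1.eventually_lt_const hη
  -- The trial family is fixed here, before s tends to 0: convergence of the forms is available only
  -- for fixed functions.
  obtain ⟨k, hk⟩ := ((eventually_all.2 fun i => eventually_all.2 (hG i)).and
    (eventually_all.2 fun i => eventually_all.2 (hA i))).exists
  have hs : ∀ i j, ∀ᶠ s in 𝓝[>] (0 : ℝ),
      |energyForm Ω s (v i k).1 (v j k).1 - if i = j then lam i else 0| < η := fun i j => by
    have h1 := (((tendsto_energyForm (by norm_num) (hv i k) (hv j k) (v i k).2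
      (v j k).2).mono_left (nhdsWithin_mono _ Ioi_subset_Ici_self)).sub_const
      (if i = j then lam i else 0)).abs
    exact h1.eventually_lt_const (hk.2 i j)
  have hhalf : ∀ᶠ s in 𝓝[>] (0 : ℝ), s < 1 / 2 :=
    mem_nhdsWithin_of_mem_nhds (Iio_mem_nhds (by norm_num))
  filter_upwards [eventually_all.2 fun i => eventually_all.2 (hs i), self_mem_nhdsWithin, hhalf]
    with s hs1 hs0 hs2
  have hsI : s ∈ Ico (0 : ℝ) 1 := ⟨le_of_lt hs0, by linarith⟩
  obtain ⟨e', lam', he'⟩ := hΩ.exists_eigenSystem hN hne hsI n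
  have hsub : energySpace Ω (1 / 2) ≤ energySpace Ω s :=
    energySpace_anti hΩm hΩ.isBounded hs2.le
  have hnn := hΩ.eigenvalueNth_nonneg hN hne hsI n
  rw [he'.eigenvalueNth_eq] at hnn ⊢
  rw [he.eigenvalueNth_eq]
  exact he'.le_of_trial hnn (fun i => ⟨(v i k).1, hsub (hv i k)⟩) lam
    (fun i => he.mono (Fin.le_last i)) (fun i j => (hk.1 i j).le) (fun i j => (hs1 i j).le)

theorem IsBoundedLipschitzSet.tendsto_eigenvalueNth (hN : 1 ≤ N)
    (hΩ : IsBoundedLipschitzSet Ω) (hne : Ω.Nonempty) (n : ℕ) :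
    Tendsto (fun s => eigenvalueNth Ω s n) (𝓝[>] 0) (𝓝 (eigenvalueNth Ω 0 n)) := by
  obtain ⟨R, hR1, hd⟩ := exists_diam_bound hΩ.isBounded
  have hR : 0 < R := one_pos.trans_le hR1
  set l := eigenvalueNth Ω 0 n
  have hunit : ∀ᶠ s in 𝓝[>] (0 : ℝ), s ∈ Ico (0 : ℝ) 1 := by
    filter_upwards [self_mem_nhdsWithin, mem_nhdsWithin_of_mem_nhds (Iio_mem_nhds one_pos)]
      with s h0 h1 using ⟨le_of_lt h0, h1⟩
  refine tendsto_order.2 ⟨fun b hb => ?_, fun b hb => ?_⟩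
  · have h1 : Tendsto (fun s : ℝ => R ^ (2 * s) * b) (𝓝[>] 0) (𝓝 b) := by
      have : Continuous fun s : ℝ => R ^ (2 * s) * b :=
        (Continuous.rpow continuous_const (by fun_prop) fun _ => Or.inl hR.ne').mul
          continuous_const
      simpa using (this.tendsto 0).mono_left nhdsWithin_le_nhds
    filter_upwards [h1.eventually_lt_const hb, hunit] with s hs hsI
    have h2 := hs.trans_le (hΩ.eigenvalueNth_zero_le hN hne hsI hR.le hd n)
    exact lt_of_mul_lt_mul_left h2 (by positivity)
  · have h1 : Tendsto (fun η : ℝ => (l + (n + 1) * η) / (1 - (n + 1) * η)) (𝓝[>] 0) (𝓝 l) := by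
      have : ContinuousAt (fun η : ℝ => (l + (n + 1) * η) / (1 - (n + 1) * η)) 0 :=
        ContinuousAt.div (by fun_prop) (by fun_prop) (by simp)
      have h2 := this.tendsto.mono_left (nhdsWithin_le_nhds (s := Ioi 0))
      simpa using h2
    have h2 : Tendsto (fun η : ℝ => 1 - ((n : ℝ) + 1) * η) (𝓝[>] 0) (𝓝 1) := by
      have : Continuous fun η : ℝ => 1 - ((n : ℝ) + 1) * η := by fun_prop
      simpa using (this.tendsto 0).mono_left (nhdsWithin_le_nhds (s := Ioi 0))
    -- Choose η so small that the Ritz bound is below b and its denominator is positive.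
    obtain ⟨η, hηb, hη1, hη0⟩ := ((h1.eventually_lt_const hb).and
      ((h2.eventually_const_lt one_pos).and self_mem_nhdsWithin)).exists
    filter_upwards [hΩ.eventually_eigenvalueNth_le hN hne n hη0] with s hs
    exact ((le_div_iff₀ hη1).2 hs).trans_lt hηb

/-- Since 𝓔_0(ξ_k, ξ_k) ≤ R^(2 s_k) λ_{n,s_k} is bounded, the ℍ⁰ compactness gives a limit.
Convergence in norm keeps it of norm 1, so it is nonzero. -/
theorem IsBoundedLipschitzSet.exists_tendsto_eigenfunction (hN : 1 ≤ N)
    (hΩ : IsBoundedLipschitzSet Ω) (hne : Ω.Nonempty) (n : ℕ) (s : ℕ → ℝ) (ξ : ℕ → L2 Ω)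
    (hs : ∀ k, s k ∈ Ioo (0 : ℝ) 1) (hs0 : Tendsto s atTop (𝓝 0))
    (hξ : ∀ k, ξ k ∈ weakEigenspace Ω (s k) (eigenvalueNth Ω (s k) n) ∧ ‖ξ k‖ = 1) :
    ∃ (φ : ℕ → ℕ) (ξ₀ : L2 Ω), StrictMono φ ∧
      ξ₀ ∈ weakEigenspace Ω 0 (eigenvalueNth Ω 0 n) ∧ ξ₀ ≠ 0 ∧
      Tendsto (fun k => ξ (φ k)) atTop (𝓝 ξ₀) := by
  have hΩm := hΩ.isOpen.measurableSet
  have hform := hΩ.isCompactForm hN (s := 0) le_rfl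
  obtain ⟨R, hR1, hd⟩ := exists_diam_bound hΩ.isBounded
  have hR : 0 < R := one_pos.trans_le hR1
  set l := eigenvalueNth Ω 0 n with hl
  set lam : ℕ → ℝ := fun k => eigenvalueNth Ω (s k) n with hlam
  have hs0' : Tendsto s atTop (𝓝[>] 0) :=
    tendsto_nhdsWithin_iff.2 ⟨hs0, Eventually.of_forall fun k => (hs k).1⟩
  have hlamlim : Tendsto lam atTop (𝓝 l) := (hΩ.tendsto_eigenvalueNth hN hne n).comp hs0'
  have hRlim : Tendsto (fun k => R ^ (2 * s k)) atTop (𝓝 1) := by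
    have : Continuous fun t : ℝ => R ^ (2 * t) :=
      Continuous.rpow continuous_const (by fun_prop) fun _ => Or.inl hR.ne'
    simpa [Function.comp_def] using (this.tendsto 0).comp hs0
  have hξs : ∀ k, ξ k ∈ energySpace Ω (s k) := fun k => (mem_weakEigenspace_iff.1 (hξ k).1).1
  have hanti : ∀ k, energySpace Ω (s k) ≤ energySpace Ω 0 := fun k =>
    energySpace_anti hΩm hΩ.isBounded (hs k).1.le
  set X : ℕ → energySpace Ω 0 := fun k => ⟨ξ k, hanti k (hξs k)⟩ with hX
  have heig : ∀ k, ∀ v ∈ energySpace Ω (s k),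
      energyForm Ω (s k) (ξ k) v = lam k * inner ℝ (ξ k) v := fun k =>
    (mem_weakEigenspace_iff.1 (hξ k).1).2
  have hself : ∀ k, energyForm Ω (s k) (ξ k) (ξ k) = lam k := fun k => by
    rw [heig k _ (hξs k), real_inner_self_eq_norm_sq, (hξ k).2, one_pow, mul_one]
  have hcmp : ∀ k, ∀ u ∈ energySpace Ω (s k),
      energyForm Ω 0 u u ≤ R ^ (2 * s k) * energyForm Ω (s k) u u := fun k u hu => by
    have := energyForm_le_of_le hΩm (hs k).1.le hR.le hd hu
    rwa [sub_zero] at this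
  obtain ⟨C, hC⟩ := (hRlim.mul hlamlim).bddAbove_range
  obtain ⟨φ, ξ₀, hφ, hlim⟩ := hform.compact X (max 1 C)
    (fun k => ((hξ k).2.le).trans (le_max_left _ _)) (fun k => by
      have h1 := hcmp k _ (hξs k)
      rw [hself] at h1
      exact (h1.trans (hC ⟨k, rfl⟩)).trans (le_max_right _ _))
  have hlimξ : Tendsto (fun k => ξ (φ k)) atTop (𝓝 ξ₀) := hlim
  have hφt := hφ.tendsto_atTop
  obtain ⟨hξ0, -⟩ := hform.lsc_of_tendsto hlim (c := fun k => R ^ (2 * s (φ k)) * lam (φ k))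
    (Eventually.of_forall fun k => by
      have h1 := hcmp (φ k) _ (hξs (φ k))
      rwa [hself] at h1) ((hRlim.mul hlamlim).comp hφt)
  set x : energySpace Ω 0 := ⟨ξ₀, hξ0⟩ with hx
  have hsmooth : ∀ v : energySpace Ω 0, (v : L2 Ω) ∈ energySpace Ω (1 / 2) →
      energyBilin Ω 0 x v = l * inner ℝ ξ₀ (v : L2 Ω) := fun v hv => by
    -- Lower semicontinuity along ξ_k + t v bounds 𝓔_0(ξ + t v, ξ + t v) by the limit of R^(2 s_k)
    -- 𝓔_{s_k}(ξ_k + t v, ξ_k + t v), which the eigenvalue equation computes. The terms t² 𝓔_0(v, v)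
    -- cancel, leaving t b ≤ c for all real t.
    have hkey : ∀ t : ℝ, t * (2 * (energyBilin Ω 0 x v - l * inner ℝ ξ₀ (v : L2 Ω)))
        ≤ l - energyBilin Ω 0 x x := fun t => by
      have hev : ∀ᶠ k in atTop, energyBilin Ω 0 (X (φ k) + t • v) (X (φ k) + t • v)
          ≤ R ^ (2 * s (φ k)) * (lam (φ k) + 2 * t * (lam (φ k) * inner ℝ (ξ (φ k)) (v : L2 Ω))
            + t ^ 2 * energyForm Ω (s (φ k)) v.1 v.1) := by
        filter_upwards [(hs0.comp hφt).eventually_lt_const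
          (by norm_num : (0 : ℝ) < 1 / 2)] with k hk
        have hvk : (v : L2 Ω) ∈ energySpace Ω (s (φ k)) :=
          energySpace_anti hΩm hΩ.isBounded (le_of_lt hk) hv
        have hmem : ξ (φ k) + t • (v : L2 Ω) ∈ energySpace Ω (s (φ k)) :=
          Submodule.add_mem _ (hξs _) (Submodule.smul_mem _ _ hvk)
        have h1 := hcmp (φ k) _ hmem
        have h2 := (hΩ.isCompactForm hN (hs (φ k)).1.le).apply_add_smul
          ⟨ξ (φ k), hξs (φ k)⟩ ⟨v, hvk⟩ t
        have h3 : energyForm Ω (s (φ k)) (ξ (φ k) + t • (v : L2 Ω) : L2 Ω)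
            (ξ (φ k) + t • (v : L2 Ω) : L2 Ω) = energyForm Ω (s (φ k)) (ξ (φ k)) (ξ (φ k))
            + 2 * t * energyForm Ω (s (φ k)) (ξ (φ k)) v.1
            + t ^ 2 * energyForm Ω (s (φ k)) v.1 v.1 := h2
        rw [h3, hself, heig _ _ hvk] at h1
        exact h1
      have hrhs := (hRlim.comp hφt).mul (((hlamlim.comp hφt).add
        (((hlamlim.comp hφt).mul (hlimξ.inner (tendsto_const_nhds (x := (v : L2 Ω))))).const_mul
          (2 * t))).add (((tendsto_energyForm (by norm_num) hv hv v.2 v.2).comp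
          (tendsto_nhdsWithin_iff.2 ⟨hs0.comp hφt,
            Eventually.of_forall fun k => (hs (φ k)).1.le⟩)).const_mul (t ^ 2)))
      have hconv : Tendsto (fun k => ((X (φ k) + t • v : energySpace Ω 0) : L2 Ω)) atTop
          (𝓝 (ξ₀ + t • (v : L2 Ω))) := hlimξ.add_const _
      obtain ⟨_, hle⟩ := hform.lsc_of_tendsto hconv hev hrhs
      have hle' : energyBilin Ω 0 (x + t • v) (x + t • v)
          ≤ 1 * (l + 2 * t * (l * inner ℝ ξ₀ (v : L2 Ω)) + t ^ 2 * energyBilin Ω 0 v v) := hle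
      rw [hform.apply_add_smul] at hle'
      linarith
    linarith [eq_zero_of_forall_mul_le hkey]
  refine ⟨φ, ξ₀, hφ, mem_weakEigenspace_iff.2 ⟨hξ0, fun v hv => ?_⟩, ?_, hlimξ⟩
  -- The weak equation passes from ℍ^{1/2} to all of ℍ⁰ by density in the form norm.
  · obtain ⟨w, hw, hwlim, hwE⟩ := hΩ.exists_energy_approx_seq hN ⟨v, hv⟩
    have h1 := hform.tendsto_apply (u := fun _ => x) (x := x) (by simp) hwE
    have h2 : Tendsto (fun k => l * inner ℝ ξ₀ (w k : L2 Ω)) atTop (𝓝 (l * inner ℝ ξ₀ v)) :=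
      ((tendsto_const_nhds (x := ξ₀)).inner hwlim).const_mul l
    exact tendsto_nhds_unique (h1.congr fun k => hsmooth (w k) (hw k)) h2
  · have h1 := hlimξ.norm
    simp only [(hξ _).2] at h1
    have h2 : ‖ξ₀‖ = 1 := tendsto_nhds_unique h1 tendsto_const_nhds
    rintro rfl
    simp at h2

end Convergence

/-! ### The main theorem -/

theorem mainTheorem6 {N : ℕ} (hN : 1 ≤ N) (Ω : Set (EuclideanSpace ℝ (Fin N)))
    (hΩ : IsBoundedLipschitzSet Ω) (hne : Ω.Nonempty) (n : ℕ) (hn : 1 ≤ n) :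
    (∀ s ∈ Ico (0 : ℝ) 1,
      0 < eigenvalueNth Ω s n ∧ IsEigenvalueNth Ω s n (eigenvalueNth Ω s n)) ∧
    Tendsto (fun s => eigenvalueNth Ω s n) (𝓝[>] 0) (𝓝 (eigenvalueNth Ω 0 n)) ∧
    ∀ (s : ℕ → ℝ) (ξ : ℕ → L2 Ω),
      (∀ k, s k ∈ Ioo (0 : ℝ) 1) → Tendsto s atTop (𝓝 0) →
      (∀ k, ξ k ∈ weakEigenspace Ω (s k) (eigenvalueNth Ω (s k) n) ∧ ‖ξ k‖ = 1) →
      ∃ (φ : ℕ → ℕ) (ξ₀ : L2 Ω), StrictMono φ ∧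
        ξ₀ ∈ weakEigenspace Ω 0 (eigenvalueNth Ω 0 n) ∧ ξ₀ ≠ 0 ∧
        Tendsto (fun k => ξ (φ k)) atTop (𝓝 ξ₀) := by
  refine ⟨fun s hs => ?_, hΩ.tendsto_eigenvalueNth hN hne n,
    hΩ.exists_tendsto_eigenfunction hN hne n⟩
  obtain ⟨e, lam, he⟩ := hΩ.exists_eigenSystem hN hne hs n
  rw [he.eigenvalueNth_eq]
  exact ⟨he.last_pos hΩ.isOpen hne hn, he.rank_eigenSpan_Iio_le, he.lt_rank_eigenSpan_Iic le_rfl⟩
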